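/- There are a single deterministic algorithm on the unit-cost word RAM and absolute constants $c\ge 1$ and $C$ such that the following holds for every real $\varepsilon\in(0,1)$, presented to the algorithm by a fraction $p/q$ of natural numbers with $\varepsilon/2\le p/q\le\varepsilon$ (for rational $\varepsilon$ one may take $p/q=\varepsilon$), every $n\ge 1$, and every word length $w$ with $2^w\ge (n+q)^c$ (so words of $O(\log(n+q))$ bits suffice). Let $G$ be a graph on the vertex set $\{0,\dots,n-1\}$ that initially has no edges and undergoes a sequence of $m$ edge insertions, each adding one new edge, such that $G$ stays a simple bipartite graph (no bipartition is given to the algorithm). The insertions are revealed to the algorithm one at a time. Initially and after every insertion, the algorithm has explicitly stored in its memory a matching $M$ of the current graph $G$ with $|M|\ge (1-\varepsilon)\,\mu(G)$, where $\mu(G)$ denotes the maximum size of a matching of $G$. Its total update time (the number of steps for the initialization and all $m$ insertions together) is at most $C\left(n/\varepsilon^{6}+m/\varepsilon^{5}\right)$, that is, $O(n/\varepsilon^6+m/\varepsilon^5)$. -/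

import Mathlib

/-! ## A unit-cost word RAM

A machine has finitely many named registers (a program mentions only finitely many) and a random
access memory, all holding `w`-bit words, i.e. natural numbers below `2 ^ w`. Programs are
structured programs over the usual word operations; every operation, register access, memory
access and test costs one unit of time. -/

namespace WordRAM

/-- Registers and memory. -/
structure State where
  reg : ℕ → ℕ
  mem : ℕ → ℕ

/-- Binary word operations. -/
inductive BinOp where
  | add | sub | mul | div | mod | lt | eq

/-- The value of an operation on `w`-bit words: addition and multiplication are modulo `2 ^ w`,
subtraction is truncated at `0`, division rounds down, comparisons return `1` or `0`. -/
def BinOp.eval (w : ℕ) : BinOp → ℕ → ℕ → ℕ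
  | .add, a, b => (a + b) % 2 ^ w
  | .sub, a, b => a - b
  | .mul, a, b => (a * b) % 2 ^ w
  | .div, a, b => a / b
  | .mod, a, b => a % b
  | .lt, a, b => (if a < b then 1 else 0) % 2 ^ w
  | .eq, a, b => (if a = b then 1 else 0) % 2 ^ w

/-- Expressions: constants, registers, memory access at a computed address, word operations. -/
inductive Expr where
  | const (c : ℕ)
  | reg (i : ℕ)
  | load (addr : Expr)
  | op (o : BinOp) (a b : Expr)

/-- The value of an expression in a state. -/
def Expr.eval (w : ℕ) (s : State) : Expr → ℕ
  | .const c => c % 2 ^ w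
  | .reg i => s.reg i
  | .load a => s.mem (a.eval w s)
  | .op o a b => o.eval w (a.eval w s) (b.eval w s)

/-- The time to evaluate an expression: the number of its nodes. -/
def Expr.cost : Expr → ℕ
  | .const _ => 1
  | .reg _ => 1
  | .load a => a.cost + 1
  | .op _ a b => a.cost + b.cost + 1

/-- Programs. A test succeeds when the value of its expression is not `0`. -/
inductive Prog where
  | skip
  | assign (i : ℕ) (e : Expr)
  | store (addr val : Expr)
  | seq (P Q : Prog)
  | ite (e : Expr) (P Q : Prog)
  | loop (e : Expr) (P : Prog)

/-- `Exec w P s t s'`: on a machine with word length `w`, the program `P` started in the state `s`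
halts after exactly `t` time units in the state `s'`. -/
inductive Exec (w : ℕ) : Prog → State → ℕ → State → Prop where
  | skip (s : State) : Exec w .skip s 1 s
  | assign (i : ℕ) (e : Expr) (s : State) :
      Exec w (.assign i e) s (e.cost + 1)
        { s with reg := Function.update s.reg i (e.eval w s) }
  | store (a e : Expr) (s : State) :
      Exec w (.store a e) s (a.cost + e.cost + 1)
        { s with mem := Function.update s.mem (a.eval w s) (e.eval w s) }
  | seq {P Q : Prog} {s₁ s₂ s₃ : State} {t₁ t₂ : ℕ} :
      Exec w P s₁ t₁ s₂ → Exec w Q s₂ t₂ s₃ → Exec w (.seq P Q) s₁ (t₁ + t₂) s₃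
  | ite_true {e : Expr} {P Q : Prog} {s s' : State} {t : ℕ} :
      e.eval w s ≠ 0 → Exec w P s t s' → Exec w (.ite e P Q) s (e.cost + 1 + t) s'
  | ite_false {e : Expr} {P Q : Prog} {s s' : State} {t : ℕ} :
      e.eval w s = 0 → Exec w Q s t s' → Exec w (.ite e P Q) s (e.cost + 1 + t) s'
  | loop_true {e : Expr} {P : Prog} {s₁ s₂ s₃ : State} {t₁ t₂ : ℕ} :
      e.eval w s₁ ≠ 0 → Exec w P s₁ t₁ s₂ → Exec w (.loop e P) s₂ t₂ s₃ →
      Exec w (.loop e P) s₁ (e.cost + 1 + t₁ + t₂) s₃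
  | loop_false {e : Expr} {P : Prog} {s : State} :
      e.eval w s = 0 → Exec w (.loop e P) s (e.cost + 1) s

/-- The machine is deterministic: running time and final state are determined by the program and
the initial state. -/
theorem Exec.deterministic {w : ℕ} {P : Prog} {s s₁ s₂ : State} {t₁ t₂ : ℕ}
    (h₁ : Exec w P s t₁ s₁) (h₂ : Exec w P s t₂ s₂) : t₁ = t₂ ∧ s₁ = s₂ := by
  induction h₁ generalizing t₂ s₂ with
  | skip => cases h₂; exact ⟨rfl, rfl⟩
  | assign => cases h₂; exact ⟨rfl, rfl⟩
  | store => cases h₂; exact ⟨rfl, rfl⟩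
  | seq _ _ ih₁ ih₂ =>
    cases h₂ with
    | seq a b =>
      obtain ⟨rfl, rfl⟩ := ih₁ a
      obtain ⟨rfl, rfl⟩ := ih₂ b
      exact ⟨rfl, rfl⟩
  | ite_true h _ ih =>
    cases h₂ with
    | ite_true _ a => obtain ⟨rfl, rfl⟩ := ih a; exact ⟨rfl, rfl⟩
    | ite_false h' _ => exact absurd h' h
  | ite_false h _ ih =>
    cases h₂ with
    | ite_true h' _ => exact absurd h h'
    | ite_false _ a => obtain ⟨rfl, rfl⟩ := ih a; exact ⟨rfl, rfl⟩
  | loop_true h _ _ ih₁ ih₂ =>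
    cases h₂ with
    | loop_true _ a b =>
      obtain ⟨rfl, rfl⟩ := ih₁ a
      obtain ⟨rfl, rfl⟩ := ih₂ b
      exact ⟨rfl, rfl⟩
    | loop_false h' => exact absurd h' h
  | loop_false h =>
    cases h₂ with
    | loop_true h' _ _ => exact absurd h h'
    | loop_false _ => exact ⟨rfl, rfl⟩

end WordRAM

/-! ## Incremental matching algorithms on the word RAM -/

namespace IncrementalMatching

open WordRAM

/-- A dynamic algorithm for graphs under edge insertions: a program run once at the beginning and
a program run at every edge insertion. -/
structure Algorithm where
  init : Prog
  insert : Prog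

/-- The state in which the initialization starts: all memory cells and registers are `0`, except
that registers `0`, `1`, `2` hold the number `n` of vertices and the numerator and denominator of
the accuracy parameter `p / q`. -/
def startState (n p q : ℕ) : State where
  reg := fun i => if i = 0 then n else if i = 1 then p else if i = 2 then q else 0
  mem := fun _ => 0

/-- The request to insert the edge `uv`: the endpoints are written into registers `0` and `1`. -/
def request (s : State) (u v : ℕ) : State :=
  { s with reg := Function.update (Function.update s.reg 0 u) 1 v }

/-- The run of the algorithm on the insertion sequence `es`: the initialization takes time `t 0`
and leads to the state `s 0`; the `i`-th insertion (counted from `0`) takes time `t (i + 1)` and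
leads from the state `s i` to the state `s (i + 1)`. -/
def IsRun (A : Algorithm) (w n p q : ℕ) (es : List (Fin n × Fin n))
    (s : ℕ → State) (t : ℕ → ℕ) : Prop :=
  Exec w A.init (startState n p q) (t 0) (s 0) ∧
  ∀ (i : ℕ) (hi : i < es.length),
    Exec w A.insert (request (s i) (es[i].1 : ℕ) (es[i].2 : ℕ)) (t (i + 1)) (s (i + 1))

/-- The simple graph on the vertices `0, …, n - 1` whose edges are the listed ones. -/
def graphOf {n : ℕ} (es : List (Fin n × Fin n)) : SimpleGraph (Fin n) :=
  SimpleGraph.fromEdgeSet {e | ∃ x ∈ es, e = s(x.1, x.2)}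

/-- A sequence of edge insertions: no loops, and every insertion adds a new (undirected) edge. -/
def IsInsertionSequence {n : ℕ} (es : List (Fin n × Fin n)) : Prop :=
  (∀ x ∈ es, x.1 ≠ x.2) ∧ (es.map fun x => s(x.1, x.2)).Nodup

/-- The maximum number of edges of a matching. -/
noncomputable def matchingNumber {V : Type*} (G : SimpleGraph V) : ℕ :=
  sSup {k | ∃ M : G.Subgraph, M.IsMatching ∧ M.edgeSet.ncard = k}

/-- The matching `M` is stored explicitly in the memory cells `0, …, n - 1`: the cell of a vertex
holds `0` if the vertex is unmatched and `u + 1` if it is matched to the vertex `u`. -/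
def Stores {n : ℕ} {G : SimpleGraph (Fin n)} (s : State) (M : G.Subgraph) : Prop :=
  ∀ v : Fin n, (∀ u : Fin n, s.mem v = u + 1 ↔ M.Adj v u) ∧ (s.mem v = 0 ↔ v ∉ M.verts)

end IncrementalMatching

/-!
The algorithm keeps, besides the graph `G`, a sparse multigraph `H` of copies of edges of `G` (the
sparsifier), and the stored matching is recomputed from `H` when it has become too small. With
`k ≥ 8 / ε` and `β = bet k = k (2 k + 1)`, the degrees `d` in `H` satisfy

* `d u + d v ≤ β` for every edge of `H` (`Lim`), and
* `d u + d v ≥ β - 1` for every edge of `G`, except at *dead* vertices (`Pend`).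

*Size.* Let `cov k d ∈ [0, k]` rise linearly from `0` to `k` while `d` passes the window
`[k ^ 2, k ^ 2 + k]` around `β / 2`, and let `D = ∑ cov k (d v)`. By the second property, `cov`,
together with `k` on the dead vertices, is a vertex cover of `G` up to an error of `1` per edge
(`Pend.cover`), so `(k - 1) μ(G) ≤ D + k Z` for `Z` dead vertices (`mul_ncard_le`). Conversely, by
the first property, the edges of `H` carry a fractional matching of size `D / k` that overloads no
vertex by more than the factor `1 + 1 / k`, so by weak duality `D` exceeds no vertex cover of `H`
(scaled by `k`) by more than this factor (`sum_cov_le_cover`). An auction on `H`, with integer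
prices up to `k`, yields a matching and a vertex cover which differ by the factor `1 + 1 / k`
(`Auction.cover`, `Auction.sum_cover`); hence `k D ≤ (k + 1) ^ 2 |M|` after a rebuild.
A rebuild takes place as soon as `D > (k + 5) |M|`, and so `|M| ≥ (1 - ε) μ(G)` at all times (`Ready.matchingNumber_le`).

*Number of changes.* The potential `2 β ∑ d - 2 ∑ d ^ 2 - ∑ d` grows by at least `2` whenever an
edge violating one of the two properties is added to or removed from `H` (`Good.pot`), so there are
at most `β ∑ d ≤ β ^ 2 n` changes (`Good.ops_le`), each of which takes time `O(β)`. A vertex that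
ends up with a smaller degree is put on a stack, and all its edges in `G` are scanned again. After
`thr k` scans it is declared dead, so all scans together take time `O(thr k * m)`. Every scan is
caused by a change of `H`, which is why few vertices die (`Good.dead_le`): `k Z ≤ D / k`.

*Rebuilds.* Since `H` has `O(β |M|)` edges for the new matching `M` (`Good.mul_sum_deg_le`), a
rebuild (clearing, two-colouring `H` by depth-first search, auction) takes time `O(β ^ 2 |M|)`. The
condition that triggers it makes `|M|` larger than before by a factor `1 + Ω(1 / k)`, so this time
is paid for by `β ^ 2 (k + 5)` times the growth of `|M|` (`rebuild_time`). With `β = O(ε⁻²)` and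
`thr k = O(ε⁻⁵)` the total is `O(n / ε ^ 6 + m / ε ^ 5)` (`time_le`).

*The machine.* `Rn` is a program logic whose postconditions mention the running time; `enc` lays out
the arrays of the algorithm in the memory, and `Fits` makes sure that no operation overflows.
-/

namespace IncrementalMatching

open Finset WordRAM

/-! ### Covers and fractional matchings -/

/-- The bound on the sum of the degrees of the endpoints of an edge of the sparsifier. -/
def bet (k : ℕ) : ℕ := k * (2 * k + 1)

/-- The number of scans after which a vertex is given up. -/
def thr (k : ℕ) : ℕ := 4 * bet k * bet k * k

/-- The vertex cover value, scaled by `k`, of a vertex of degree `d` in the sparsifier: it rises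
linearly from `0` to `k` in the window `[k ^ 2, k ^ 2 + k]` around `bet k / 2`. -/
def cov (k d : ℕ) : ℕ := (d - k * k) - ((d - k * k) - k)

theorem cov_le (k d : ℕ) : cov k d ≤ k := by unfold cov; omega

theorem bet_eq (k : ℕ) : bet k = 2 * (k * k) + k := by unfold bet; ring

/-- The window is placed such that two degrees adding up to at least `bet k - 1` have cover values
adding up to `k`, up to an error of `1`. -/
theorem cov_add_cov {k a b : ℕ} (h : bet k ≤ a + b + 1) : k ≤ cov k a + cov k b + 1 := by
  rw [bet_eq] at h; unfold cov; generalize k * k = q at *; omega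

/-- Multiplied by `a * b`: the value `cov k a / a + cov k b / b` of an edge whose endpoints have the
degrees `a` and `b` is at most `(k + 1) / a`. This holds because the window is narrow, of width `k`,
at the distance `k ^ 2` from `0`. -/
theorem mul_cov_add_le {k a b : ℕ} (h : a + b ≤ bet k) :
    a * cov k b + b * cov k a ≤ b * (k + 1) := by
  rw [bet_eq] at h
  rcases Nat.lt_or_ge (k * k) b with hb | hb
  · obtain ⟨s, rfl⟩ := Nat.exists_eq_add_of_lt hb
    rcases Nat.lt_or_ge (k * k) a with ha | ha
    · obtain ⟨t, rfl⟩ := Nat.exists_eq_add_of_lt ha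
      have h1 : cov k (k * k + s + 1) = s + 1 := by
        unfold cov; generalize k * k = q at *; omega
      have h2 : cov k (k * k + t + 1) = t + 1 := by
        unfold cov; generalize k * k = q at *; omega
      rw [h1, h2]
      have h3 : (s + 1) + (t + 1) ≤ k := by generalize k * k = q at *; omega
      nlinarith [Nat.mul_le_mul h3 h3, Nat.mul_le_mul_left (k * k) h3, sq_nonneg ((s : ℤ) - t),
        Nat.zero_le ((s + 1) * k), Nat.mul_le_mul_left s h3, Nat.mul_le_mul_left t h3]
    · have h2 : cov k a = 0 := by unfold cov; omega
      rw [h2]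
      have := Nat.mul_le_mul (ha.trans hb.le) (cov_le k (k * k + s + 1))
      nlinarith
  · have h1 : cov k b = 0 := by unfold cov; omega
    rw [h1]
    have := Nat.mul_le_mul_left b (cov_le k a)
    nlinarith

/-- Weak duality for the sparsifier: the fractional matching that gives each copy of an edge `uv`
the value `cov (d u) / d u + cov (d v) / d v` has size `∑ cov (d u)`, and it overloads no vertex
by more than the factor `1 + 1 / k`, so it is bounded by any vertex cover `P` of the edges. -/
theorem sum_cov_le_cover {n k : ℕ} {w : ℕ → ℕ → ℕ} {d P : ℕ → ℕ}
    (sym : ∀ u v, w u v = w v u) (hd : ∀ u < n, ∑ v ∈ range n, w u v = d u)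
    (hle : ∀ u < n, ∀ v < n, 0 < w u v → d u + d v ≤ bet k)
    (hP : ∀ u < n, ∀ v < n, 0 < w u v → k ≤ P u + P v) :
    k * ∑ u ∈ range n, cov k (d u) ≤ (k + 1) * ∑ u ∈ range n, P u := by
  have pos : ∀ u < n, ∀ v < n, 0 < w u v → 0 < d u := by
    intro u hu v hv h
    rw [← hd u hu]
    exact h.trans_le (Finset.single_le_sum (f := w u) (fun _ _ => Nat.zero_le _)
      (Finset.mem_range.2 hv))
  -- The contribution of the endpoint `v` to the value of an edge.
  let g : ℕ → ℚ := fun v => (cov k (d v) : ℚ) / d v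
  have hg : ∀ v < n, (cov k (d v) : ℚ) = ∑ u ∈ range n, (w u v : ℚ) * g v := by
    intro v hv
    rw [← Finset.sum_mul]
    have : (∑ u ∈ range n, (w u v : ℚ)) = d v := by
      rw [← hd v hv]; push_cast
      exact Finset.sum_congr rfl fun u _ => by rw [sym]
    rw [this]
    by_cases h : d v = 0
    · simp [g, h, cov]
    · have : (d v : ℚ) ≠ 0 := by exact_mod_cast h
      simp only [g]; field_simp
  have key : ∀ u < n, ∑ v ∈ range n, (w u v : ℚ) * (P u * (g u + g v)) ≤ (k + 1) * P u := by
    intro u hu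
    have h1 : ∀ v ∈ range n, (w u v : ℚ) * (P u * (g u + g v)) ≤
        w u v * (P u * ((k + 1) / d u)) := by
      intro v hv
      rw [Finset.mem_range] at hv
      rcases Nat.eq_zero_or_pos (w u v) with h | h
      · simp [h]
      have hu' : (0 : ℚ) < d u := by exact_mod_cast pos u hu v hv h
      have hv' : (0 : ℚ) < d v := by exact_mod_cast pos v hv u hu (sym u v ▸ h)
      have h2 : ((d u : ℚ) * cov k (d v) + d v * cov k (d u)) ≤ d v * (k + 1) := by
        exact_mod_cast mul_cov_add_le (hle u hu v hv h)
      gcongr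
      simp only [g]
      rw [div_add_div _ _ hu'.ne' hv'.ne', div_le_div_iff₀ (by positivity) hu']
      nlinarith
    refine (Finset.sum_le_sum h1).trans ?_
    rw [← Finset.sum_mul]
    have : (∑ v ∈ range n, (w u v : ℚ)) = d u := by rw [← hd u hu]; push_cast; rfl
    rw [this]
    by_cases h : d u = 0
    · simp [h]; positivity
    · have : (d u : ℚ) ≠ 0 := by exact_mod_cast h
      apply le_of_eq; field_simp
  have main : (k : ℚ) * ∑ u ∈ range n, (cov k (d u) : ℚ) ≤ (k + 1) * ∑ u ∈ range n, (P u : ℚ) := by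
    calc (k : ℚ) * ∑ u ∈ range n, (cov k (d u) : ℚ)
        = ∑ v ∈ range n, ∑ u ∈ range n, (w u v : ℚ) * g v * k := by
          rw [Finset.mul_sum]
          refine Finset.sum_congr rfl fun v hv => ?_
          rw [← Finset.sum_mul, ← hg v (Finset.mem_range.1 hv)]; ring
      _ ≤ ∑ v ∈ range n, ∑ u ∈ range n, (w u v : ℚ) * g v * (P u + P v) := by
          refine Finset.sum_le_sum fun v hv => Finset.sum_le_sum fun u hu => ?_
          rw [Finset.mem_range] at hu hv
          rcases Nat.eq_zero_or_pos (w u v) with h | h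
          · simp [h]
          have : (k : ℚ) ≤ P u + P v := by exact_mod_cast hP u hu v hv h
          have : 0 ≤ g v := by simp only [g]; positivity
          gcongr
      _ = ∑ u ∈ range n, ∑ v ∈ range n, (w u v : ℚ) * (P u * (g u + g v)) := by
          have e1 : ∑ v ∈ range n, ∑ u ∈ range n, (w u v : ℚ) * g v * (P u + P v)
              = ∑ v ∈ range n, ∑ u ∈ range n, (w u v : ℚ) * g v * P u
                + ∑ v ∈ range n, ∑ u ∈ range n, (w u v : ℚ) * g v * P v := by
            simp only [← Finset.sum_add_distrib, mul_add]
          rw [e1, Finset.sum_comm (f := fun v u => (w u v : ℚ) * g v * P u),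
            ← Finset.sum_add_distrib]
          refine Finset.sum_congr rfl fun u _ => ?_
          rw [← Finset.sum_add_distrib]
          refine Finset.sum_congr rfl fun v _ => ?_
          rw [sym v u]; ring
      _ ≤ ∑ u ∈ range n, ((k : ℚ) + 1) * P u :=
          Finset.sum_le_sum fun u hu => key u (Finset.mem_range.1 hu)
      _ = _ := by rw [Finset.mul_sum]
  exact_mod_cast main

/-- The number of copies of edges is bounded by a cover of the sparsifier. -/
theorem sum_deg_le_cover {n k b : ℕ} {w : ℕ → ℕ → ℕ} {d y : ℕ → ℕ}
    (sym : ∀ u v, w u v = w v u) (hd : ∀ u < n, ∑ v ∈ range n, w u v = d u)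
    (hb : ∀ u < n, d u ≤ b)
    (hy : ∀ u < n, ∀ v < n, 0 < w u v → k ≤ y u + y v + 1) :
    k * ∑ u ∈ range n, d u ≤ 2 * b * (∑ u ∈ range n, y u) + ∑ u ∈ range n, d u := by
  have h1 : ∑ u ∈ range n, d u * y u ≤ b * ∑ u ∈ range n, y u := by
    rw [Finset.mul_sum]
    exact Finset.sum_le_sum fun u hu => Nat.mul_le_mul_right _ (hb u (Finset.mem_range.1 hu))
  have h2 : ∑ u ∈ range n, ∑ v ∈ range n, w u v * y u = ∑ u ∈ range n, d u * y u := by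
    refine Finset.sum_congr rfl fun u hu => ?_
    rw [← Finset.sum_mul, hd u (Finset.mem_range.1 hu)]
  have h3 : ∑ u ∈ range n, ∑ v ∈ range n, w u v * y v = ∑ u ∈ range n, d u * y u := by
    rw [Finset.sum_comm, ← h2]
    exact Finset.sum_congr rfl fun u _ => Finset.sum_congr rfl fun v _ => by rw [sym]
  have h4 : ∑ u ∈ range n, ∑ v ∈ range n, w u v = ∑ u ∈ range n, d u :=
    Finset.sum_congr rfl fun u hu => hd u (Finset.mem_range.1 hu)
  have h5 : k * ∑ u ∈ range n, d u ≤ ∑ u ∈ range n, ∑ v ∈ range n,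
      (w u v * y u + w u v * y v + w u v) := by
    rw [← h4, Finset.mul_sum]
    refine Finset.sum_le_sum fun u hu => ?_
    rw [Finset.mul_sum]
    refine Finset.sum_le_sum fun v hv => ?_
    rw [Finset.mem_range] at hu hv
    rcases Nat.eq_zero_or_pos (w u v) with h | h
    · simp [h]
    · have := Nat.mul_le_mul_left (w u v) (hy u hu v hv h)
      nlinarith
  simp only [Finset.sum_add_distrib] at h5
  rw [h2, h3, h4] at h5
  nlinarith

/-- Few vertices are given up: if each of the `Z` dead vertices accounts for `thr k` of at most
`ops` operations, they add only a `1 / k` fraction to the cover value `D`. -/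
theorem dead_le {k Z D S ops : ℕ} (hk : 8 ≤ k) (h1 : thr k * Z ≤ ops) (h2 : ops ≤ bet k * S)
    (h3 : k * S ≤ 2 * bet k * (D + k * Z) + S) : k * (k * Z) ≤ D := by
  obtain ⟨j, rfl⟩ : ∃ j, k = j + 1 := ⟨k - 1, by omega⟩
  have hb : 0 < bet (j + 1) := by unfold bet; positivity
  set b := bet (j + 1)
  have h4 : j * S ≤ 2 * b * (D + (j + 1) * Z) := by nlinarith
  have h5 : 4 * b * b * (j + 1) * Z * j ≤ b * (2 * b * (D + (j + 1) * Z)) := by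
    calc 4 * b * b * (j + 1) * Z * j ≤ b * S * j := Nat.mul_le_mul_right _ (h1.trans h2)
      _ = b * (j * S) := by ring
      _ ≤ _ := Nat.mul_le_mul_left _ h4
  have h6 : 2 * (j + 1) * Z * j ≤ D + (j + 1) * Z := by
    refine Nat.le_of_mul_le_mul_left (c := 2 * b * b) ?_ (by positivity)
    nlinarith
  have h7 : 7 * ((j + 1) * Z) ≤ j * ((j + 1) * Z) := Nat.mul_le_mul_right _ (by omega)
  nlinarith

/-- The change of a sum when one value of `d` changes, without subtraction. -/
theorem sum_update {n u : ℕ} (hu : u < n) (f : ℕ → ℕ → ℕ) (d : ℕ → ℕ) (x : ℕ) :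
    ∑ v ∈ range n, f v (Function.update d u x v) + f u (d u)
      = ∑ v ∈ range n, f v (d v) + f u x := by
  have hm : u ∈ range n := Finset.mem_range.2 hu
  rw [← Finset.add_sum_erase _ _ hm, ← Finset.add_sum_erase (range n) (fun v => f v (d v)) hm]
  have : ∑ v ∈ (range n).erase u, f v (Function.update d u x v)
      = ∑ v ∈ (range n).erase u, f v (d v) :=
    Finset.sum_congr rfl fun v hv => by rw [Function.update_of_ne (Finset.ne_of_mem_erase hv)]
  rw [this, Function.update_self]; ring

/-! ### A program logic for the word RAM -/

infixr:30 " ;; " => Prog.seq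

instance : Add Expr := ⟨Expr.op .add⟩
instance : Sub Expr := ⟨Expr.op .sub⟩
instance : Mul Expr := ⟨Expr.op .mul⟩

/-- The comparison of two words. -/
def ltE (a b : Expr) : Expr := .op .lt a b

/-- The equality test of two words. -/
def eqE (a b : Expr) : Expr := .op .eq a b

section Eval
variable (w : ℕ) (s : State) (a b : Expr)

@[simp] theorem eval_add : (a + b).eval w s = (a.eval w s + b.eval w s) % 2 ^ w := rfl
@[simp] theorem eval_sub : (a - b).eval w s = a.eval w s - b.eval w s := rfl
@[simp] theorem eval_mul : (a * b).eval w s = (a.eval w s * b.eval w s) % 2 ^ w := rfl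
@[simp] theorem eval_const (c : ℕ) : (Expr.const c).eval w s = c % 2 ^ w := rfl
@[simp] theorem eval_reg (i : ℕ) : (Expr.reg i).eval w s = s.reg i := rfl
@[simp] theorem eval_load : (Expr.load a).eval w s = s.mem (a.eval w s) := rfl
@[simp] theorem eval_ltE :
    (ltE a b).eval w s = (if a.eval w s < b.eval w s then 1 else 0) % 2 ^ w := rfl
@[simp] theorem eval_eqE :
    (eqE a b).eval w s = (if a.eval w s = b.eval w s then 1 else 0) % 2 ^ w := rfl

end Eval

/-- The data of the algorithm as arrays and counters: the stored matching `mt`, the degrees `d` in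
the sparsifier, the number `cnt` of scans, the degrees `deg` in the graph, a stack `stk` of
`sp` vertices, the list `log` of the `lg` endpoints of edges put into the sparsifier, colours `col`
and prices `pr`, the neighbours `slot u i`, `i < d u`, in the sparsifier (with multiplicity) and
`adj u i`, `i < deg u`, in the graph, the cover value `dv` of the sparsifier and the size `ms` of
the matching. The number `ops` of changes of the sparsifier is not stored in the machine. -/
structure St where
  mt : ℕ → ℕ
  d : ℕ → ℕ
  cnt : ℕ → ℕ
  deg : ℕ → ℕ
  stk : ℕ → ℕ
  log : ℕ → ℕ
  col : ℕ → ℕ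
  pr : ℕ → ℕ
  slot : ℕ → ℕ → ℕ
  adj : ℕ → ℕ → ℕ
  lg : ℕ
  sp : ℕ
  dv : ℕ
  ms : ℕ
  ops : ℕ

/-- The row length of the two-dimensional arrays: it exceeds all degrees in the sparsifier, which
are at most `bet k`, and in the graph, for which the invariants only record the bound `n * n`. -/
def stride (n k : ℕ) : ℕ := n * n + bet k

/-- The entry `i` of the array number `j`; two-dimensional arrays are stored row by row. -/
def cell (n k : ℕ) (σ : St) (j i : ℕ) : ℕ :=
  if j = 0 then σ.d i else if j = 1 then σ.cnt i else if j = 2 then σ.deg i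
  else if j = 3 then σ.stk i else if j = 4 then σ.log i else if j = 5 then σ.col i
  else if j = 6 then σ.pr i
  else if j = 7 then σ.slot (i / stride n k) (i % stride n k)
  else if j = 8 then σ.adj (i / stride n k) (i % stride n k) else 0

/-- The machine state that represents the data `σ`, with the values `τ` of the remaining
registers. The matching is in the cells below `n`, the other arrays are interleaved above: the
entry `i` of the array number `j < 16` is in the cell `n + 16 * i + j`. -/
def enc (n k : ℕ) (σ : St) (τ : ℕ → ℕ) : State where
  reg := fun i => if i < 32 then τ i else if i = 32 then n else if i = 33 then k
    else if i = 34 then bet k else if i = 35 then stride n k else if i = 36 then thr k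
    else if i = 37 then σ.lg else if i = 38 then σ.sp else if i = 39 then σ.dv
    else if i = 40 then σ.ms else τ i
  mem := fun a => if a < n then σ.mt a else cell n k σ ((a - n) % 16) ((a - n) / 16)

/-- A bound for all indices, counters and addresses. -/
def cap (n k : ℕ) : ℕ :=
  (n + 1) * stride n k + 2 * (bet k * (bet k * n)) + thr k + (k + 5) * (n + 1)

/-- The words are long enough for all numbers that occur, and the parameters are not degenerate. -/
structure Fits (w n k : ℕ) : Prop where
  pos : 1 ≤ n
  eight : 8 ≤ k
  big : 100 * cap n k + 100 ≤ 2 ^ w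

/-- The consequences of `Fits` that the linear arithmetic of the machine words needs. -/
theorem Fits.bounds {w n k : ℕ} (h : Fits w n k) :
    100 * cap n k + 100 ≤ 2 ^ w ∧ n ≤ cap n k ∧ n * stride n k + stride n k ≤ cap n k ∧
      bet k ≤ stride n k ∧ n * n ≤ stride n k ∧ 2 * (bet k * (bet k * n)) ≤ cap n k ∧
      thr k ≤ cap n k ∧ (k + 5) * n ≤ cap n k ∧ k * n ≤ cap n k ∧ k ≤ cap n k ∧
      bet k = 2 * (k * k) + k ∧ 1 ≤ n ∧ 8 ≤ k ∧ n < stride n k ∧ n ≤ n * n := by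
  have h1 := h.pos
  have h2 := h.eight
  have h3 : n ≤ n * n := Nat.le_mul_self n
  have h4 : stride n k = n * n + bet k := rfl
  have h5 := bet_eq k
  have h6 : cap n k = (n * stride n k + stride n k) + 2 * (bet k * (bet k * n)) + thr k
      + ((k + 5) * n + k + 5) := by unfold cap; ring
  have h7 : (k + 5) * n = k * n + 5 * n := by ring
  refine ⟨h.big, ?_, ?_, ?_, ?_, ?_, ?_, ?_, ?_, ?_, h5, h1, h2, ?_, h3⟩ <;> omega

/-- There is a terminating run of `P` from the state representing `σ` and `τ` to a state
representing some `σ'` and `τ'` in time `t` such that `Q σ' τ' t`. -/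
def Rn (w n k : ℕ) (P : Prog) (σ : St) (τ : ℕ → ℕ) (Q : St → (ℕ → ℕ) → ℕ → Prop) : Prop :=
  ∃ t σ' τ', Exec w P (enc n k σ τ) t (enc n k σ' τ') ∧ Q σ' τ' t

section Rules
variable {w n k : ℕ} {P P' : Prog} {σ : St} {τ : ℕ → ℕ} {Q : St → (ℕ → ℕ) → ℕ → Prop} {e : Expr}

theorem Rn.seq (h : Rn w n k P σ τ fun σ' τ' t =>
    Rn w n k P' σ' τ' fun σ'' τ'' t' => Q σ'' τ'' (t + t')) : Rn w n k (P ;; P') σ τ Q := by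
  obtain ⟨t, σ', τ', h1, t', σ'', τ'', h2, h3⟩ := h
  exact ⟨_, _, _, .seq h1 h2, h3⟩

theorem Rn.skip (h : Q σ τ 1) : Rn w n k .skip σ τ Q := ⟨_, _, _, .skip _, h⟩

/-- The cost of the test is only recorded to be at most `100`; the same convention is used in the
rules for loops, assignments and stores. -/
theorem Rn.ite (h1 : e.eval w (enc n k σ τ) ≠ 0 → ∀ c ≤ 100, Rn w n k P σ τ fun σ' τ' t =>
      Q σ' τ' (c + t))
    (h0 : e.eval w (enc n k σ τ) = 0 → ∀ c ≤ 100, Rn w n k P' σ τ fun σ' τ' t =>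
      Q σ' τ' (c + t))
    (hc : e.cost ≤ 99 := by exact Nat.le_of_ble_eq_true rfl) : Rn w n k (.ite e P P') σ τ Q := by
  by_cases h : e.eval w (enc n k σ τ) = 0
  · obtain ⟨t, σ', τ', h2, h3⟩ := h0 h (e.cost + 1) (by omega)
    exact ⟨_, _, _, .ite_false h h2, h3⟩
  · obtain ⟨t, σ', τ', h2, h3⟩ := h1 h (e.cost + 1) (by omega)
    exact ⟨_, _, _, .ite_true h h2, h3⟩

/-- The rule for loops: an invariant that mentions the time elapsed so far, and a measure which
ensures termination. -/
theorem Rn.loop (I : St → (ℕ → ℕ) → ℕ → Prop) (m : St → (ℕ → ℕ) → ℕ) (h0 : I σ τ 0)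
    (h : ∀ σ τ t, I σ τ t → ∀ c ≤ 100, (e.eval w (enc n k σ τ) = 0 → Q σ τ (t + c)) ∧
      (e.eval w (enc n k σ τ) ≠ 0 → Rn w n k P σ τ fun σ' τ' t' =>
        I σ' τ' (t + (c + t')) ∧ m σ' τ' < m σ τ))
    (hc : e.cost ≤ 99 := by exact Nat.le_of_ble_eq_true rfl) :
    Rn w n k (.loop e P) σ τ Q := by
  suffices H : ∀ N σ τ t, m σ τ < N → I σ τ t →
      Rn w n k (.loop e P) σ τ fun σ' τ' t' => Q σ' τ' (t + t') by
    have := H _ σ τ 0 (Nat.lt_succ_self _) h0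
    simpa using this
  intro N
  induction N with
  | zero => intro σ τ t hm; omega
  | succ N ih =>
    intro σ τ t hm hI
    obtain ⟨hq, hr⟩ := h σ τ t hI (e.cost + 1) (by omega)
    by_cases he : e.eval w (enc n k σ τ) = 0
    · exact ⟨_, _, _, .loop_false he, hq he⟩
    · obtain ⟨t1, σ1, τ1, hx, hI1, hm1⟩ := hr he
      obtain ⟨t2, σ2, τ2, hx2, hQ⟩ := ih σ1 τ1 _ (by omega) hI1
      refine ⟨_, _, _, .loop_true he hx hx2, ?_⟩
      convert hQ using 1
      ring

/-! ### Assignments and stores -/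

theorem enc_tmp {i : ℕ} (hi : i < 32) (σ : St) (τ : ℕ → ℕ) (x : ℕ) :
    { enc n k σ τ with reg := Function.update (enc n k σ τ).reg i x }
      = enc n k σ (Function.update τ i x) := by
  simp only [enc, State.mk.injEq, and_true]
  funext j
  by_cases h : j = i
  · subst h; simp [hi]
  · simp [Function.update_of_ne h]

theorem Rn.of_exec {s : State} {t : ℕ} {σ' : St} {τ' : ℕ → ℕ}
    (h : Exec w P (enc n k σ τ) t s) (hs : s = enc n k σ' τ') (hQ : Q σ' τ' t) :
    Rn w n k P σ τ Q := ⟨t, σ', τ', hs ▸ h, hQ⟩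

theorem Rn.assign {i x : ℕ} (hi : i < 32) (he : e.eval w (enc n k σ τ) = x)
    (h : ∀ c ≤ 100, Q σ (Function.update τ i x) c)
    (hc : e.cost ≤ 99 := by exact Nat.le_of_ble_eq_true rfl) : Rn w n k (.assign i e) σ τ Q :=
  Rn.of_exec (.assign i e _) (by rw [he, enc_tmp hi]) (h _ (by omega))

theorem Rn.assign_lg {x : ℕ} (he : e.eval w (enc n k σ τ) = x)
    (h : ∀ c ≤ 100, Q { σ with lg := x } τ c)
    (hc : e.cost ≤ 99 := by exact Nat.le_of_ble_eq_true rfl) : Rn w n k (.assign 37 e) σ τ Q := by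
  refine Rn.of_exec (.assign 37 e _) ?_ (h _ (by omega))
  rw [he]; simp only [enc, State.mk.injEq]; refine ⟨?_, rfl⟩
  funext j; by_cases hj : j = 37
  · subst hj; simp
  · simp [hj]

theorem Rn.assign_sp {x : ℕ} (he : e.eval w (enc n k σ τ) = x)
    (h : ∀ c ≤ 100, Q { σ with sp := x } τ c)
    (hc : e.cost ≤ 99 := by exact Nat.le_of_ble_eq_true rfl) : Rn w n k (.assign 38 e) σ τ Q := by
  refine Rn.of_exec (.assign 38 e _) ?_ (h _ (by omega))
  rw [he]; simp only [enc, State.mk.injEq]; refine ⟨?_, rfl⟩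
  funext j; by_cases hj : j = 38
  · subst hj; simp
  · simp [hj]

theorem Rn.assign_dv {x : ℕ} (he : e.eval w (enc n k σ τ) = x)
    (h : ∀ c ≤ 100, Q { σ with dv := x } τ c)
    (hc : e.cost ≤ 99 := by exact Nat.le_of_ble_eq_true rfl) : Rn w n k (.assign 39 e) σ τ Q := by
  refine Rn.of_exec (.assign 39 e _) ?_ (h _ (by omega))
  rw [he]; simp only [enc, State.mk.injEq]; refine ⟨?_, rfl⟩
  funext j; by_cases hj : j = 39
  · subst hj; simp
  · simp [hj]

theorem Rn.assign_ms {x : ℕ} (he : e.eval w (enc n k σ τ) = x)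
    (h : ∀ c ≤ 100, Q { σ with ms := x } τ c)
    (hc : e.cost ≤ 99 := by exact Nat.le_of_ble_eq_true rfl) : Rn w n k (.assign 40 e) σ τ Q := by
  refine Rn.of_exec (.assign 40 e _) ?_ (h _ (by omega))
  rw [he]; simp only [enc, State.mk.injEq]; refine ⟨?_, rfl⟩
  funext j; by_cases hj : j = 40
  · subst hj; simp
  · simp [hj]

/-- The address of the entry `e` of the array number `j`. -/
def addr (j : ℕ) (e : Expr) : Expr := .reg 32 + (Expr.const 16 * e + Expr.const j)

/-- The index of the entry `u i` of a two-dimensional array. -/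
def idx (u i : Expr) : Expr := u * .reg 35 + i

variable {a b : Expr} {u i x j : ℕ}

theorem eval_addr (F : Fits w n k) (hj : j < 16) (ha : a.eval w (enc n k σ τ) = i)
    (hi : i ≤ cap n k) : (addr j a).eval w (enc n k σ τ) = n + (16 * i + j) := by
  have h1 := F.big
  have h2 : n ≤ cap n k := by
    have := F.bounds; omega
  have h3 : (Expr.reg 32).eval w (enc n k σ τ) = n := rfl
  simp only [addr, eval_add, eval_mul, eval_const, h3, ha]
  have e1 : 16 % 2 ^ w = 16 := Nat.mod_eq_of_lt (by omega)
  have e2 : j % 2 ^ w = j := Nat.mod_eq_of_lt (by omega)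
  have e3 : 16 * i % 2 ^ w = 16 * i := Nat.mod_eq_of_lt (by omega)
  have e4 : (16 * i + j) % 2 ^ w = 16 * i + j := Nat.mod_eq_of_lt (by omega)
  rw [e1, e2, e3, e4]
  exact Nat.mod_eq_of_lt (by omega)

theorem idx_le_cap (hu : u < n) (hi : i < stride n k) : u * stride n k + i ≤ cap n k := by
  have : u * stride n k + i ≤ (n + 1) * stride n k := by nlinarith
  simp only [cap]; omega

theorem eval_idx (F : Fits w n k) (ha : a.eval w (enc n k σ τ) = u)
    (hb : b.eval w (enc n k σ τ) = i) (hu : u < n) (hi : i < stride n k) :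
    (idx a b).eval w (enc n k σ τ) = u * stride n k + i := by
  have h1 := F.big
  have h2 := idx_le_cap hu hi
  have h3 : (Expr.reg 35).eval w (enc n k σ τ) = stride n k := rfl
  simp only [idx, eval_add, eval_mul, h3, ha, hb]
  rw [Nat.mod_eq_of_lt (a := u * stride n k) (by omega)]
  exact Nat.mod_eq_of_lt (by omega)

theorem enc_mem (hj : j < 16) : (enc n k σ τ).mem (n + (16 * i + j)) = cell n k σ j i := by
  have h1 : (n + (16 * i + j) - n) % 16 = j := by omega
  have h2 : (n + (16 * i + j) - n) / 16 = i := by omega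
  simp only [enc]
  rw [if_neg (by omega), h1, h2]

theorem eval_cell (F : Fits w n k) (hj : j < 16) (ha : a.eval w (enc n k σ τ) = i)
    (hi : i ≤ cap n k) : (Expr.load (addr j a)).eval w (enc n k σ τ) = cell n k σ j i := by
  rw [eval_load, eval_addr F hj ha hi, enc_mem hj]

theorem eval_cell2 (F : Fits w n k) (hj : j < 16) (ha : a.eval w (enc n k σ τ) = u)
    (hb : b.eval w (enc n k σ τ) = i) (hu : u < n) (hi : i < stride n k) :
    (Expr.load (addr j (idx a b))).eval w (enc n k σ τ) = cell n k σ j (u * stride n k + i) :=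
  eval_cell F hj (eval_idx F ha hb hu hi) (idx_le_cap hu hi)

theorem div_mod_idx (hi : i < stride n k) :
    (u * stride n k + i) / stride n k = u ∧ (u * stride n k + i) % stride n k = i := by
  constructor
  · rw [Nat.mul_comm, Nat.mul_add_div (by omega), Nat.div_eq_of_lt hi, Nat.add_zero]
  · rw [Nat.mul_comm, Nat.mul_add_mod, Nat.mod_eq_of_lt hi]

/-- The update of one entry of a two-dimensional array. -/
def upd2 (f : ℕ → ℕ → ℕ) (u i x : ℕ) : ℕ → ℕ → ℕ := Function.update f u (Function.update (f u) i x)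

theorem upd2_apply (f : ℕ → ℕ → ℕ) (u i x u' i' : ℕ) :
    upd2 f u i x u' i' = if u' = u ∧ i' = i then x else f u' i' := by
  unfold upd2
  by_cases h : u' = u
  · subst h
    by_cases h' : i' = i
    · subst h'; simp
    · simp [h']
  · simp [h]

theorem eval_mt (ha : a.eval w (enc n k σ τ) = i) (hi : i < n) :
    (Expr.load a).eval w (enc n k σ τ) = σ.mt i := by
  rw [eval_load, ha]; simp [enc, hi]
theorem eval_d (F : Fits w n k) (ha : a.eval w (enc n k σ τ) = i) (hi : i ≤ cap n k) :
    (Expr.load (addr 0 a)).eval w (enc n k σ τ) = σ.d i := eval_cell F (by decide) ha hi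
theorem eval_cnt (F : Fits w n k) (ha : a.eval w (enc n k σ τ) = i) (hi : i ≤ cap n k) :
    (Expr.load (addr 1 a)).eval w (enc n k σ τ) = σ.cnt i := eval_cell F (by decide) ha hi
theorem eval_deg (F : Fits w n k) (ha : a.eval w (enc n k σ τ) = i) (hi : i ≤ cap n k) :
    (Expr.load (addr 2 a)).eval w (enc n k σ τ) = σ.deg i := eval_cell F (by decide) ha hi
theorem eval_stk (F : Fits w n k) (ha : a.eval w (enc n k σ τ) = i) (hi : i ≤ cap n k) :
    (Expr.load (addr 3 a)).eval w (enc n k σ τ) = σ.stk i := eval_cell F (by decide) ha hi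
theorem eval_log (F : Fits w n k) (ha : a.eval w (enc n k σ τ) = i) (hi : i ≤ cap n k) :
    (Expr.load (addr 4 a)).eval w (enc n k σ τ) = σ.log i := eval_cell F (by decide) ha hi
theorem eval_col (F : Fits w n k) (ha : a.eval w (enc n k σ τ) = i) (hi : i ≤ cap n k) :
    (Expr.load (addr 5 a)).eval w (enc n k σ τ) = σ.col i := eval_cell F (by decide) ha hi
theorem eval_pr (F : Fits w n k) (ha : a.eval w (enc n k σ τ) = i) (hi : i ≤ cap n k) :
    (Expr.load (addr 6 a)).eval w (enc n k σ τ) = σ.pr i := eval_cell F (by decide) ha hi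
theorem eval_slot (F : Fits w n k) (ha : a.eval w (enc n k σ τ) = u)
    (hb : b.eval w (enc n k σ τ) = i) (hu : u < n) (hi : i < stride n k) :
    (Expr.load (addr 7 (idx a b))).eval w (enc n k σ τ) = σ.slot u i := by
  rw [eval_cell2 F (by decide) ha hb hu hi]
  simp [cell, div_mod_idx hi]
theorem eval_adj (F : Fits w n k) (ha : a.eval w (enc n k σ τ) = u)
    (hb : b.eval w (enc n k σ τ) = i) (hu : u < n) (hi : i < stride n k) :
    (Expr.load (addr 8 (idx a b))).eval w (enc n k σ τ) = σ.adj u i := by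
  rw [eval_cell2 F (by decide) ha hb hu hi]
  simp [cell, div_mod_idx hi]

theorem Rn.store_cell (F : Fits w n k) (hj : j < 16) {σ' : St}
    (ha : a.eval w (enc n k σ τ) = i) (hi : i ≤ cap n k) (he : e.eval w (enc n k σ τ) = x)
    (h0 : σ'.mt = σ.mt ∧ σ'.lg = σ.lg ∧ σ'.sp = σ.sp ∧ σ'.dv = σ.dv ∧ σ'.ms = σ.ms)
    (h1 : ∀ j' i', cell n k σ' j' i' = if j' = j ∧ i' = i then x else cell n k σ j' i')
    (h : ∀ c ≤ 100, Q σ' τ c)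
    (hc : (addr j a).cost + e.cost ≤ 99 := by exact Nat.le_of_ble_eq_true rfl) :
    Rn w n k (.store (addr j a) e) σ τ Q := by
  refine Rn.of_exec (.store _ e _) ?_ (h _ (by omega))
  rw [he, eval_addr F hj ha hi]
  simp only [enc, h0, State.mk.injEq, true_and]
  funext c
  by_cases hc : c = n + (16 * i + j)
  · subst hc
    have e1 : (n + (16 * i + j) - n) % 16 = j := by omega
    have e2 : (n + (16 * i + j) - n) / 16 = i := by omega
    rw [Function.update_self, if_neg (by omega), h1, e1, e2, if_pos ⟨rfl, rfl⟩]
  · rw [Function.update_of_ne hc, h1]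
    by_cases hn : c < n
    · simp [hn]
    · rw [if_neg hn, if_neg hn, if_neg]
      omega

theorem Rn.store_mt (ha : a.eval w (enc n k σ τ) = i) (hi : i < n)
    (he : e.eval w (enc n k σ τ) = x)
    (h : ∀ c ≤ 100, Q { σ with mt := Function.update σ.mt i x } τ c)
    (hc : a.cost + e.cost ≤ 99 := by exact Nat.le_of_ble_eq_true rfl) :
    Rn w n k (.store a e) σ τ Q := by
  refine Rn.of_exec (.store _ e _) ?_ (h _ (by omega))
  rw [he, ha]
  simp only [enc, State.mk.injEq, true_and]
  funext c
  by_cases hc : c = i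
  · subst hc; simp [hi]
  · simp only [Function.update_of_ne hc]; rfl

theorem Rn.store_d (F : Fits w n k) (ha : a.eval w (enc n k σ τ) = i) (hi : i ≤ cap n k)
    (he : e.eval w (enc n k σ τ) = x)
    (h : ∀ c ≤ 100, Q { σ with d := Function.update σ.d i x } τ c)
    (hc : (addr 0 a).cost + e.cost ≤ 99 := by exact Nat.le_of_ble_eq_true rfl) :
    Rn w n k (.store (addr 0 a) e) σ τ Q := by
  refine Rn.store_cell (σ' := { σ with d := Function.update σ.d i x }) F (by decide) ha hi he
    ⟨rfl, rfl, rfl, rfl, rfl⟩ (fun j' i' => ?_) h hc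
  by_cases hj : j' = 0
  · subst hj; simp [cell, Function.update_apply]
  · simp [cell, hj]
theorem Rn.store_cnt (F : Fits w n k) (ha : a.eval w (enc n k σ τ) = i) (hi : i ≤ cap n k)
    (he : e.eval w (enc n k σ τ) = x)
    (h : ∀ c ≤ 100, Q { σ with cnt := Function.update σ.cnt i x } τ c)
    (hc : (addr 1 a).cost + e.cost ≤ 99 := by exact Nat.le_of_ble_eq_true rfl) :
    Rn w n k (.store (addr 1 a) e) σ τ Q := by
  refine Rn.store_cell (σ' := { σ with cnt := Function.update σ.cnt i x }) F (by decide) ha hi he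
    ⟨rfl, rfl, rfl, rfl, rfl⟩ (fun j' i' => ?_) h hc
  by_cases hj : j' = 1
  · subst hj; simp [cell, Function.update_apply]
  · simp [cell, hj]
theorem Rn.store_deg (F : Fits w n k) (ha : a.eval w (enc n k σ τ) = i) (hi : i ≤ cap n k)
    (he : e.eval w (enc n k σ τ) = x)
    (h : ∀ c ≤ 100, Q { σ with deg := Function.update σ.deg i x } τ c)
    (hc : (addr 2 a).cost + e.cost ≤ 99 := by exact Nat.le_of_ble_eq_true rfl) :
    Rn w n k (.store (addr 2 a) e) σ τ Q := by
  refine Rn.store_cell (σ' := { σ with deg := Function.update σ.deg i x }) F (by decide) ha hi he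
    ⟨rfl, rfl, rfl, rfl, rfl⟩ (fun j' i' => ?_) h hc
  by_cases hj : j' = 2
  · subst hj; simp [cell, Function.update_apply]
  · simp [cell, hj]
theorem Rn.store_stk (F : Fits w n k) (ha : a.eval w (enc n k σ τ) = i) (hi : i ≤ cap n k)
    (he : e.eval w (enc n k σ τ) = x)
    (h : ∀ c ≤ 100, Q { σ with stk := Function.update σ.stk i x } τ c)
    (hc : (addr 3 a).cost + e.cost ≤ 99 := by exact Nat.le_of_ble_eq_true rfl) :
    Rn w n k (.store (addr 3 a) e) σ τ Q := by
  refine Rn.store_cell (σ' := { σ with stk := Function.update σ.stk i x }) F (by decide) ha hi he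
    ⟨rfl, rfl, rfl, rfl, rfl⟩ (fun j' i' => ?_) h hc
  by_cases hj : j' = 3
  · subst hj; simp [cell, Function.update_apply]
  · simp [cell, hj]
theorem Rn.store_log (F : Fits w n k) (ha : a.eval w (enc n k σ τ) = i) (hi : i ≤ cap n k)
    (he : e.eval w (enc n k σ τ) = x)
    (h : ∀ c ≤ 100, Q { σ with log := Function.update σ.log i x } τ c)
    (hc : (addr 4 a).cost + e.cost ≤ 99 := by exact Nat.le_of_ble_eq_true rfl) :
    Rn w n k (.store (addr 4 a) e) σ τ Q := by
  refine Rn.store_cell (σ' := { σ with log := Function.update σ.log i x }) F (by decide) ha hi he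
    ⟨rfl, rfl, rfl, rfl, rfl⟩ (fun j' i' => ?_) h hc
  by_cases hj : j' = 4
  · subst hj; simp [cell, Function.update_apply]
  · simp [cell, hj]
theorem Rn.store_col (F : Fits w n k) (ha : a.eval w (enc n k σ τ) = i) (hi : i ≤ cap n k)
    (he : e.eval w (enc n k σ τ) = x)
    (h : ∀ c ≤ 100, Q { σ with col := Function.update σ.col i x } τ c)
    (hc : (addr 5 a).cost + e.cost ≤ 99 := by exact Nat.le_of_ble_eq_true rfl) :
    Rn w n k (.store (addr 5 a) e) σ τ Q := by
  refine Rn.store_cell (σ' := { σ with col := Function.update σ.col i x }) F (by decide) ha hi he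
    ⟨rfl, rfl, rfl, rfl, rfl⟩ (fun j' i' => ?_) h hc
  by_cases hj : j' = 5
  · subst hj; simp [cell, Function.update_apply]
  · simp [cell, hj]
theorem Rn.store_pr (F : Fits w n k) (ha : a.eval w (enc n k σ τ) = i) (hi : i ≤ cap n k)
    (he : e.eval w (enc n k σ τ) = x)
    (h : ∀ c ≤ 100, Q { σ with pr := Function.update σ.pr i x } τ c)
    (hc : (addr 6 a).cost + e.cost ≤ 99 := by exact Nat.le_of_ble_eq_true rfl) :
    Rn w n k (.store (addr 6 a) e) σ τ Q := by
  refine Rn.store_cell (σ' := { σ with pr := Function.update σ.pr i x }) F (by decide) ha hi he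
    ⟨rfl, rfl, rfl, rfl, rfl⟩ (fun j' i' => ?_) h hc
  by_cases hj : j' = 6
  · subst hj; simp [cell, Function.update_apply]
  · simp [cell, hj]

theorem idx_eq_iff (hi : i < stride n k) (c : ℕ) :
    (c / stride n k = u ∧ c % stride n k = i) ↔ c = u * stride n k + i := by
  constructor
  · rintro ⟨rfl, rfl⟩; rw [Nat.mul_comm]; exact (Nat.div_add_mod _ _).symm
  · rintro rfl; exact div_mod_idx hi

theorem Rn.store_slot (F : Fits w n k) (ha : a.eval w (enc n k σ τ) = u)
    (hb : b.eval w (enc n k σ τ) = i) (hu : u < n) (hi : i < stride n k)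
    (he : e.eval w (enc n k σ τ) = x)
    (h : ∀ c ≤ 100, Q { σ with slot := upd2 σ.slot u i x } τ c)
    (hc : (addr 7 (idx a b)).cost + e.cost ≤ 99 := by exact Nat.le_of_ble_eq_true rfl) :
    Rn w n k (.store (addr 7 (idx a b)) e) σ τ Q := by
  refine Rn.store_cell (σ' := { σ with slot := upd2 σ.slot u i x }) F (by decide)
    (eval_idx F ha hb hu hi) (idx_le_cap hu hi) he
    ⟨rfl, rfl, rfl, rfl, rfl⟩ (fun j' i' => ?_) h hc
  by_cases hj : j' = 7
  · subst hj; simp [cell, upd2_apply, idx_eq_iff hi]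
  · simp [cell, hj]
theorem Rn.store_adj (F : Fits w n k) (ha : a.eval w (enc n k σ τ) = u)
    (hb : b.eval w (enc n k σ τ) = i) (hu : u < n) (hi : i < stride n k)
    (he : e.eval w (enc n k σ τ) = x)
    (h : ∀ c ≤ 100, Q { σ with adj := upd2 σ.adj u i x } τ c)
    (hc : (addr 8 (idx a b)).cost + e.cost ≤ 99 := by exact Nat.le_of_ble_eq_true rfl) :
    Rn w n k (.store (addr 8 (idx a b)) e) σ τ Q := by
  refine Rn.store_cell (σ' := { σ with adj := upd2 σ.adj u i x }) F (by decide)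
    (eval_idx F ha hb hu hi) (idx_le_cap hu hi) he
    ⟨rfl, rfl, rfl, rfl, rfl⟩ (fun j' i' => ?_) h hc
  by_cases hj : j' = 8
  · subst hj; simp [cell, upd2_apply, idx_eq_iff hi]
  · simp [cell, hj]

theorem le_cap_of_lt (F : Fits w n k) (hu : u < n) : u ≤ cap n k := by
  have := F.bounds; omega

end Rules

/-! ### Adding and removing a copy of an edge -/

/-- The degree in the sparsifier of the vertex in the register `a`. -/
def degE (a : ℕ) : Expr := .load (addr 0 (.reg a))

/-- The cover value of the degree `e`. -/
def covE (e : Expr) : Expr :=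
  (e - .reg 33 * .reg 33) - ((e - .reg 33 * .reg 33) - .reg 33)

/-- Enter the vertex in the register `b` as a neighbour of the vertex in the register `a`. -/
def halfAddP (a b : ℕ) : Prog :=
  .store (addr 7 (idx (.reg a) (degE a))) (.reg b) ;;
  .assign 39 (.reg 39 + covE (degE a + .const 1) - covE (degE a)) ;;
  .store (addr 0 (.reg a)) (degE a + .const 1) ;;
  .store (addr 4 (.reg 37)) (.reg a) ;;
  .assign 37 (.reg 37 + .const 1)

/-- Delete the neighbour number `i` of the vertex in the register `a`, where `i` is in the register
`b`, by moving the last neighbour into its place. -/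
def halfRemP (a b : ℕ) : Prog :=
  .store (addr 7 (idx (.reg a) (.reg b))) (.load (addr 7 (idx (.reg a) (degE a - .const 1)))) ;;
  .assign 39 (.reg 39 + covE (degE a - .const 1) - covE (degE a)) ;;
  .store (addr 0 (.reg a)) (degE a - .const 1)

/-- The effect of `halfAddP`. -/
def halfAdd (k u v : ℕ) (σ : St) : St :=
  { σ with
    slot := upd2 σ.slot u (σ.d u) v
    dv := σ.dv + cov k (σ.d u + 1) - cov k (σ.d u)
    d := Function.update σ.d u (σ.d u + 1)
    log := Function.update σ.log σ.lg u
    lg := σ.lg + 1 }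

/-- The effect of `halfRemP`. -/
def halfRem (k u i : ℕ) (σ : St) : St :=
  { σ with
    slot := upd2 σ.slot u i (σ.slot u (σ.d u - 1))
    dv := σ.dv + cov k (σ.d u - 1) - cov k (σ.d u)
    d := Function.update σ.d u (σ.d u - 1) }

section
variable {w n k : ℕ} {σ : St} {τ : ℕ → ℕ} {Q : St → (ℕ → ℕ) → ℕ → Prop} {e : Expr}
  {a b u v i x : ℕ}

theorem eval_tmp (hi : i < 32) (hx : τ i = x) : (Expr.reg i).eval w (enc n k σ τ) = x := by
  simp [enc, hi, hx]

theorem eval_degE (F : Fits w n k) (ha : a < 32) (hx : τ a = u) (hu : u < n) :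
    (degE a).eval w (enc n k σ τ) = σ.d u :=
  eval_d F (eval_tmp ha hx) (le_cap_of_lt F hu)

theorem eval_covE (F : Fits w n k) (he : e.eval w (enc n k σ τ) = x) :
    (covE e).eval w (enc n k σ τ) = cov k x := by
  have h := F.bounds
  have h1 : (Expr.reg 33).eval w (enc n k σ τ) = k := rfl
  simp only [covE, eval_sub, eval_mul, h1, he]
  rw [Nat.mod_eq_of_lt (by omega), cov]

theorem eval_add_of (he : a = e.eval w (enc n k σ τ)) {e' : Expr}
    (he' : b = e'.eval w (enc n k σ τ)) (h : a + b < 2 ^ w) :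
    (e + e').eval w (enc n k σ τ) = a + b := by
  rw [eval_add, ← he, ← he', Nat.mod_eq_of_lt h]

theorem eval_add_one (he : e.eval w (enc n k σ τ) = x) (h : x + 1 < 2 ^ w) :
    (e + .const 1).eval w (enc n k σ τ) = x + 1 := by
  rw [eval_add, he, eval_const, Nat.mod_eq_of_lt (a := 1) (by omega), Nat.mod_eq_of_lt h]

theorem eval_sub_one (he : e.eval w (enc n k σ τ) = x) (h : 1 < 2 ^ w) :
    (e - .const 1).eval w (enc n k σ τ) = x - 1 := by
  rw [eval_sub, he, eval_const, Nat.mod_eq_of_lt h]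

theorem Rn.halfAdd (F : Fits w n k) (ha : a < 32) (hb : b < 32) (hu : τ a = u) (hv : τ b = v)
    (hun : u < n) (hd : σ.d u < bet k) (hdv : σ.dv ≤ k * n) (hlg : σ.lg < cap n k)
    (h : ∀ t ≤ 500, Q (halfAdd k u v σ) τ t) : Rn w n k (halfAddP a b) σ τ Q := by
  have B := F.bounds
  have c1 := cov_le k (σ.d u + 1)
  refine Rn.seq (Rn.store_slot F (eval_tmp ha hu) (eval_degE F ha hu hun) hun (by omega)
    (eval_tmp hb hv) fun c1 hc1 => ?_)
  refine Rn.seq (Rn.assign_dv (x := σ.dv + cov k (σ.d u + 1) - cov k (σ.d u)) ?_ fun c2 hc2 => ?_)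
  · rw [eval_sub, eval_covE F (eval_degE F ha hu hun), eval_add,
      eval_covE F (eval_add_one (eval_degE F ha hu hun) (by simp only; omega)),
      Nat.mod_eq_of_lt]
    · rfl
    · simp only [enc]; simp; omega
  refine Rn.seq (Rn.store_d F (eval_tmp ha hu) (le_cap_of_lt F hun)
    (eval_add_one (eval_degE F ha hu hun) (by simp only; omega)) fun c3 hc3 => ?_)
  refine Rn.seq (Rn.store_log F (i := σ.lg) rfl hlg.le (eval_tmp ha hu) fun c4 hc4 => ?_)
  refine Rn.assign_lg (eval_add_one (x := σ.lg) rfl (by omega)) fun c5 hc5 => ?_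
  exact h _ (by omega)

theorem Rn.halfRem (F : Fits w n k) (ha : a < 32) (hb : b < 32) (hu : τ a = u) (hi : τ b = i)
    (hun : u < n) (hd : σ.d u ≤ bet k) (hid : i < σ.d u) (hdv : σ.dv ≤ k * n)
    (h : ∀ t ≤ 500, Q (halfRem k u i σ) τ t) : Rn w n k (halfRemP a b) σ τ Q := by
  have B := F.bounds
  have c1 := cov_le k (σ.d u - 1)
  refine Rn.seq (Rn.store_slot F (eval_tmp ha hu) (eval_tmp hb hi) hun (by omega)
    (eval_slot F (eval_tmp ha hu) (eval_sub_one (eval_degE F ha hu hun) (by omega)) hun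
      (by omega)) fun c1 hc1 => ?_)
  refine Rn.seq (Rn.assign_dv (x := σ.dv + cov k (σ.d u - 1) - cov k (σ.d u)) ?_ fun c2 hc2 => ?_)
  · rw [eval_sub, eval_covE F (eval_degE F ha hu hun), eval_add,
      eval_covE F (eval_sub_one (eval_degE F ha hu hun) (by omega)),
      Nat.mod_eq_of_lt]
    · rfl
    · simp only [enc]; simp; omega
  refine Rn.store_d F (eval_tmp ha hu) (le_cap_of_lt F hun)
    (eval_sub_one (eval_degE F ha hu hun) (by omega)) fun c3 hc3 => ?_
  exact h _ (by omega)

end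

/-! ### The sparsifier as a multigraph -/

/-- The neighbours of `u` in the sparsifier, with multiplicity. -/
def row (σ : St) (u : ℕ) : Multiset ℕ := (Multiset.range (σ.d u)).map (σ.slot u)

/-- Adjacency in the graph. -/
def Adj (σ : St) (u v : ℕ) : Prop := ∃ i < σ.deg u, σ.adj u i = v

@[simp] theorem card_row (σ : St) (u : ℕ) : (row σ u).card = σ.d u := by simp [row]

theorem mem_row {σ : St} {u v : ℕ} : v ∈ row σ u ↔ ∃ i < σ.d u, σ.slot u i = v := by
  simp [row]

theorem row_halfAdd (k u v : ℕ) (σ : St) (x : ℕ) :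
    row (halfAdd k u v σ) x = if x = u then v ::ₘ row σ u else row σ x := by
  split_ifs with h
  · subst h
    simp only [row, halfAdd, Function.update_self, Multiset.range_succ, Multiset.map_cons,
      upd2_apply, and_self, if_true]
    congr 1
    refine Multiset.map_congr rfl fun i hi => ?_
    rw [Multiset.mem_range] at hi
    rw [if_neg (by omega)]
  · simp only [row, halfAdd, Function.update_of_ne h]
    refine Multiset.map_congr rfl fun i _ => ?_
    rw [upd2_apply, if_neg (by tauto)]

theorem row_halfRem {k u i : ℕ} {σ : St} (hi : i < σ.d u) (x : ℕ) :
    row (halfRem k u i σ) x = if x = u then (row σ u).erase (σ.slot u i) else row σ x := by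
  split_ifs with h
  · subst h
    obtain ⟨m, hm⟩ : ∃ m, σ.d x = m + 1 := ⟨σ.d x - 1, by omega⟩
    simp only [row, halfRem, Function.update_self, hm, Nat.add_sub_cancel, Multiset.range_succ,
      Multiset.map_cons]
    rcases Nat.lt_or_ge i m with h | h
    · have e : Multiset.range m = i ::ₘ (Multiset.range m).erase i :=
        (Multiset.cons_erase (Multiset.mem_range.2 h)).symm
      rw [e]
      simp only [Multiset.map_cons, upd2_apply, and_self, if_true]
      rw [Multiset.cons_swap, Multiset.erase_cons_head]
      congr 1
      refine Multiset.map_congr rfl fun j hj => ?_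
      have : j ≠ i := ((Multiset.nodup_range m).mem_erase_iff.1 hj).1
      rw [if_neg (by tauto)]
    · have : i = m := by omega
      subst this
      rw [Multiset.erase_cons_head]
      refine Multiset.map_congr rfl fun j hj => ?_
      rw [Multiset.mem_range] at hj
      rw [upd2_apply, if_neg (by omega)]
  · simp only [row, halfRem, Function.update_of_ne h]
    refine Multiset.map_congr rfl fun i _ => ?_
    rw [upd2_apply, if_neg (by tauto)]

/-- The invariants of the data structures, apart from the degree bounds of the sparsifier and the
stored matching. The function `κ` is a bipartition of the graph, not known to the algorithm. The
inequality `pot` bounds the number of changes of the sparsifier: adding an edge whose degrees add up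
to less than `bet k - 1`, and removing one whose degrees add up to more than `bet k`, raises
`2 * bet k * ∑ d - 2 * ∑ d ^ 2 - ∑ d` by at least `2`. -/
structure Good (n k : ℕ) (κ : ℕ → Prop) (σ : St) : Prop where
  dz : ∀ u, n ≤ u → σ.d u = 0
  sym : ∀ u v, (row σ u).count v = (row σ v).count u
  sub : ∀ u v, v ∈ row σ u → Adj σ u v
  adjs : ∀ u v, Adj σ u v → Adj σ v u
  adjn : ∀ u v, Adj σ u v → u < n
  bip : ∀ u v, Adj σ u v → (κ u ↔ ¬ κ v)
  degb : ∀ u, σ.deg u ≤ n * n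
  pot : 2 * σ.ops + 2 * ∑ u ∈ range n, σ.d u * σ.d u + ∑ u ∈ range n, σ.d u
    ≤ 2 * bet k * ∑ u ∈ range n, σ.d u
  cnts : ∑ u ∈ range n, σ.cnt u + σ.sp ≤ σ.ops
  cntT : ∀ u, σ.cnt u ≤ thr k
  lgs : σ.lg ≤ 2 * σ.ops
  dvs : σ.dv = ∑ u ∈ range n, cov k (σ.d u)
  logn : ∀ i < σ.lg, σ.log i < n
  logd : ∀ v, 0 < σ.d v → ∃ i < σ.lg, σ.log i = v
  stkn : ∀ i < σ.sp, σ.stk i < n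

/-- The degrees of the endpoints of every edge of the sparsifier add up to at most `b`. -/
def Lim (b : ℕ) (σ : St) : Prop := ∀ u v, v ∈ row σ u → σ.d u + σ.d v ≤ b

/-- The data that adding and removing edges of the sparsifier does not change, and how the other
data may change: only vertices on the stack can have lost degree. -/
structure Ext (σ σ' : St) : Prop where
  mt : σ'.mt = σ.mt
  cnt : σ'.cnt = σ.cnt
  deg : σ'.deg = σ.deg
  adj : σ'.adj = σ.adj
  col : σ'.col = σ.col
  ms : σ'.ms = σ.ms
  pr : σ'.pr = σ.pr
  lg : σ.lg ≤ σ'.lg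
  log : ∀ i < σ.lg, σ'.log i = σ.log i
  sp : σ.sp ≤ σ'.sp
  stk : ∀ i < σ.sp, σ'.stk i = σ.stk i
  spo : σ'.sp + σ.ops ≤ σ'.ops + σ.sp

theorem Ext.refl (σ : St) : Ext σ σ :=
  ⟨rfl, rfl, rfl, rfl, rfl, rfl, rfl, le_rfl, fun _ _ => rfl, le_rfl, fun _ _ => rfl,
    (Nat.add_comm _ _).le⟩

theorem Ext.trans {σ σ' σ'' : St} (h : Ext σ σ') (h' : Ext σ' σ'') : Ext σ σ'' where
  mt := h'.mt.trans h.mt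
  cnt := h'.cnt.trans h.cnt
  deg := h'.deg.trans h.deg
  adj := h'.adj.trans h.adj
  col := h'.col.trans h.col
  ms := h'.ms.trans h.ms
  pr := h'.pr.trans h.pr
  lg := h.lg.trans h'.lg
  log i hi := (h'.log i (hi.trans_le h.lg)).trans (h.log i hi)
  sp := h.sp.trans h'.sp
  stk i hi := (h'.stk i (hi.trans_le h.sp)).trans (h.stk i hi)
  spo := by have := h.spo; have := h'.spo; omega

/-- The vertex `y` is on the stack. -/
def OnStk (σ : St) (y : ℕ) : Prop := ∃ i < σ.sp, σ.stk i = y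

theorem OnStk.ext {σ σ' : St} {y : ℕ} (h : OnStk σ y) (e : Ext σ σ') : OnStk σ' y := by
  obtain ⟨i, hi, rfl⟩ := h
  exact ⟨i, hi.trans_le e.sp, e.stk i hi⟩

theorem Ext.adj_iff {σ σ' : St} (e : Ext σ σ') (u v : ℕ) : Adj σ' u v ↔ Adj σ u v := by
  simp [Adj, e.deg, e.adj]

section
variable {n k : ℕ} {κ : ℕ → Prop} {σ : St} {u v x z i j : ℕ}

theorem Good.ne (G : Good n k κ σ) (h : Adj σ u v) : u ≠ v := by
  rintro rfl
  have := G.bip u u h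
  tauto

theorem Good.row_symm (G : Good n k κ σ) (h : v ∈ row σ u) : u ∈ row σ v := by
  rw [← Multiset.count_pos] at h ⊢
  rwa [G.sym]

theorem Good.adjn' (G : Good n k κ σ) (h : Adj σ u v) : v < n := G.adjn _ _ (G.adjs _ _ h)

theorem pos_of_mem_row (h : v ∈ row σ u) : 0 < σ.d u := by
  rw [← card_row, Multiset.card_pos]
  rintro h'; simp [h'] at h

theorem Good.d_le {b : ℕ} (G : Good n k κ σ) (L : Lim (b + 1) σ) (u : ℕ) : σ.d u ≤ b := by
  rcases Nat.eq_zero_or_pos (σ.d u) with h | h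
  · omega
  · obtain ⟨v, hv⟩ := Multiset.card_pos_iff_exists_mem.1 ((card_row σ u).symm ▸ h)
    have := L u v hv
    have := pos_of_mem_row (G.row_symm hv)
    omega

theorem Lim.mono {b b' : ℕ} (L : Lim b σ) (h : b ≤ b') : Lim b' σ :=
  fun u v hv => (L u v hv).trans h

theorem Good.dv_le (G : Good n k κ σ) : σ.dv ≤ k * n := by
  rw [G.dvs]
  refine (Finset.sum_le_card_nsmul _ _ k fun u _ => cov_le k _).trans ?_
  simp [Nat.mul_comm]

/-- The consequence of `pot` for the number of changes. -/
theorem Good.ops_le_sum (G : Good n k κ σ) : σ.ops ≤ bet k * ∑ u ∈ range n, σ.d u := by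
  have := G.pot
  have e : 2 * bet k * ∑ u ∈ range n, σ.d u = 2 * (bet k * ∑ u ∈ range n, σ.d u) := by ring
  omega

theorem Good.ops_le (G : Good n k κ σ) (L : Lim (bet k + 1) σ) :
    σ.ops ≤ bet k * (bet k * n) := by
  refine G.ops_le_sum.trans (Nat.mul_le_mul_left _ ?_)
  refine (Finset.sum_le_card_nsmul _ _ (bet k) fun u _ => G.d_le L u).trans ?_
  simp [Nat.mul_comm]

/-- Put a copy of the edge `uv` into the sparsifier. -/
def addEdge (k u v : ℕ) (σ : St) : St :=
  { halfAdd k v u (halfAdd k u v σ) with ops := σ.ops + 1 }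

/-- Remove a copy of an edge `zx` which is the neighbour number `i` of `z` and the neighbour
number `j` of `x` from the sparsifier, and put `x` on the stack. -/
def remEdge (k z i x j : ℕ) (σ : St) : St :=
  { halfRem k x j (halfRem k z i σ) with
    stk := Function.update σ.stk σ.sp x
    sp := σ.sp + 1
    ops := σ.ops + 1 }

theorem row_addEdge (huv : u ≠ v) (x : ℕ) : row (addEdge k u v σ) x =
    if x = u then v ::ₘ row σ u else if x = v then u ::ₘ row σ v else row σ x := by
  have e : row (addEdge k u v σ) x = row (halfAdd k v u (halfAdd k u v σ)) x := rfl
  rw [e, row_halfAdd, row_halfAdd, row_halfAdd, if_neg huv.symm]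
  by_cases h : x = u
  · subst h; simp [huv]
  · simp [h]

theorem row_remEdge (hzx : z ≠ x) (hi : i < σ.d z) (hx : σ.slot z i = x) (hj : j < σ.d x)
    (hz : σ.slot x j = z) (y : ℕ) : row (remEdge k z i x j σ) y =
    if y = z then (row σ z).erase x else if y = x then (row σ x).erase z else row σ y := by
  have e : row (remEdge k z i x j σ) y = row (halfRem k x j (halfRem k z i σ)) y := rfl
  have h1 : (halfRem k z i σ).d x = σ.d x := by simp [halfRem, hzx.symm]
  have h2 : (halfRem k z i σ).slot x j = z := by
    simp [halfRem, upd2_apply, hzx.symm, hz]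
  rw [e, row_halfRem (by rw [h1]; exact hj), row_halfRem hi, row_halfRem hi, h2, hx,
    if_neg hzx.symm]
  by_cases h : y = z
  · subst h; simp [hzx]
  · simp [h]

theorem d_addEdge (huv : u ≠ v) : (addEdge k u v σ).d =
    Function.update (Function.update σ.d u (σ.d u + 1)) v (σ.d v + 1) := by
  simp [addEdge, halfAdd, Function.update_of_ne huv.symm]

theorem d_remEdge (hzx : z ≠ x) : (remEdge k z i x j σ).d =
    Function.update (Function.update σ.d z (σ.d z - 1)) x (σ.d x - 1) := by
  simp [remEdge, halfRem, Function.update_of_ne hzx.symm]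

theorem sum_update₂ (hu : u < n) (hv : v < n) (huv : u ≠ v) (f : ℕ → ℕ) (d : ℕ → ℕ) (a b : ℕ) :
    ∑ y ∈ range n, f (Function.update (Function.update d u a) v b y) + f (d u) + f (d v)
      = ∑ y ∈ range n, f (d y) + f a + f b := by
  have h1 := sum_update hv (fun _ => f) (Function.update d u a) b
  have h2 := sum_update hu (fun _ => f) d a
  simp only [Function.update_of_ne huv.symm] at h1
  omega

theorem cov_mono {a b : ℕ} (k : ℕ) (h : a ≤ b) : cov k a ≤ cov k b := by unfold cov; omega

theorem dv_halfAdd (hdv : σ.dv = ∑ u ∈ range n, cov k (σ.d u)) (hu : u < n) :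
    (halfAdd k u v σ).dv = ∑ y ∈ range n, cov k ((halfAdd k u v σ).d y) := by
  have := sum_update hu (fun _ => cov k) σ.d (σ.d u + 1)
  have := cov_mono k (Nat.le_add_right (σ.d u) 1)
  simp only [halfAdd]
  omega

theorem dv_halfRem (hdv : σ.dv = ∑ u ∈ range n, cov k (σ.d u)) (hu : u < n) :
    (halfRem k u i σ).dv = ∑ y ∈ range n, cov k ((halfRem k u i σ).d y) := by
  have := sum_update hu (fun _ => cov k) σ.d (σ.d u - 1)
  simp only [halfRem]
  omega

theorem Good.addEdge (G : Good n k κ σ) (h : Adj σ u v) (hd : σ.d u + σ.d v + 1 < bet k) :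
    Good n k κ (addEdge k u v σ) := by
  have huv := G.ne h
  have hu := G.adjn _ _ h
  have hv := G.adjn' h
  have hr := row_addEdge (σ := σ) (k := k) huv
  have hdd := d_addEdge (σ := σ) (k := k) huv
  have s1 := sum_update₂ hu hv huv (fun x => x) σ.d (σ.d u + 1) (σ.d v + 1)
  have s2 := sum_update₂ hu hv huv (fun x => x * x) σ.d (σ.d u + 1) (σ.d v + 1)
  refine ⟨fun y hy => ?_, fun a b => ?_, fun a b hb => ?_, G.adjs, G.adjn, G.bip, G.degb, ?_, ?_,
    G.cntT, ?_, ?_, fun i hi => ?_, fun y hy => ?_, G.stkn⟩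
  · rw [hdd, Function.update_of_ne (by omega), Function.update_of_ne (by omega), G.dz y hy]
  · have hc : ∀ a b, (row (IncrementalMatching.addEdge k u v σ) a).count b = (row σ a).count b
        + (if a = u ∧ b = v then 1 else 0) + (if a = v ∧ b = u then 1 else 0) := by
      intro a b
      rw [hr]
      split_ifs <;> simp_all
    rw [hc, hc, G.sym a b]
    simp only [and_comm (a := b = _)]
    ring
  · have hA : Adj (IncrementalMatching.addEdge k u v σ) a b ↔ Adj σ a b := Iff.rfl
    rw [hA]
    rw [hr] at hb
    split_ifs at hb with h1 h2
    · subst h1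
      rcases Multiset.mem_cons.1 hb with h3 | h3
      · subst h3; exact h
      · exact G.sub _ _ h3
    · subst h2
      rcases Multiset.mem_cons.1 hb with h3 | h3
      · subst h3; exact G.adjs _ _ h
      · exact G.sub _ _ h3
    · exact G.sub _ _ hb
  · have := G.pot
    have e : (IncrementalMatching.addEdge k u v σ).ops = σ.ops + 1 := rfl
    rw [hdd, e]
    nlinarith
  · have := G.cnts
    simp only [IncrementalMatching.addEdge, halfAdd]; omega
  · have := G.lgs
    simp only [IncrementalMatching.addEdge, halfAdd]; omega
  · exact dv_halfAdd (v := u) (dv_halfAdd (v := v) G.dvs hu) hv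
  · simp only [IncrementalMatching.addEdge, halfAdd] at hi ⊢
    simp only [Function.update_apply]
    split_ifs
    · exact hv
    · exact hu
    · exact G.logn i (by omega)
  · have hlog : ∀ y, (∃ i < σ.lg, σ.log i = y) →
        ∃ i < (IncrementalMatching.addEdge k u v σ).lg,
          (IncrementalMatching.addEdge k u v σ).log i = y := by
      rintro y ⟨i, hi, hy⟩
      refine ⟨i, ?_, ?_⟩
      · simp only [IncrementalMatching.addEdge, halfAdd]; omega
      · simp only [IncrementalMatching.addEdge, halfAdd]
        rw [Function.update_of_ne (by omega), Function.update_of_ne (by omega), hy]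
    by_cases h1 : y = u
    · subst h1
      refine ⟨σ.lg, ?_, ?_⟩ <;> simp [IncrementalMatching.addEdge, halfAdd]
    by_cases h2 : y = v
    · subst h2
      refine ⟨σ.lg + 1, ?_, ?_⟩ <;> simp [IncrementalMatching.addEdge, halfAdd]
    rw [hdd, Function.update_of_ne h2, Function.update_of_ne h1] at hy
    exact hlog y (G.logd y hy)

theorem Ext.addEdge (k u v : ℕ) (σ : St) : Ext σ (addEdge k u v σ) := by
  refine ⟨rfl, rfl, rfl, rfl, rfl, rfl, rfl, ?_, fun i hi => ?_, le_rfl, fun _ _ => rfl, ?_⟩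
  · simp only [IncrementalMatching.addEdge, halfAdd]; omega
  · simp only [IncrementalMatching.addEdge, halfAdd]
    rw [Function.update_of_ne (by omega), Function.update_of_ne (by omega)]
  · simp only [IncrementalMatching.addEdge, halfAdd]; omega

theorem Ext.remEdge (k z i x j : ℕ) (σ : St) : Ext σ (remEdge k z i x j σ) := by
  refine ⟨rfl, rfl, rfl, rfl, rfl, rfl, rfl, le_rfl, fun i hi => rfl, ?_, fun i hi => ?_, ?_⟩
  · simp [IncrementalMatching.remEdge]
  · simp only [IncrementalMatching.remEdge]
    rw [Function.update_of_ne (by omega)]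
  · simp only [IncrementalMatching.remEdge, halfRem]; omega

theorem Good.remEdge (G : Good n k κ σ) (hi : i < σ.d z) (hx : σ.slot z i = x) (hj : j < σ.d x)
    (hz : σ.slot x j = z) (hd : bet k < σ.d z + σ.d x) :
    Good n k κ (remEdge k z i x j σ) ∧ Adj σ z x := by
  have h : Adj σ z x := G.sub _ _ (mem_row.2 ⟨i, hi, hx⟩)
  refine ⟨?_, h⟩
  have hzx := G.ne h
  have hzn := G.adjn _ _ h
  have hxn := G.adjn' h
  have hr := row_remEdge (σ := σ) (k := k) hzx hi hx hj hz
  have hdd := d_remEdge (σ := σ) (k := k) (i := i) (j := j) hzx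
  obtain ⟨p, hp⟩ : ∃ p, σ.d z = p + 1 := ⟨σ.d z - 1, by omega⟩
  obtain ⟨q, hq⟩ : ∃ q, σ.d x = q + 1 := ⟨σ.d x - 1, by omega⟩
  have s1 := sum_update₂ hzn hxn hzx (fun x => x) σ.d (σ.d z - 1) (σ.d x - 1)
  have s2 := sum_update₂ hzn hxn hzx (fun x => x * x) σ.d (σ.d z - 1) (σ.d x - 1)
  refine ⟨fun y hy => ?_, fun a b => ?_, fun a b hb => ?_, G.adjs, G.adjn, G.bip, G.degb, ?_, ?_,
    G.cntT, ?_, ?_, G.logn, fun y hy => ?_, fun i hi => ?_⟩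
  · rw [hdd, Function.update_of_ne (by omega), Function.update_of_ne (by omega), G.dz y hy]
  · have hxz : x ∈ row σ z := mem_row.2 ⟨i, hi, hx⟩
    have hzx' : z ∈ row σ x := mem_row.2 ⟨j, hj, hz⟩
    have hc : ∀ a b, (row (IncrementalMatching.remEdge k z i x j σ) a).count b
        + (if a = z ∧ b = x then 1 else 0) + (if a = x ∧ b = z then 1 else 0)
        = (row σ a).count b := by
      intro a b
      rw [hr]
      by_cases ha : a = z
      · rw [if_pos ha, ha, ← Multiset.cons_erase hxz, Multiset.erase_cons_head,
          Multiset.count_cons]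
        simp [hzx]
      · by_cases ha' : a = x
        · rw [if_neg ha, if_pos ha', ha', ← Multiset.cons_erase hzx', Multiset.erase_cons_head,
            Multiset.count_cons]
          simp [hzx.symm]
        · simp [ha, ha']
    have h1 := hc a b
    have h2 := hc b a
    have h3 := G.sym a b
    simp only [and_comm (a := b = _)] at h2
    omega
  · have hA : Adj (IncrementalMatching.remEdge k z i x j σ) a b ↔ Adj σ a b := Iff.rfl
    rw [hA]
    rw [hr] at hb
    split_ifs at hb with h1 h2
    · subst h1; exact G.sub _ _ (Multiset.mem_of_mem_erase hb)
    · subst h2; exact G.sub _ _ (Multiset.mem_of_mem_erase hb)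
    · exact G.sub _ _ hb
  · have := G.pot
    have e : (IncrementalMatching.remEdge k z i x j σ).ops = σ.ops + 1 := rfl
    rw [hdd, e]
    simp only [hp, hq, Nat.add_sub_cancel] at s1 s2 hd ⊢
    nlinarith
  · have := G.cnts
    simp only [IncrementalMatching.remEdge, halfRem]; omega
  · have := G.lgs
    simp only [IncrementalMatching.remEdge, halfRem]; omega
  · exact dv_halfRem (i := j) (dv_halfRem (i := i) G.dvs hzn) hxn
  · refine G.logd y ?_
    rw [hdd] at hy
    simp only [Function.update_apply] at hy
    split_ifs at hy with h1 h2
    · subst h1; omega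
    · subst h2; omega
    · exact hy
  · simp only [IncrementalMatching.remEdge] at hi ⊢
    simp only [Function.update_apply]
    split_ifs
    · exact hxn
    · exact G.stkn i (by omega)

end

/-! ### Saturating an edge -/

/-- With the vertex `z` in register `5` and its neighbour number `i`, where `i` is in register `6`,
in register `7`: remove this copy of an edge, and put the neighbour on the stack. -/
def remP : Prog :=
  halfRemP 5 6 ;;
  .assign 8 (.const 0) ;;
  .loop (ltE (eqE (.load (addr 7 (idx (.reg 7) (.reg 8)))) (.reg 5)) (.const 1))
    (.assign 8 (.reg 8 + .const 1)) ;;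
  halfRemP 7 8 ;;
  .store (addr 3 (.reg 38)) (.reg 7) ;;
  .assign 38 (.reg 38 + .const 1)

/-- Remove one edge at the vertex in register `5` whose degrees add up to more than `bet k`, if
there is one. -/
def fixP : Prog :=
  .assign 6 (.const 0) ;;
  .loop (ltE (.reg 6) (degE 5))
    (.assign 7 (.load (addr 7 (idx (.reg 5) (.reg 6)))) ;;
      .ite (ltE (.reg 34) (degE 5 + degE 7))
        (remP ;; .assign 6 (.reg 34))
        (.assign 6 (.reg 6 + .const 1)))

/-- Add copies of the edge between the vertices in the registers `3` and `4` until their degrees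
add up to `bet k - 1`; after each addition remove one edge at each endpoint where the degrees have
become too large. -/
def satP : Prog :=
  .loop (ltE (degE 3 + degE 4 + .const 1) (.reg 34))
    (halfAddP 3 4 ;; halfAddP 4 3 ;; .assign 5 (.reg 3) ;; fixP ;; .assign 5 (.reg 4) ;; fixP)

/-- What removals of edges from the sparsifier may change. -/
structure Shrink (σ σ' : St) : Prop extends Ext σ σ' where
  d_le : ∀ y, σ'.d y ≤ σ.d y
  row_sub : ∀ a b, b ∈ row σ' a → b ∈ row σ a

theorem Shrink.lim {σ σ' : St} {b : ℕ} (S : Shrink σ σ') (L : Lim b σ) : Lim b σ' := fun u v h =>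
  (Nat.add_le_add (S.d_le u) (S.d_le v)).trans (L u v (S.row_sub u v h))

section
variable {w n k : ℕ} {κ : ℕ → Prop} {σ : St} {τ : ℕ → ℕ} {Q : St → (ℕ → ℕ) → ℕ → Prop}
  {e e' : Expr} {a b u v i x y z : ℕ}

theorem eval_lt_eq_zero (F : Fits w n k) {s : State} (ha : e.eval w s = x)
    (hb : e'.eval w s = y) : (ltE e e').eval w s = 0 ↔ y ≤ x := by
  have := F.big
  rw [eval_ltE, ha, hb]
  split_ifs with h
  · rw [Nat.mod_eq_of_lt (by omega)]; omega
  · simp; omega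

theorem eval_eq_one (F : Fits w n k) {s : State} (ha : e.eval w s = x)
    (hb : e'.eval w s = y) : (eqE e e').eval w s = if x = y then 1 else 0 := by
  have := F.big
  rw [eval_eqE, ha, hb]
  split_ifs with h
  · rw [Nat.mod_eq_of_lt (by omega)]
  · simp

/-- The counter `ops` is not stored in the machine, so its value may be chosen freely. -/
theorem Rn.ghost {P : Prog} (f : St → ℕ)
    (h : Rn w n k P σ τ fun σ' τ' t => Q { σ' with ops := f σ' } τ' t) : Rn w n k P σ τ Q := by
  obtain ⟨t, σ', τ', h1, h2⟩ := h
  exact ⟨t, { σ' with ops := f σ' }, τ', h1, h2⟩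

theorem eval_const_lt (F : Fits w n k) {c : ℕ} (hc : c < 100) {s : State} :
    (Expr.const c).eval w s = c := by
  have := F.big
  rw [eval_const, Nat.mod_eq_of_lt (by omega)]

/-- The specification of `remP`. The search for the copy in the other list is linear in the degree,
and only `z` can lose degree without being put on the stack. -/
theorem Rn.rem (F : Fits w n k) (G : Good n k κ σ) (L : Lim (bet k + 1) σ)
    (h5 : τ 5 = z) (h6 : τ 6 = i) (hi : i < σ.d z) (h7 : τ 7 = x) (hx : σ.slot z i = x)
    (hd : bet k < σ.d z + σ.d x)
    (h : ∀ σ' τ' t, Good n k κ σ' → Shrink σ σ' → (∀ y, y ≠ z → σ.d y ≤ σ'.d y ∨ OnStk σ' y) →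
      σ'.d z + 1 = σ.d z → (∀ l, l ≠ 8 → τ' l = τ l) →
      t ≤ 2000 + 200 * bet k → Q σ' τ' t) :
    Rn w n k remP σ τ Q := by
  have B := F.bounds
  have hA : Adj σ z x := G.sub _ _ (mem_row.2 ⟨i, hi, hx⟩)
  have hzx := G.ne hA
  have hzn := G.adjn _ _ hA
  have hxn := G.adjn' hA
  obtain ⟨j₀, hj₀, hjz⟩ := mem_row.1 (G.row_symm (mem_row.2 ⟨i, hi, hx⟩))
  have hdx := G.d_le L x
  have hops := G.ops_le L
  have hcnt := G.cnts
  have e1 : (IncrementalMatching.halfRem k z i σ).d x = σ.d x := by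
    simp [IncrementalMatching.halfRem, hzx.symm]
  have e2 : ∀ l, (IncrementalMatching.halfRem k z i σ).slot x l = σ.slot x l := by
    intro l; simp [IncrementalMatching.halfRem, upd2_apply, hzx.symm]
  refine Rn.seq (Rn.halfRem F (by decide) (by decide) h5 h6 hzn (G.d_le L z) hi G.dv_le
    fun t1 ht1 => ?_)
  refine Rn.seq (Rn.assign (by decide) (eval_const_lt F (c := 0) (by decide)) fun c2 hc2 => ?_)
  refine Rn.seq (Rn.loop
    (fun σ' τ' t => σ' = IncrementalMatching.halfRem k z i σ ∧ ∃ j ≤ j₀,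
      τ' = Function.update τ 8 j ∧ t ≤ 200 * j) (fun _ τ' => j₀ - τ' 8) ?_ ?_)
  · exact ⟨rfl, 0, Nat.zero_le _, rfl, le_rfl⟩
  rintro σ' τ' t ⟨rfl, j, hj, rfl, ht⟩ c3 hc3
  have hev := eval_eq_one (e' := .reg 5) F (eval_slot (k := k)
      (σ := IncrementalMatching.halfRem k z i σ) (τ := Function.update τ 8 j) F
      (a := .reg 7) (b := .reg 8) (eval_tmp (by decide) (by simpa using h7))
      (eval_tmp (x := j) (by decide) (by simp)) hxn (by omega))
      (eval_tmp (x := z) (by decide) (by simpa using h5))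
  rw [e2] at hev
  have hev' := eval_lt_eq_zero (e' := .const 1) F hev (eval_const_lt F (by decide))
  constructor
  · intro h0
    rw [hev'] at h0
    have hjz' : σ.slot x j = z := by by_contra hne; simp [hne] at h0
    have hjd : j < σ.d x := by omega
    have dv' : (IncrementalMatching.halfRem k z i σ).dv ≤ k * n := by
      rw [dv_halfRem G.dvs hzn]
      refine (Finset.sum_le_card_nsmul _ _ k fun u _ => cov_le k _).trans ?_
      simp [Nat.mul_comm]
    refine Rn.seq (Rn.halfRem (u := x) (i := j) F (by decide) (by decide) (by simpa using h7)
      (by simp) hxn (by omega) (by omega) dv' fun t2 ht2 => ?_)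
    refine Rn.seq (Rn.store_stk (i := σ.sp) (x := x) F rfl (by omega)
      (eval_tmp (by decide) (by simpa using h7)) fun c4 hc4 => ?_)
    refine Rn.ghost (fun σ' => σ'.ops + 1) ?_
    refine Rn.assign_sp (x := σ.sp + 1) (eval_add_one rfl (by omega))
      fun c5 hc5 => ?_
    have G' := (G.remEdge hi hx hjd hjz' hd).1
    have hd' := d_remEdge (σ := σ) (k := k) (i := i) (j := j) hzx
    have hr' := row_remEdge (σ := σ) (k := k) hzx hi hx hjd hjz'
    have hE := Ext.remEdge k z i x j σ
    refine h (IncrementalMatching.remEdge k z i x j σ) _ _ G' ⟨hE, ?_, ?_⟩ ?_ ?_ ?_ (by omega)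
    · intro y; rw [hd']; simp only [Function.update_apply]; split_ifs <;> simp_all
    · intro a b hb
      rw [hr'] at hb
      split_ifs at hb with h1 h2
      · subst h1; exact Multiset.mem_of_mem_erase hb
      · subst h2; exact Multiset.mem_of_mem_erase hb
      · exact hb
    · intro y hy
      by_cases hyx : y = x
      · right
        refine ⟨σ.sp, ?_, ?_⟩ <;> simp [IncrementalMatching.remEdge, hyx]
      · left; rw [hd', Function.update_of_ne hyx, Function.update_of_ne hy]
    · rw [hd', Function.update_of_ne hzx, Function.update_self]; omega
    · intro l hl; simp [hl]
  · intro h0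
    rw [Ne, hev'] at h0
    have hne : σ.slot x j ≠ z := by intro hne; simp [hne] at h0
    have : j ≠ j₀ := by rintro rfl; exact hne hjz
    refine Rn.assign (by decide) (eval_add_one (x := j)
      (eval_tmp (by decide) (by simp)) (by omega)) fun c6 hc6 => ?_
    refine ⟨⟨rfl, j + 1, by omega, by simp, by omega⟩, ?_⟩
    simp only [Function.update_self]; omega

/-- The specification of `fixP`. If the degrees of all edges add up to at most `bet k + 1`, one
removal suffices to bring the sums at `z` down to `bet k`. -/
theorem Rn.fix (F : Fits w n k) (G : Good n k κ σ) (L : Lim (bet k + 1) σ)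
    (h5 : τ 5 = z) (hzn : z < n)
    (h : ∀ σ' τ' t, Good n k κ σ' → Shrink σ σ' → (∀ y, y ≠ z → σ.d y ≤ σ'.d y ∨ OnStk σ' y) →
      σ.d z ≤ σ'.d z + 1 → (∀ b, b ∈ row σ' z → σ'.d z + σ'.d b ≤ bet k) →
      (∀ l, l < 6 ∨ 8 < l → τ' l = τ l) →
      t ≤ 700 * bet k + 3000 → Q σ' τ' t) :
    Rn w n k fixP σ τ Q := by
  have B := F.bounds
  refine Rn.seq (Rn.assign (by decide) (eval_const_lt F (c := 0) (by decide)) fun c1 hc1 => ?_)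
  refine Rn.loop (fun σ' τ' t => τ' 6 ≤ bet k ∧ (∀ l, l < 6 ∨ 8 < l → τ' l = τ l) ∧
      ((σ' = σ ∧ τ' 6 ≤ σ.d z ∧ t ≤ 500 * τ' 6 ∧
          ∀ i < τ' 6, σ.d z + σ.d (σ.slot z i) ≤ bet k) ∨
        (Good n k κ σ' ∧ Shrink σ σ' ∧ (∀ y, y ≠ z → σ.d y ≤ σ'.d y ∨ OnStk σ' y) ∧
          σ'.d z + 1 = σ.d z ∧ τ' 6 = bet k ∧ t ≤ 700 * bet k + 2000)))
    (fun _ τ' => bet k - τ' 6) ?_ ?_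
  · refine ⟨by simp, fun l hl => Function.update_of_ne (by omega) _ _, Or.inl ⟨rfl, ?_⟩⟩
    simp
  rintro σ' τ' t ⟨hb, hτ, ⟨rfl, hi, ht, hall⟩ | ⟨G', S, hS, hz, h6, ht⟩⟩ c2 hc2
  · have h5' : τ' 5 = z := (hτ 5 (by omega)).trans h5
    have hev := eval_lt_eq_zero (e := .reg 6) (e' := degE 5) F
      (eval_tmp (w := w) (n := n) (k := k) (σ := σ') (τ := τ') (by decide) rfl)
      (eval_degE F (by decide) h5' hzn)
    refine ⟨fun h0 => ?_, fun h0 => ?_⟩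
    · rw [hev] at h0
      refine h _ _ _ G ⟨Ext.refl _, fun _ => le_rfl, fun _ _ h => h⟩ (fun _ _ => Or.inl le_rfl)
        (by omega) ?_ hτ (by omega)
      intro b hb
      obtain ⟨i, hi', rfl⟩ := mem_row.1 hb
      exact hall i (by omega)
    · rw [Ne, hev] at h0
      have hdz := G.d_le L z
      have hA : Adj σ' z (σ'.slot z (τ' 6)) := G.sub _ _ (mem_row.2 ⟨_, by omega, rfl⟩)
      have hxn := G.adjn' hA
      have hdx := G.d_le L (σ'.slot z (τ' 6))
      refine Rn.seq (Rn.assign (x := σ'.slot z (τ' 6)) (by decide)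
        (eval_slot F (eval_tmp (by decide) h5') (eval_tmp (by decide) rfl) hzn (by omega))
        fun c3 hc3 => ?_)
      have hev2 := eval_lt_eq_zero (e := .reg 34) (e' := degE 5 + degE 7) (x := bet k)
        (s := enc n k σ' (Function.update τ' 7 (σ'.slot z (τ' 6)))) F rfl
        (eval_add_of (w := w) (eval_degE F (u := z) (by decide) (by simpa using h5') hzn).symm
          (eval_degE F (u := σ'.slot z (τ' 6)) (by decide) (by simp) hxn).symm (by omega))
      refine Rn.ite (fun h1 c4 hc4 => ?_) (fun h1 c4 hc4 => ?_)
      · rw [Ne, hev2] at h1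
        refine Rn.seq (Rn.rem F G L (z := z) (i := τ' 6) (x := σ'.slot z (τ' 6))
          (by simpa using h5')
          (by simp) (by omega) (by simp) rfl (by omega) ?_)
        intro σ'' τ'' t'' G' S hS hz hτ' ht'
        refine Rn.assign (x := bet k) (by decide) rfl fun c5 hc5 => ?_
        have h6 : Function.update τ'' 6 (bet k) 6 = bet k := Function.update_self ..
        refine ⟨⟨h6.le, fun l hl => ?_, Or.inr ⟨G', S, hS, hz, h6, ?_⟩⟩, ?_⟩
        · rw [Function.update_of_ne (by omega), hτ' l (by omega),
            Function.update_of_ne (by omega), hτ l hl]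
        · omega
        · rw [h6]; omega
      · rw [hev2] at h1
        refine Rn.assign (x := τ' 6 + 1) (by decide) (eval_add_one
          (eval_tmp (by decide) (by simp)) (by omega)) fun c5 hc5 => ?_
        have h6 : Function.update (Function.update τ' 7 (σ'.slot z (τ' 6))) 6 (τ' 6 + 1) 6
          = τ' 6 + 1 := Function.update_self ..
        refine ⟨⟨by omega, fun l hl => ?_, Or.inl ⟨rfl, by omega, by omega, ?_⟩⟩, by omega⟩
        · rw [Function.update_of_ne (by omega), Function.update_of_ne (by omega), hτ l hl]
        · intro i hi'
          rw [h6] at hi'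
          rcases Nat.lt_succ_iff_lt_or_eq.1 hi' with h2 | rfl
          · exact hall i h2
          · omega
  · have h5' : τ' 5 = z := (hτ 5 (by omega)).trans h5
    have hev := eval_lt_eq_zero (e := .reg 6) (e' := degE 5) F
      (eval_tmp (w := w) (n := n) (k := k) (σ := σ') (τ := τ') (by decide) rfl)
      (eval_degE F (by decide) h5' hzn)
    have hdz := G'.d_le (S.lim L) z
    refine ⟨fun h0 => ?_, fun h0 => ?_⟩
    · refine h _ _ _ G' S hS (by omega) ?_ hτ (by omega)
      intro b hb
      have := L z b (S.row_sub z b hb)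
      have := S.d_le b
      omega
    · rw [Ne, hev] at h0; omega

/-- Only vertices on the stack have lost degree. -/
def Drop (σ σ' : St) : Prop := ∀ y, σ.d y ≤ σ'.d y ∨ OnStk σ' y

theorem Drop.trans {σ σ' σ'' : St} (h : Drop σ σ') (h' : Drop σ' σ'') (e : Ext σ' σ'') :
    Drop σ σ'' := fun y => by
  rcases h y with h | h
  · rcases h' y with h' | h'
    · exact Or.inl (h.trans h')
    · exact Or.inr h'
  · exact Or.inr (h.ext e)

/-- One round of `satP`. The new copy raises the two degrees by `1`, so one removal at each endpoint
restores the limit, and a vertex whose degree is smaller in the end is on the stack. -/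
theorem Rn.step (F : Fits w n k) (G : Good n k κ σ) (L : Lim (bet k) σ)
    (h3 : τ 3 = u) (h4 : τ 4 = v) (hA : Adj σ u v) (hd : σ.d u + σ.d v + 1 < bet k)
    (h : ∀ σ' τ' t, Good n k κ σ' → Lim (bet k) σ' → Ext σ σ' → Drop σ σ' → σ.ops < σ'.ops →
      (∀ l, l < 5 ∨ 8 < l → τ' l = τ l) → t ≤ 1500 * bet k → Q σ' τ' t) :
    Rn w n k (halfAddP 3 4 ;; halfAddP 4 3 ;; .assign 5 (.reg 3) ;; fixP ;;
      .assign 5 (.reg 4) ;; fixP) σ τ Q := by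
  have B := F.bounds
  have hk : 64 ≤ k * k := Nat.mul_le_mul F.eight F.eight
  have huv := G.ne hA
  have hun := G.adjn _ _ hA
  have hvn := G.adjn' hA
  have hops := G.ops_le (L.mono (Nat.le_succ _))
  have hlg := G.lgs
  have e1 : (IncrementalMatching.halfAdd k u v σ).d v = σ.d v := by
    simp [IncrementalMatching.halfAdd, huv.symm]
  have e2 : (IncrementalMatching.halfAdd k u v σ).lg = σ.lg + 1 := rfl
  have dv' : (IncrementalMatching.halfAdd k u v σ).dv ≤ k * n := by
    rw [dv_halfAdd G.dvs hun]
    refine (Finset.sum_le_card_nsmul _ _ k fun u _ => cov_le k _).trans ?_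
    simp [Nat.mul_comm]
  -- The potential bounds the number of changes made so far together with the present one.
  have G1 := G.addEdge hA hd
  have hdd := d_addEdge (σ := σ) (k := k) huv
  have hrr := row_addEdge (σ := σ) (k := k) huv
  have hdu : (addEdge k u v σ).d u = σ.d u + 1 := by
    rw [hdd, Function.update_of_ne huv, Function.update_self]
  have hdv : (addEdge k u v σ).d v = σ.d v + 1 := by rw [hdd, Function.update_self]
  have hdy : ∀ y, y ≠ u → y ≠ v → (addEdge k u v σ).d y = σ.d y := fun y h1 h2 => by
    rw [hdd, Function.update_of_ne h2, Function.update_of_ne h1]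
  have L1 : Lim (bet k + 1) (addEdge k u v σ) := by
    have hu1 : ∀ b, b ∈ row σ u → (addEdge k u v σ).d b ≤ σ.d b ∨ b = v := by
      intro b hb
      by_cases h2 : b = v
      · exact Or.inr h2
      · exact Or.inl (hdy b (G.ne (G.sub _ _ hb)).symm h2).le
    have hv1 : ∀ b, b ∈ row σ v → (addEdge k u v σ).d b ≤ σ.d b ∨ b = u := by
      intro b hb
      by_cases h2 : b = u
      · exact Or.inr h2
      · exact Or.inl (hdy b h2 (G.ne (G.sub _ _ hb)).symm).le
    intro a b hb
    rw [hrr] at hb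
    split_ifs at hb with h1 h2
    · subst h1
      rcases Multiset.mem_cons.1 hb with h3 | h3
      · subst h3; omega
      · have := L _ _ h3
        rcases hu1 b h3 with h4 | rfl <;> omega
    · subst h2
      rcases Multiset.mem_cons.1 hb with h3 | h3
      · subst h3; omega
      · have := L _ _ h3
        rcases hv1 b h3 with h4 | rfl <;> omega
    · have := L _ _ hb
      have h3 := hdy a h1 h2
      by_cases h4 : b = u
      · subst h4; omega
      · by_cases h5 : b = v
        · subst h5; omega
        · have := hdy b h4 h5; omega
  have hops1 := G1.ops_le L1
  have hlg1 := G1.lgs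
  have e3 : (addEdge k u v σ).lg = σ.lg + 2 := rfl
  refine Rn.seq (Rn.halfAdd F (by decide) (by decide) h3 h4 hun (by omega) G.dv_le (by omega)
    fun t1 ht1 => ?_)
  refine Rn.seq (Rn.ghost (fun σ' => σ'.ops + 1) (Rn.halfAdd (u := v) (v := u) F (by decide)
    (by decide) h4 h3 hvn (by omega) dv' (by omega) fun t2 ht2 => ?_))
  change Rn w n k _ (addEdge k u v σ) τ _
  refine Rn.seq (Rn.assign (x := u) (by decide) (eval_tmp (by decide) h3) fun c3 hc3 => ?_)
  refine Rn.seq (Rn.fix F G1 L1 (z := u) (by simp) hun ?_)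
  intro σ2 τ2 t2 G2 S2 D2 du2 E2 hτ2 ht2
  refine Rn.seq (Rn.assign (x := v) (by decide) (eval_tmp (by decide)
    ((hτ2 4 (by omega)).trans (by simpa using h4))) fun c4 hc4 => ?_)
  refine Rn.fix F G2 (S2.lim L1) (z := v) (by simp) hvn ?_
  intro σ3 τ3 t3 G3 S3 D3 dv3 E3 hτ3 ht3
  have X : Ext σ σ3 := (Ext.addEdge k u v σ).trans (S2.toExt.trans S3.toExt)
  refine h _ _ _ G3 ?_ X ?_ ?_ ?_ (by omega)
  · have hu3 : ∀ b, b ∈ row σ3 u → σ3.d u + σ3.d b ≤ bet k := fun b hb =>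
      (Nat.add_le_add (S3.d_le u) (S3.d_le b)).trans (E2 b (S3.row_sub _ _ hb))
    intro a b hb
    by_cases a1 : a = u
    · subst a1; exact hu3 b hb
    by_cases a2 : a = v
    · subst a2; exact E3 b hb
    by_cases b1 : b = u
    · subst b1; rw [Nat.add_comm]; exact hu3 a (G3.row_symm hb)
    by_cases b2 : b = v
    · subst b2; rw [Nat.add_comm]; exact E3 a (G3.row_symm hb)
    have h1 := S2.row_sub _ _ (S3.row_sub _ _ hb)
    rw [hrr, if_neg a1, if_neg a2] at h1
    have := L a b h1
    have := (S3.d_le a).trans ((S2.d_le a).trans (hdy a a1 a2).le)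
    have := (S3.d_le b).trans ((S2.d_le b).trans (hdy b b1 b2).le)
    omega
  · intro y
    by_cases a1 : y = u
    · subst a1
      rcases D3 y huv with h1 | h1
      · left; omega
      · exact Or.inr h1
    have h2 := D2 y a1
    by_cases a2 : y = v
    · subst a2
      rcases h2 with h1 | h1
      · left; omega
      · exact Or.inr (h1.ext S3.toExt)
    rw [hdy y a1 a2] at h2
    rcases h2 with h1 | h1
    · rcases D3 y a2 with h3 | h3
      · exact Or.inl (h1.trans h3)
      · exact Or.inr h3
    · exact Or.inr (h1.ext S3.toExt)
  · have h1 := S2.spo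
    have h2 := S3.spo
    have h3 := S2.sp
    have h4 := S3.sp
    have h5 : (addEdge k u v σ).ops = σ.ops + 1 := rfl
    omega
  · intro l hl
    rw [hτ3 l (by omega), Function.update_of_ne (by omega), hτ2 l (by omega),
      Function.update_of_ne (by omega)]

/-- The specification of `satP`: its time is paid for by the changes of the sparsifier. -/
theorem Rn.sat (F : Fits w n k) (G : Good n k κ σ) (L : Lim (bet k) σ)
    (h3 : τ 3 = u) (h4 : τ 4 = v) (hA : Adj σ u v)
    (h : ∀ σ' τ' t, Good n k κ σ' → Lim (bet k) σ' → Ext σ σ' → Drop σ σ' →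
      bet k ≤ σ'.d u + σ'.d v + 1 →
      (∀ l, l < 5 ∨ 8 < l → τ' l = τ l) →
      t + 1600 * bet k * σ.ops ≤ 1600 * bet k * σ'.ops + 100 → Q σ' τ' t) :
    Rn w n k satP σ τ Q := by
  have B := F.bounds
  have hun := G.adjn _ _ hA
  have hvn := G.adjn' hA
  refine Rn.loop (fun σ' τ' t => Good n k κ σ' ∧ Lim (bet k) σ' ∧ Ext σ σ' ∧ Drop σ σ' ∧
      (∀ l, l < 5 ∨ 8 < l → τ' l = τ l) ∧
      t + 1600 * bet k * σ.ops ≤ 1600 * bet k * σ'.ops)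
    (fun σ' _ => bet k * (bet k * n) - σ'.ops) ?_ ?_
  · exact ⟨G, L, Ext.refl _, fun _ => Or.inl le_rfl, fun _ _ => rfl, by omega⟩
  rintro σ' τ' t ⟨G', L', X, D, hτ, ht⟩ c hc
  have h3' : τ' 3 = u := (hτ 3 (by omega)).trans h3
  have h4' : τ' 4 = v := (hτ 4 (by omega)).trans h4
  have du := G'.d_le (L'.mono (Nat.le_succ _)) u
  have dv := G'.d_le (L'.mono (Nat.le_succ _)) v
  have hev := eval_lt_eq_zero (e := degE 3 + degE 4 + .const 1) (e' := .reg 34) F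
    (eval_add_one (w := w) (n := n) (k := k) (σ := σ') (τ := τ')
      (eval_add_of (eval_degE F (by decide) h3' hun).symm (eval_degE F (by decide) h4' hvn).symm
        (by omega)) (by omega)) (y := bet k) rfl
  refine ⟨fun h0 => ?_, fun h0 => ?_⟩
  · rw [hev] at h0
    exact h _ _ _ G' L' X D h0 hτ (by omega)
  · rw [Ne, hev] at h0
    refine Rn.step F G' L' h3' h4' ((X.adj_iff u v).2 hA) (by omega) ?_
    intro σ2 τ2 t2 G2 L2 X2 D2 hops hτ2 ht2
    have := G2.ops_le (L2.mono (Nat.le_succ _))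
    refine ⟨⟨G2, L2, X.trans X2, D.trans D2 X2, fun l hl => ?_, ?_⟩, by omega⟩
    · rw [hτ2 l hl, hτ l hl]
    · have : 1600 * bet k * (σ'.ops + 1) ≤ 1600 * bet k * σ2.ops := Nat.mul_le_mul_left _ hops
      rw [Nat.mul_add] at this
      omega

end

/-! ### Repairing the sparsifier -/

/-- Take a vertex from the stack and, unless this has happened `thr k` times before, go through
its edges in the graph. -/
def scanP : Prog :=
  .assign 38 (.reg 38 - .const 1) ;;
  .assign 3 (.load (addr 3 (.reg 38))) ;;
  .ite (ltE (.load (addr 1 (.reg 3))) (.reg 36))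
    (.store (addr 1 (.reg 3)) (.load (addr 1 (.reg 3)) + .const 1) ;;
      .assign 9 (.const 0) ;;
      .loop (ltE (.reg 9) (.load (addr 2 (.reg 3))))
        (.assign 4 (.load (addr 8 (idx (.reg 3) (.reg 9)))) ;;
          satP ;;
          .assign 9 (.reg 9 + .const 1)))
    .skip

/-- Work through the stack. -/
def cascadeP : Prog := .loop (ltE (.const 0) (.reg 38)) scanP

/-- The vertex is waiting for a scan or has been given up. -/
def Flag (k : ℕ) (σ : St) (y : ℕ) : Prop := OnStk σ y ∨ thr k ≤ σ.cnt y

/-- All edges of the graph have endpoints of large total degree in the sparsifier, except for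
edges at flagged vertices and for those in `X`. -/
def Pend (k : ℕ) (X : ℕ → ℕ → Prop) (σ : St) : Prop :=
  ∀ a b, Adj σ a b → bet k ≤ σ.d a + σ.d b + 1 ∨ Flag k σ a ∨ Flag k σ b ∨ X a b

theorem Flag.ext {k : ℕ} {σ σ' : St} {y : ℕ} (h : Flag k σ y) (e : Ext σ σ') : Flag k σ' y := by
  rcases h with h | h
  · exact Or.inl (h.ext e)
  · exact Or.inr (by rw [e.cnt]; exact h)

theorem Pend.sat {k : ℕ} {X X' : ℕ → ℕ → Prop} {σ σ' : St} {u v : ℕ} (h : Pend k X σ)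
    (e : Ext σ σ') (D : Drop σ σ') (hd : bet k ≤ σ'.d u + σ'.d v + 1)
    (hX : ∀ a b, X a b → X' a b ∨ (a = u ∧ b = v) ∨ (a = v ∧ b = u)) : Pend k X' σ' := by
  intro a b hab
  have h1 := h a b ((e.adj_iff a b).1 hab)
  rcases D a with ha | ha
  · rcases D b with hb | hb
    · rcases h1 with h1 | h1 | h1 | h1
      · left; omega
      · exact Or.inr (Or.inl (h1.ext e))
      · exact Or.inr (Or.inr (Or.inl (h1.ext e)))
      · rcases hX a b h1 with h2 | ⟨rfl, rfl⟩ | ⟨rfl, rfl⟩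
        · exact Or.inr (Or.inr (Or.inr h2))
        · exact Or.inl hd
        · left; omega
    · exact Or.inr (Or.inr (Or.inl (Or.inl hb)))
  · exact Or.inr (Or.inl (Or.inl ha))

/-- The data that the repair of the sparsifier does not change. -/
structure Keep (σ σ' : St) : Prop where
  mt : σ'.mt = σ.mt
  deg : σ'.deg = σ.deg
  adj : σ'.adj = σ.adj
  col : σ'.col = σ.col
  ms : σ'.ms = σ.ms
  pr : σ'.pr = σ.pr
  lg : σ.lg ≤ σ'.lg
  log : ∀ i < σ.lg, σ'.log i = σ.log i

theorem Ext.keep {σ σ' : St} (e : Ext σ σ') : Keep σ σ' :=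
  ⟨e.mt, e.deg, e.adj, e.col, e.ms, e.pr, e.lg, e.log⟩

theorem Keep.trans {σ σ' σ'' : St} (h : Keep σ σ') (h' : Keep σ' σ'') : Keep σ σ'' where
  mt := h'.mt.trans h.mt
  deg := h'.deg.trans h.deg
  adj := h'.adj.trans h.adj
  col := h'.col.trans h.col
  ms := h'.ms.trans h.ms
  pr := h'.pr.trans h.pr
  lg := h.lg.trans h'.lg
  log i hi := (h'.log i (hi.trans_le h.lg)).trans (h.log i hi)

/-- The total number of steps of all scans. -/
def scans (n : ℕ) (σ : St) : ℕ := ∑ x ∈ range n, σ.cnt x * σ.deg x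

section
variable {w n k : ℕ} {κ : ℕ → Prop} {σ : St} {τ : ℕ → ℕ} {Q : St → (ℕ → ℕ) → ℕ → Prop}
  {e e' : Expr} {a b u v i x y z : ℕ}

/-- The loop of `scanP` saturates all edges at `x`. The edges which the loop has still to treat are
the exceptions allowed by `Pend`. -/
theorem Rn.scanLoop (F : Fits w n k) (G : Good n k κ σ) (L : Lim (bet k) σ)
    (hP : Pend k (fun a b => a = x ∨ b = x) σ) (hx : τ 3 = x) (hxn : x < n)
    (h : ∀ σ' τ' t, Good n k κ σ' → Lim (bet k) σ' → Pend k (fun _ _ => False) σ' → Ext σ σ' →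
      t + 1600 * bet k * σ.ops ≤ 1600 * bet k * σ'.ops + 600 * σ.deg x + 200 → Q σ' τ' t) :
    Rn w n k (.assign 9 (.const 0) ;;
      .loop (ltE (.reg 9) (.load (addr 2 (.reg 3))))
        (.assign 4 (.load (addr 8 (idx (.reg 3) (.reg 9)))) ;;
          satP ;;
          .assign 9 (.reg 9 + .const 1))) σ τ Q := by
  have B := F.bounds
  have hdeg := G.degb x
  refine Rn.seq (Rn.assign (by decide) (eval_const_lt F (c := 0) (by decide)) fun c1 hc1 => ?_)
  refine Rn.loop (fun σ' τ' t => Good n k κ σ' ∧ Lim (bet k) σ' ∧ Ext σ σ' ∧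
      Pend k (fun a b => (a = x ∧ ∃ i, τ' 9 ≤ i ∧ i < σ.deg x ∧ σ.adj x i = b) ∨
        (b = x ∧ ∃ i, τ' 9 ≤ i ∧ i < σ.deg x ∧ σ.adj x i = a)) σ' ∧ τ' 3 = x ∧
      τ' 9 ≤ σ.deg x ∧
      t + 1600 * bet k * σ.ops ≤ 1600 * bet k * σ'.ops + 600 * τ' 9)
    (fun _ τ' => σ.deg x - τ' 9) ?_ ?_
  · refine ⟨G, L, Ext.refl _, ?_, by simpa using hx, by simp, by omega⟩
    intro a b hab
    rcases hP a b hab with h1 | h1 | h1 | rfl | rfl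
    · exact Or.inl h1
    · exact Or.inr (Or.inl h1)
    · exact Or.inr (Or.inr (Or.inl h1))
    · obtain ⟨i, hi, hb⟩ := hab
      exact Or.inr (Or.inr (Or.inr (Or.inl ⟨rfl, i, by simp, hi, hb⟩)))
    · obtain ⟨i, hi, hb⟩ := G.adjs _ _ hab
      exact Or.inr (Or.inr (Or.inr (Or.inr ⟨rfl, i, by simp, hi, hb⟩)))
  rintro σ' τ' t ⟨G', L', E, P, h3, h9, ht⟩ c2 hc2
  have hdeg' : σ'.deg x = σ.deg x := by rw [E.deg]
  have hev := eval_lt_eq_zero F (eval_tmp (w := w) (n := n) (k := k) (σ := σ') (i := 9)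
    (by decide) rfl) (eval_deg F (eval_tmp (τ := τ') (i := 3) (by decide) h3) (le_cap_of_lt F hxn))
  rw [hdeg'] at hev
  refine ⟨fun h0 => ?_, fun h0 => ?_⟩
  · rw [hev] at h0
    refine h _ _ _ G' L' ?_ E ?_
    · intro a b hab
      rcases P a b hab with h1 | h1 | h1 | ⟨_, i, h1, h2, _⟩ | ⟨_, i, h1, h2, _⟩
      · exact Or.inl h1
      · exact Or.inr (Or.inl h1)
      · exact Or.inr (Or.inr (Or.inl h1))
      · omega
      · omega
    · omega
  · rw [Ne, hev] at h0
    have hA : Adj σ' x (σ.adj x (τ' 9)) := ⟨τ' 9, by omega, by rw [E.adj]⟩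
    refine Rn.seq (Rn.assign (x := σ.adj x (τ' 9)) (by decide) ?_ fun c3 hc3 => ?_)
    · rw [eval_adj F (eval_tmp (by decide) h3) (eval_tmp (by decide) rfl) hxn (by omega), E.adj]
    refine Rn.seq (Rn.sat F G' L' (u := x) (v := σ.adj x (τ' 9)) (by simpa using h3)
      (by simp) hA ?_)
    intro σ2 τ2 t2 G2 L2 E2 D2 hd2 hτ2 ht2
    have h9' : τ2 9 = τ' 9 := by rw [hτ2 9 (by omega)]; simp
    refine Rn.assign (x := τ' 9 + 1) (by decide)
      (eval_add_one (eval_tmp (by decide) h9') (by omega)) fun c4 hc4 => ?_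
    have h9'' : Function.update τ2 9 (τ' 9 + 1) 9 = τ' 9 + 1 := Function.update_self ..
    simp only [h9'']
    refine ⟨⟨G2, L2, E.trans E2, P.sat E2 D2 hd2 ?_, ?_, by omega, by omega⟩, by omega⟩
    · rintro a b (⟨rfl, i, h1, h2, h4⟩ | ⟨rfl, i, h1, h2, h4⟩)
      · rcases Nat.lt_or_ge (τ' 9) i with h5 | h5
        · exact Or.inl (Or.inl ⟨rfl, i, h5, h2, h4⟩)
        · have : i = τ' 9 := by omega
          subst this
          exact Or.inr (Or.inl ⟨rfl, h4.symm⟩)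
      · rcases Nat.lt_or_ge (τ' 9) i with h5 | h5
        · exact Or.inl (Or.inr ⟨rfl, i, h5, h2, h4⟩)
        · have : i = τ' 9 := by omega
          subst this
          exact Or.inr (Or.inr ⟨h4.symm, rfl⟩)
    · rw [Function.update_of_ne (by decide), hτ2 3 (by omega)]; simpa using h3

theorem OnStk.pop (h : OnStk σ y) {σ' : St} (hsp : σ'.sp = σ.sp - 1) (hstk : σ'.stk = σ.stk) :
    OnStk σ' y ∨ y = σ.stk (σ.sp - 1) := by
  obtain ⟨i, hi, rfl⟩ := h
  rcases Nat.lt_or_ge i (σ.sp - 1) with h1 | h1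
  · exact Or.inl ⟨i, by omega, by rw [hstk]⟩
  · exact Or.inr (by congr 1; omega)

theorem Good.pop (G : Good n k κ σ) (c : ℕ → ℕ) (hc : ∑ u ∈ range n, c u + (σ.sp - 1) ≤ σ.ops)
    (hT : ∀ u, c u ≤ thr k) : Good n k κ { σ with sp := σ.sp - 1, cnt := c } :=
  ⟨G.dz, G.sym, G.sub, G.adjs, G.adjn, G.bip, G.degb, G.pot, hc, hT, G.lgs, G.dvs, G.logn, G.logd,
    fun i hi => G.stkn i (hi.trans_le (Nat.sub_le _ _))⟩

/-- The specification of `scanP`. A vertex that has been scanned too often becomes dead, which keeps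
its edges within the exceptions of `Pend`. -/
theorem Rn.scan (F : Fits w n k) (G : Good n k κ σ) (L : Lim (bet k) σ)
    (hP : Pend k (fun _ _ => False) σ) (hsp : 0 < σ.sp)
    (h : ∀ σ' τ' t, Good n k κ σ' → Lim (bet k) σ' → Pend k (fun _ _ => False) σ' → Keep σ σ' →
      σ.ops ≤ σ'.ops → σ'.sp + σ.ops + 1 ≤ σ'.ops + σ.sp →
      t + 1600 * bet k * σ.ops + 600 * scans n σ
        ≤ 1600 * bet k * σ'.ops + 600 * scans n σ' + 800 → Q σ' τ' t) :
    Rn w n k scanP σ τ Q := by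
  have B := F.bounds
  have hops := G.ops_le (L.mono (Nat.le_succ _))
  have hcnt := G.cnts
  have hxn := G.stkn (σ.sp - 1) (by omega)
  set x := σ.stk (σ.sp - 1) with hx
  have hcx : σ.cnt x ≤ ∑ u ∈ range n, σ.cnt u :=
    Finset.single_le_sum (f := σ.cnt) (fun _ _ => Nat.zero_le _) (Finset.mem_range.2 hxn)
  refine Rn.seq (Rn.assign_sp (x := σ.sp - 1) (eval_sub_one rfl (by omega)) fun c1 hc1 => ?_)
  refine Rn.seq (Rn.assign (x := x) (by decide) (eval_stk F (i := σ.sp - 1) rfl (by omega))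
    fun c2 hc2 => ?_)
  have hev := fun σ' => eval_lt_eq_zero F (eval_cnt (w := w) (σ := σ') F
    (eval_tmp (τ := Function.update τ 3 x) (i := 3) (x := x) (by decide) (by simp))
    (le_cap_of_lt F hxn)) (e' := .reg 36) (y := thr k) rfl
  refine Rn.ite (fun h0 c3 hc3 => ?_) (fun h0 c3 hc3 => ?_)
  · rw [Ne, hev] at h0
    simp only at h0
    have hcT : σ.cnt x + 1 ≤ thr k := by omega
    refine Rn.seq (Rn.store_cnt (i := x) (x := σ.cnt x + 1) F (eval_tmp (by decide) (by simp))
      (le_cap_of_lt F hxn) (eval_add_one (eval_cnt F (eval_tmp (by decide) (by simp))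
        (le_cap_of_lt F hxn)) (by omega)) fun c4 hc4 => ?_)
    have hs1 := sum_update hxn (fun _ c => c) σ.cnt (σ.cnt x + 1)
    have hs2 := sum_update hxn (fun v c => c * σ.deg v) σ.cnt (σ.cnt x + 1)
    have G1 := G.pop (Function.update σ.cnt x (σ.cnt x + 1)) (by omega) (fun u => by
      rw [Function.update_apply]; split_ifs
      · exact hcT
      · exact G.cntT u)
    refine Rn.scanLoop (x := x) F G1 L ?_ (by simp) hxn ?_
    · intro a b hab
      have hf : ∀ y, Flag k σ y → Flag k
          { σ with sp := σ.sp - 1, cnt := Function.update σ.cnt x (σ.cnt x + 1) } y ∨ y = x := by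
        rintro y (h1 | h1)
        · rcases h1.pop (σ' :=
            { σ with sp := σ.sp - 1, cnt := Function.update σ.cnt x (σ.cnt x + 1) }) rfl rfl
            with h2 | h2
          · exact Or.inl (Or.inl h2)
          · exact Or.inr h2
        · by_cases hy : y = x
          · exact Or.inr hy
          · exact Or.inl (Or.inr (by simpa [hy] using h1))
      rcases hP a b hab with h1 | h1 | h1 | h1
      · exact Or.inl h1
      · rcases hf _ h1 with h2 | h2
        · exact Or.inr (Or.inl h2)
        · exact Or.inr (Or.inr (Or.inr (Or.inl h2)))
      · rcases hf _ h1 with h2 | h2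
        · exact Or.inr (Or.inr (Or.inl h2))
        · exact Or.inr (Or.inr (Or.inr (Or.inr h2)))
      · exact h1.elim
    · intro σ' τ' t G' L' P' E ht
      have h1 := E.spo
      have h2 := E.sp
      simp only at h1 h2 ht
      refine h _ _ _ G' L' P' ⟨E.mt, E.deg, E.adj, E.col, E.ms, E.pr, E.lg, E.log⟩
        (by omega) (by omega) ?_
      have h3 : scans n σ' = scans n σ + σ.deg x := by
        simp only [scans, E.cnt, E.deg]
        rw [Nat.add_mul] at hs2
        omega
      omega
  · rw [hev] at h0
    simp only at h0
    refine Rn.skip ?_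
    refine h { σ with sp := σ.sp - 1 } _ _ (G.pop σ.cnt (by omega) G.cntT) L ?_
      ⟨rfl, rfl, rfl, rfl, rfl, rfl, le_rfl, fun _ _ => rfl⟩ le_rfl (by simp only; omega) ?_
    · have hf : ∀ y, Flag k σ y → Flag k { σ with sp := σ.sp - 1 } y := by
        rintro y (h1 | h1)
        · rcases h1.pop (σ' := { σ with sp := σ.sp - 1 }) rfl rfl with h2 | h2
          · exact Or.inl h2
          · exact Or.inr (by rw [h2]; exact h0)
        · exact Or.inr h1
      intro a b hab
      rcases hP a b hab with h1 | h1 | h1 | h1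
      · exact Or.inl h1
      · exact Or.inr (Or.inl (hf _ h1))
      · exact Or.inr (Or.inr (Or.inl (hf _ h1)))
      · exact h1.elim
    · have : scans n { σ with sp := σ.sp - 1 } = scans n σ := rfl
      simp only [this]; omega

/-- The specification of `cascadeP`. It terminates since every vertex pushed on the stack comes from
a change of the sparsifier, of which there are boundedly many. -/
theorem Rn.cascade (F : Fits w n k) (G : Good n k κ σ) (L : Lim (bet k) σ)
    (hP : Pend k (fun _ _ => False) σ)
    (h : ∀ σ' τ' t, Good n k κ σ' → Lim (bet k) σ' → Pend k (fun _ _ => False) σ' → Keep σ σ' →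
      σ'.sp = 0 →
      t + 1700 * bet k * σ.ops + 600 * scans n σ
        ≤ 1700 * bet k * σ'.ops + 600 * scans n σ' + 900 * σ.sp + 100 → Q σ' τ' t) :
    Rn w n k cascadeP σ τ Q := by
  have B := F.bounds
  have hk : 64 ≤ k * k := Nat.mul_le_mul F.eight F.eight
  refine Rn.loop (fun σ' τ' t => Good n k κ σ' ∧ Lim (bet k) σ' ∧ Pend k (fun _ _ => False) σ' ∧
      Keep σ σ' ∧ t + 1700 * bet k * σ.ops + 600 * scans n σ + 900 * σ'.sp
        ≤ 1700 * bet k * σ'.ops + 600 * scans n σ' + 900 * σ.sp)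
    (fun σ' _ => 2 * (bet k * (bet k * n) - σ'.ops) + σ'.sp) ?_ ?_
  · exact ⟨G, L, hP, ⟨rfl, rfl, rfl, rfl, rfl, rfl, le_rfl, fun _ _ => rfl⟩, by omega⟩
  rintro σ' τ' t ⟨G', L', P', K, ht⟩ c hc
  have hev := eval_lt_eq_zero F (s := enc n k σ' τ') (e := .const 0) (e' := .reg 38)
    (eval_const_lt F (by decide)) (y := σ'.sp) rfl
  refine ⟨fun h0 => ?_, fun h0 => ?_⟩
  · rw [hev] at h0
    exact h _ _ _ G' L' P' K (by omega) (by omega)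
  · rw [Ne, hev] at h0
    refine Rn.scan F G' L' P' (by omega) ?_
    intro σ2 τ2 t2 G2 L2 P2 K2 ho hs ht2
    have hb := G2.ops_le (L2.mono (Nat.le_succ _))
    refine ⟨⟨G2, L2, P2, K.trans K2, ?_⟩, by omega⟩
    obtain ⟨δ, hδ⟩ := Nat.exists_eq_add_of_le ho
    rw [hδ] at ht2 hs ⊢
    have h1 : 900 * δ ≤ 100 * bet k * δ := Nat.mul_le_mul_right _ (by omega)
    simp only [Nat.mul_add] at ht2 ⊢
    have e1 : 1700 * bet k * δ = 1600 * bet k * δ + 100 * bet k * δ := by ring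
    omega

end

/-! ### Clearing the old matching and two-colouring the sparsifier -/

/-- Clear the matching, the colours and the prices. -/
def resetP : Prog :=
  .assign 9 (.const 0) ;;
  .loop (ltE (.reg 9) (.reg 37))
    (.assign 3 (.load (addr 4 (.reg 9))) ;;
      .store (.reg 3) (.const 0) ;;
      .store (addr 5 (.reg 3)) (.const 0) ;;
      .store (addr 6 (.reg 3)) (.const 0) ;;
      .assign 9 (.reg 9 + .const 1))

/-- Give the neighbours of the vertex in register `3` the other colour, and put those which had no
colour on the stack. -/
def spreadP : Prog :=
  .assign 4 (.const 0) ;;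
  .loop (ltE (.reg 4) (degE 3))
    (.assign 5 (.load (addr 7 (idx (.reg 3) (.reg 4)))) ;;
      .ite (ltE (.load (addr 5 (.reg 5))) (.const 1))
        (.store (addr 5 (.reg 5)) (.const 3 - .load (addr 5 (.reg 3))) ;;
          .store (addr 3 (.reg 38)) (.reg 5) ;;
          .assign 38 (.reg 38 + .const 1))
        .skip ;;
      .assign 4 (.reg 4 + .const 1))

/-- Colour the component of the vertex in register `3` by depth-first search. -/
def searchP : Prog :=
  .store (addr 5 (.reg 3)) (.const 1) ;;
  .store (addr 3 (.const 0)) (.reg 3) ;;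
  .assign 38 (.const 1) ;;
  .loop (ltE (.const 0) (.reg 38))
    (.assign 38 (.reg 38 - .const 1) ;;
      .assign 3 (.load (addr 3 (.reg 38))) ;;
      spreadP)

/-- Colour all vertices of positive degree in the sparsifier with `1` and `2`. -/
def colourP : Prog :=
  .assign 9 (.const 0) ;;
  .loop (ltE (.reg 9) (.reg 37))
    (.assign 3 (.load (addr 4 (.reg 9))) ;;
      .ite (ltE (.load (addr 5 (.reg 3))) (ltE (.const 0) (degE 3))) searchP .skip ;;
      .assign 9 (.reg 9 + .const 1))

/-- Vertices outside the log carry no data. -/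
def Clean (σ : St) : Prop :=
  ∀ v, (σ.mt v ≠ 0 ∨ σ.col v ≠ 0 ∨ σ.pr v ≠ 0) → ∃ i < σ.lg, σ.log i = v

/-- The data `σ` with other colours and another stack. -/
def recol (σ : St) (c s : ℕ → ℕ) (m : ℕ) : St := { σ with col := c, stk := s, sp := m }

/-- The vertex `x` and its neighbours in the sparsifier have different colours. -/
def Closed (σ : St) (c : ℕ → ℕ) (x : ℕ) : Prop := ∀ y ∈ row σ x, c y ≠ 0 ∧ c y ≠ c x

/-- The number of coloured vertices, weighted by the time their treatment takes. -/
def colCost (n : ℕ) (σ : St) (c : ℕ → ℕ) : ℕ :=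
  ∑ v ∈ range n, if c v = 0 then 0 else 1 + σ.d v

/-- The time needed to treat the first `m` entries of the stack `s`. -/
def stkCost (σ : St) (s : ℕ → ℕ) (m : ℕ) : ℕ := ∑ i ∈ range m, (1 + σ.d (s i))

/-- The invariant of the search: the colours on the stack agree with the bipartition `κ` up to
exchanging the classes, and all coloured vertices are closed except those on the stack and those
in `X`. -/
structure Search (n : ℕ) (κ : ℕ → Prop) (σ : St) (B : Prop) (X : ℕ → Prop) (c s : ℕ → ℕ) (m : ℕ) :
    Prop where
  le : ∀ v, c v ≤ 2
  pos : ∀ v, c v ≠ 0 → 0 < σ.d v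
  stkn : ∀ i < m, c (s i) ≠ 0 ∧ ((c (s i) = 1 ↔ κ (s i)) ↔ B)
  closed : ∀ x, c x ≠ 0 → X x ∨ (∃ i < m, s i = x) ∨ Closed σ c x
  cost : stkCost σ s m ≤ colCost n σ c

section
variable {w n k : ℕ} {κ : ℕ → Prop} {σ : St} {τ : ℕ → ℕ} {Q : St → (ℕ → ℕ) → ℕ → Prop}
  {e e' : Expr} {a b u v i x y z : ℕ}

/-- Clearing the vertices in the log suffices, and takes time independent of `n`. -/
theorem Rn.reset (F : Fits w n k) (G : Good n k κ σ) (L : Lim (bet k) σ) (C : Clean σ)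
    (h : ∀ τ' t, t ≤ 700 * σ.lg + 200 →
      Q { σ with mt := fun _ => 0, col := fun _ => 0, pr := fun _ => 0 } τ' t) :
    Rn w n k resetP σ τ Q := by
  have B := F.bounds
  have hops := G.ops_le (L.mono (Nat.le_succ _))
  have hlg := G.lgs
  refine Rn.seq (Rn.assign (by decide) (eval_const_lt F (c := 0) (by decide)) fun c1 hc1 => ?_)
  refine Rn.loop (fun σ' τ' t => τ' 9 ≤ σ.lg ∧ t ≤ 700 * τ' 9 ∧ ∃ m c p : ℕ → ℕ,
      σ' = { σ with mt := m, col := c, pr := p } ∧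
      ∀ v, (m v ≠ 0 ∨ c v ≠ 0 ∨ p v ≠ 0) → ∃ i < σ.lg, τ' 9 ≤ i ∧ σ.log i = v)
    (fun _ τ' => σ.lg - τ' 9) ?_ ?_
  · refine ⟨by simp, by omega, _, _, _, rfl, fun v hv => ?_⟩
    obtain ⟨i, hi, h⟩ := C v hv
    exact ⟨i, hi, by simp, h⟩
  rintro σ' τ' t ⟨h9, ht, m, c, p, rfl, hv⟩ c2 hc2
  have hev := eval_lt_eq_zero F (eval_tmp (w := w) (n := n) (k := k)
    (σ := { σ with mt := m, col := c, pr := p }) (i := 9) (τ := τ')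
    (by decide) rfl) (e' := .reg 37) (y := σ.lg) rfl
  refine ⟨fun h0 => ?_, fun h0 => ?_⟩
  · rw [hev] at h0
    have z : ∀ v, m v = 0 ∧ c v = 0 ∧ p v = 0 := by
      intro v
      by_contra hne
      obtain ⟨i, hi, hi', _⟩ := hv v (by tauto)
      omega
    have z1 : m = fun _ => 0 := funext fun v => (z v).1
    have z2 : c = fun _ => 0 := funext fun v => (z v).2.1
    have z3 : p = fun _ => 0 := funext fun v => (z v).2.2
    subst z1 z2 z3
    exact h _ _ (by omega)
  · rw [Ne, hev] at h0
    have hln := G.logn (τ' 9) (by omega)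
    refine Rn.seq (Rn.assign (x := σ.log (τ' 9)) (by decide)
      (eval_log F (eval_tmp (by decide) rfl) (by omega)) fun c3 hc3 => ?_)
    refine Rn.seq (Rn.store_mt (i := σ.log (τ' 9)) (eval_tmp (by decide) (by simp)) hln
      (eval_const_lt F (c := 0) (by decide)) fun c4 hc4 => ?_)
    refine Rn.seq (Rn.store_col F (i := σ.log (τ' 9)) (eval_tmp (by decide) (by simp))
      (le_cap_of_lt F hln) (eval_const_lt F (c := 0) (by decide)) fun c5 hc5 => ?_)
    refine Rn.seq (Rn.store_pr F (i := σ.log (τ' 9)) (eval_tmp (by decide) (by simp))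
      (le_cap_of_lt F hln) (eval_const_lt F (c := 0) (by decide)) fun c6 hc6 => ?_)
    refine Rn.assign (x := τ' 9 + 1) (by decide)
      (eval_add_one (eval_tmp (by decide) (by simp)) (by omega)) fun c7 hc7 => ?_
    simp only [Function.update_self]
    refine ⟨⟨by omega, by omega, _, _, _, rfl, fun v hv' => ?_⟩, by omega⟩
    by_cases hvl : v = σ.log (τ' 9)
    · simp [hvl] at hv'
    · simp only [Function.update_of_ne hvl] at hv'
      obtain ⟨i, hi, hi', hil⟩ := hv v hv'
      refine ⟨i, hi, ?_, hil⟩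
      rcases Nat.lt_or_ge (τ' 9) i with h1 | h1
      · exact h1
      · exact absurd (by rw [← hil]; congr 1; omega) hvl

theorem colCost_update {c : ℕ → ℕ} (hy : y < n) (h0 : c y = 0) (hz : z ≠ 0) :
    colCost n σ (Function.update c y z) = colCost n σ c + (1 + σ.d y) := by
  have := sum_update hy (fun v c => if c = 0 then 0 else 1 + σ.d v) c z
  simp only [h0, hz, if_true, if_false] at this
  simp only [colCost]
  omega

theorem stkCost_push {s : ℕ → ℕ} {m : ℕ} :
    stkCost σ (Function.update s m y) (m + 1) = stkCost σ s m + (1 + σ.d y) := by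
  unfold stkCost
  rw [Finset.sum_range_succ, Function.update_self]
  congr 1
  refine Finset.sum_congr rfl fun i hi => ?_
  rw [Finset.mem_range] at hi
  rw [Function.update_of_ne (by omega)]

theorem le_stkCost {s : ℕ → ℕ} {m : ℕ} : m ≤ stkCost σ s m := by
  have : ∑ i ∈ range m, 1 ≤ stkCost σ s m :=
    Finset.sum_le_sum fun i _ => Nat.le_add_right 1 _
  simpa using this

theorem colCost_le {c : ℕ → ℕ} (h : ∀ v, c v ≠ 0 → 0 < σ.d v) :
    colCost n σ c ≤ 2 * ∑ v ∈ range n, σ.d v := by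
  rw [Finset.mul_sum]
  refine Finset.sum_le_sum fun v _ => ?_
  split_ifs with h0
  · exact Nat.zero_le _
  · have := h v h0; omega

theorem Good.sum_d_le (G : Good n k κ σ) (L : Lim (bet k) σ) :
    ∑ u ∈ range n, σ.d u ≤ bet k * n := by
  refine (Finset.sum_le_card_nsmul _ _ (bet k) fun u _ =>
    G.d_le (L.mono (Nat.le_succ _)) u).trans ?_
  simp [Nat.mul_comm]

theorem Search.sp_lt {B : Prop} {X : ℕ → Prop} {c s : ℕ → ℕ} {m : ℕ} (F : Fits w n k)
    (G : Good n k κ σ) (L : Lim (bet k) σ) (S : Search n κ σ B X c s m) : m ≤ cap n k := by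
  have h1 := G.sum_d_le L
  have h2 := colCost_le (n := n) S.pos
  have h3 := S.cost
  have h4 := le_stkCost (σ := σ) (s := s) (m := m)
  have h5 := F.bounds
  have h6 : bet k * n ≤ bet k * (bet k * n) := Nat.le_mul_of_pos_left _ (by omega)
  omega

/-- Colouring an uncoloured neighbour `y` of `x` and pushing it on the stack. -/
theorem Search.push {B : Prop} {X : ℕ → Prop} {c s : ℕ → ℕ} {m : ℕ} (G : Good n k κ σ)
    (S : Search n κ σ B X c s m) (hx : c x ≠ 0) (hB : (c x = 1 ↔ κ x) ↔ B)
    (hy : y ∈ row σ x) (h0 : c y = 0) :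
    Search n κ σ B X (Function.update c y (3 - c x)) (Function.update s m y) (m + 1) := by
  have hA := G.sub _ _ hy
  have hx2 := S.le x
  have hbip := G.bip _ _ hA
  have hyn := G.adjn' hA
  have hne : ∀ v, c v ≠ 0 → v ≠ y := by rintro v hv rfl; exact hv h0
  refine ⟨fun v => ?_, fun v hv => ?_, fun i hi => ?_, fun v hv => ?_, ?_⟩
  · rw [Function.update_apply]; split_ifs
    · omega
    · exact S.le v
  · by_cases hvy : v = y
    · subst hvy; exact pos_of_mem_row (G.row_symm hy)
    · rw [Function.update_of_ne hvy] at hv; exact S.pos v hv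
  · by_cases him : i = m
    · subst him
      simp only [Function.update_self]
      refine ⟨by omega, ?_⟩
      rw [← hB]
      have : 3 - c x = 1 ↔ ¬ c x = 1 := by omega
      rw [this]
      tauto
    · obtain ⟨h1, h2⟩ := S.stkn i (by omega)
      rw [Function.update_of_ne him, Function.update_of_ne (hne _ h1)]
      exact ⟨h1, h2⟩
  · by_cases hvy : v = y
    · subst hvy; exact Or.inr (Or.inl ⟨m, by omega, Function.update_self ..⟩)
    · rw [Function.update_of_ne hvy] at hv
      rcases S.closed v hv with h1 | ⟨i, hi, rfl⟩ | h1
      · exact Or.inl h1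
      · exact Or.inr (Or.inl ⟨i, by omega, Function.update_of_ne (by omega) _ _⟩)
      · refine Or.inr (Or.inr fun z hz => ?_)
        obtain ⟨h2, h3⟩ := h1 z hz
        rw [Function.update_of_ne (hne _ h2), Function.update_of_ne hvy]
        exact ⟨h2, h3⟩
  · rw [colCost_update hyn h0 (by omega), stkCost_push]
    have := S.cost
    omega

/-- The specification of `spreadP`: afterwards `x` is closed. -/
theorem Rn.spread (F : Fits w n k) (G : Good n k κ σ) (L : Lim (bet k) σ) {B : Prop}
    {c s : ℕ → ℕ} {m : ℕ}
    (S : Search n κ σ B (fun v => v = x) c s m) (h3 : τ 3 = x) (hx : c x ≠ 0) (hxn : x < n)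
    (hB : (c x = 1 ↔ κ x) ↔ B)
    (h : ∀ c' s' m' τ' t, Search n κ σ B (fun _ => False) c' s' m' → τ' 9 = τ 9 →
      (∀ v, c v ≠ 0 → c' v = c v) →
      colCost n σ c ≤ colCost n σ c' →
      stkCost σ s' m' + colCost n σ c = stkCost σ s m + colCost n σ c' →
      t ≤ 900 * σ.d x + 200 → Q (recol σ c' s' m') τ' t) :
    Rn w n k spreadP (recol σ c s m) τ Q := by
  have Bd := F.bounds
  have hdx := G.d_le (L.mono (Nat.le_succ _)) x
  refine Rn.seq (Rn.assign (by decide) (eval_const_lt F (c := 0) (by decide)) fun c1 hc1 => ?_)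
  refine Rn.loop (fun σ' τ' t => ∃ c' s' m', σ' = recol σ c' s' m' ∧
      Search n κ σ B (fun v => v = x) c' s' m' ∧ τ' 9 = τ 9 ∧ τ' 3 = x ∧ τ' 4 ≤ σ.d x ∧
      (∀ v, c v ≠ 0 → c' v = c v) ∧
      (∀ i < τ' 4, c' (σ.slot x i) ≠ 0 ∧ c' (σ.slot x i) ≠ c x) ∧
      colCost n σ c ≤ colCost n σ c' ∧
      stkCost σ s' m' + colCost n σ c = stkCost σ s m + colCost n σ c' ∧ t ≤ 900 * τ' 4)
    (fun _ τ' => σ.d x - τ' 4) ?_ ?_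
  · exact ⟨c, s, m, rfl, S, by simp, by simpa using h3, by simp, fun _ _ => rfl, by simp, le_rfl,
      rfl, by omega⟩
  rintro σ' τ' t ⟨c', s', m', rfl, S', h9', h3', h4', hcc, hcl, hc0, hc1', ht⟩ c2 hc2
  have hcx := hcc x hx
  have hev := eval_lt_eq_zero F (eval_tmp (w := w) (n := n) (k := k)
    (σ := recol σ c' s' m') (i := 4) (τ := τ')
    (by decide) rfl) (eval_degE F (a := 3) (by decide) h3' hxn)
  refine ⟨fun h0 => ?_, fun h0 => ?_⟩
  · rw [hev] at h0
    have h0' : σ.d x ≤ τ' 4 := h0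
    refine h c' s' m' _ _ ⟨S'.le, S'.pos, S'.stkn, fun v hv => ?_, S'.cost⟩ h9' hcc hc0 hc1'
      (by omega)
    rcases S'.closed v hv with rfl | h1 | h1
    · refine Or.inr (Or.inr fun y hy => ?_)
      obtain ⟨i, hi, rfl⟩ := mem_row.1 hy
      rw [hcx]
      exact hcl i (by omega)
    · exact Or.inr (Or.inl h1)
    · exact Or.inr (Or.inr h1)
  · rw [Ne, hev] at h0
    have h0' : τ' 4 < σ.d x := not_le.1 h0
    have hy : σ.slot x (τ' 4) ∈ row σ x := mem_row.2 ⟨_, h0', rfl⟩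
    set y := σ.slot x (τ' 4) with hydef
    have hyn := G.adjn' (G.sub _ _ hy)
    refine Rn.seq (Rn.assign (x := y) (by decide)
      (eval_slot F (eval_tmp (by decide) h3') (eval_tmp (by decide) rfl) hxn (by omega))
      fun c3 hc3 => ?_)
    have hev2 := eval_lt_eq_zero F (eval_col (w := w) (σ := recol σ c' s' m') F
      (eval_tmp (τ := Function.update τ' 5 y) (i := 5) (x := y) (by decide) (by simp))
      (le_cap_of_lt F hyn)) (eval_const_lt F (c := 1) (by decide))
    refine Rn.seq (Rn.ite (fun h1 c4 hc4 => ?_) (fun h1 c4 hc4 => ?_))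
    · rw [Ne, hev2] at h1
      have hy0 : c' y = 0 := by have h1' : ¬ 1 ≤ c' y := h1; omega
      have hm := S'.sp_lt F G L
      refine Rn.seq (Rn.store_col (i := y) (x := 3 - c' x) F (eval_tmp (by decide) (by simp))
        (le_cap_of_lt F hyn) ?_ fun c5 hc5 => ?_)
      · rw [eval_sub, eval_const_lt F (by decide), eval_col (i := x) F
          (eval_tmp (by decide) (by simpa using h3')) (le_cap_of_lt F hxn)]
        rfl
      refine Rn.seq (Rn.store_stk (i := m') (x := y) F rfl hm (eval_tmp (by decide) (by simp))
        fun c6 hc6 => ?_)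
      refine Rn.assign_sp (x := m' + 1) (eval_add_one rfl (by omega)) fun c7 hc7 => ?_
      refine Rn.assign (x := τ' 4 + 1) (by decide) (eval_add_one (eval_tmp (by decide) (by simp))
        (by omega)) fun c8 hc8 => ?_
      have S2 := S'.push G (x := x) (y := y) (by omega) (by rw [hcx]; exact hB) hy hy0
      have hu : ∀ v, c' v ≠ 0 → Function.update c' y (3 - c' x) v = c' v := fun v hv =>
        Function.update_of_ne (by rintro rfl; exact hv hy0) _ _
      have hcx2 := S'.le x
      have hq1 := colCost_update (σ := σ) (z := 3 - c' x) hyn hy0 (by omega)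
      have hq2 := stkCost_push (σ := σ) (s := s') (m := m') (y := y)
      simp only [Function.update_self]
      refine ⟨⟨Function.update c' y (3 - c' x), Function.update s' m' y, m' + 1, rfl, S2,
        by simpa using h9', by simpa using h3', by omega, fun v hv => ?_, fun i hi => ?_,
        by omega, by omega, by omega⟩, by omega⟩
      · rw [hu v (by rw [hcc v hv]; exact hv), hcc v hv]
      · rcases Nat.lt_succ_iff_lt_or_eq.1 hi with h2 | rfl
        · rw [hu _ (hcl i h2).1]; exact hcl i h2
        · rw [← hydef, Function.update_self]; omega
    · rw [hev2] at h1
      have hy0 : 1 ≤ c' y := h1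
      refine Rn.skip ?_
      refine Rn.assign (x := τ' 4 + 1) (by decide) (eval_add_one (eval_tmp (by decide) (by simp))
        (by omega)) fun c8 hc8 => ?_
      simp only [Function.update_self]
      refine ⟨⟨c', s', m', rfl, S', by simpa using h9', by simpa using h3', by omega, hcc,
        fun i hi => ?_, hc0, hc1', by omega⟩, by omega⟩
      rcases Nat.lt_succ_iff_lt_or_eq.1 hi with h2 | rfl
      · exact hcl i h2
      · rw [← hydef, ← hcx]
        refine ⟨by omega, ?_⟩
        have hyx : x ≠ y := G.ne (G.sub _ _ hy)
        rcases S'.closed y (by omega) with h2 | ⟨i, hi, hiy⟩ | h2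
        · exact absurd h2.symm hyx
        · obtain ⟨h3, h4⟩ := S'.stkn i hi
          rw [hiy] at h3 h4
          have h5 := G.bip _ _ (G.sub _ _ hy)
          rw [← hcx] at hB
          intro h6
          rw [h6] at h4
          tauto
        · exact (h2 x (G.row_symm hy)).2.symm

/-- The specification of `searchP`. The amortized cost of colouring a vertex is its degree, up to a
constant. -/
theorem Rn.search (F : Fits w n k) (G : Good n k κ σ) (L : Lim (bet k) σ)
    {c s : ℕ → ℕ} (S : Search n κ σ True (fun _ => False) c s 0)
    (h3 : τ 3 = x) (hxn : x < n) (hx0 : c x = 0) (hdx : 0 < σ.d x)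
    (h : ∀ c' s' τ' t, Search n κ σ True (fun _ => False) c' s' 0 → τ' 9 = τ 9 →
      (∀ v, c v ≠ 0 → c' v ≠ 0) → c' x ≠ 0 →
      t + 1000 * colCost n σ c ≤ 1000 * colCost n σ c' + 400 → Q (recol σ c' s' 0) τ' t) :
    Rn w n k searchP (recol σ c s 0) τ Q := by
  have B := F.bounds
  refine Rn.seq (Rn.store_col (i := x) F (eval_tmp (by decide) h3) (le_cap_of_lt F hxn)
    (eval_const_lt F (c := 1) (by decide)) fun c1 hc1 => ?_)
  refine Rn.seq (Rn.store_stk (i := 0) F (eval_const_lt F (by decide)) (by omega)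
    (eval_tmp (by decide) h3) fun c2 hc2 => ?_)
  refine Rn.seq (Rn.assign_sp (eval_const_lt F (c := 1) (by decide)) fun c3 hc3 => ?_)
  have hq := colCost_update (σ := σ) (z := 1) hxn hx0 one_ne_zero
  have hne : ∀ v, c v ≠ 0 → v ≠ x := by rintro v hv rfl; exact hv hx0
  have S1 : Search n κ σ (1 = 1 ↔ κ x) (fun _ => False) (Function.update c x 1)
      (Function.update s 0 x) 1 := by
    refine ⟨fun v => ?_, fun v hv => ?_, fun i hi => ?_, fun v hv => ?_, ?_⟩
    · rw [Function.update_apply]; split_ifs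
      · omega
      · exact S.le v
    · by_cases hvx : v = x
      · subst hvx; exact hdx
      · rw [Function.update_of_ne hvx] at hv; exact S.pos v hv
    · have : i = 0 := by omega
      subst this
      simp only [Function.update_self]
      simp
    · by_cases hvx : v = x
      · subst hvx; exact Or.inr (Or.inl ⟨0, by omega, Function.update_self ..⟩)
      · rw [Function.update_of_ne hvx] at hv
        rcases S.closed v hv with h1 | ⟨i, hi, _⟩ | h1
        · exact h1.elim
        · omega
        · refine Or.inr (Or.inr fun z hz => ?_)
          obtain ⟨h2, h4⟩ := h1 z hz
          rw [Function.update_of_ne (hne _ h2), Function.update_of_ne hvx]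
          exact ⟨h2, h4⟩
    · have := S.cost
      have := stkCost_push (σ := σ) (s := s) (m := 0) (y := x)
      simp only [Nat.zero_add] at this
      omega
  refine Rn.loop (fun σ' τ' t => ∃ c' s' m', σ' = recol σ c' s' m' ∧
      Search n κ σ (1 = 1 ↔ κ x) (fun _ => False) c' s' m' ∧ τ' 9 = τ 9 ∧
      (∀ v, c v ≠ 0 → c' v ≠ 0) ∧ c' x ≠ 0 ∧
      t + 1000 * stkCost σ s' m' + 1000 * colCost n σ c ≤ 1000 * colCost n σ c')
    (fun σ' _ => 2 * (2 * ∑ v ∈ range n, σ.d v - colCost n σ σ'.col) + stkCost σ σ'.stk σ'.sp)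
    ?_ ?_
  · refine ⟨Function.update c x 1, Function.update s 0 x, 1, rfl, S1, rfl, fun v hv => ?_,
      by simp, ?_⟩
    · rw [Function.update_of_ne (hne v hv)]; exact hv
    · have e1 := stkCost_push (σ := σ) (s := s) (m := 0) (y := x)
      have e2 : stkCost σ s 0 = 0 := rfl
      simp only [Nat.zero_add] at e1
      omega
  rintro σ' τ' t ⟨c', s', m', rfl, S', h9', hcc, hcx, ht⟩ c4 hc4
  have hev := eval_lt_eq_zero F (s := enc n k (recol σ c' s' m') τ') (e := .const 0)
    (e' := .reg 38) (eval_const_lt F (by decide)) (y := m') rfl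
  refine ⟨fun h0 => ?_, fun h0 => ?_⟩
  · rw [hev] at h0
    have : m' = 0 := by omega
    subst this
    refine h c' s' _ _ ⟨S'.le, S'.pos, fun i hi => by omega, S'.closed, S'.cost⟩ h9' hcc hcx
      (by omega)
  · rw [Ne, hev] at h0
    obtain ⟨p, rfl⟩ : ∃ p, m' = p + 1 := ⟨m' - 1, by omega⟩
    obtain ⟨hz1, hz2⟩ := S'.stkn p (by omega)
    set z := s' p with hz
    have hzn : z < n := by
      by_contra hzn
      have := G.dz z (by omega)
      have := S'.pos z hz1
      omega
    have hcap := S'.sp_lt F G L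
    have hsc : stkCost σ s' (p + 1) = stkCost σ s' p + (1 + σ.d z) := Finset.sum_range_succ ..
    refine Rn.seq (Rn.assign_sp (x := p) (eval_sub_one (x := p + 1) rfl (by omega))
      fun c5 hc5 => ?_)
    refine Rn.seq (Rn.assign (x := z) (by decide) (eval_stk F (i := p) rfl (by omega))
      fun c6 hc6 => ?_)
    have S2 : Search n κ σ (1 = 1 ↔ κ x) (fun v => v = z) c' s' p := by
      refine ⟨S'.le, S'.pos, fun i hi => S'.stkn i (by omega), fun v hv => ?_, ?_⟩
      · rcases S'.closed v hv with h1 | ⟨i, hi, h1⟩ | h1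
        · exact h1.elim
        · by_cases hip : i = p
          · subst hip; exact Or.inl h1.symm
          · exact Or.inr (Or.inl ⟨i, by omega, h1⟩)
        · exact Or.inr (Or.inr h1)
      · have := S'.cost; omega
    refine Rn.spread F G L S2 (by simp) hz1 hzn hz2 ?_
    intro c2' s2 m2 τ2 t2 S3 h92 hcc2 hcost1 hcost2 ht2
    have hb := colCost_le (n := n) S3.pos
    change colCost n σ c' ≤ _ at hcost1
    change _ + colCost n σ c' = stkCost σ s' p + _ at hcost2
    refine ⟨⟨c2', s2, m2, rfl, S3, by rw [h92]; simpa using h9', fun v hv => ?_, ?_, ?_⟩, ?_⟩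
    · rw [hcc2 v (hcc v hv)]; exact hcc v hv
    · rw [hcc2 x hcx]; exact hcx
    · omega
    · simp only [recol]; omega

/-- The vertices of positive degree are properly coloured with `1` and `2`. -/
structure Proper (σ : St) (c : ℕ → ℕ) : Prop where
  le : ∀ v, c v ≤ 2
  pos : ∀ v, c v ≠ 0 ↔ 0 < σ.d v
  ne : ∀ u v, v ∈ row σ u → c v ≠ c u

/-- The specification of `colourP`: the log contains all vertices of positive degree. -/
theorem Rn.colour (F : Fits w n k) (G : Good n k κ σ) (L : Lim (bet k) σ) (hsp : σ.sp = 0)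
    (hcol : σ.col = fun _ => 0)
    (h : ∀ c s τ' t, Proper σ c →
      t ≤ 2000 * ∑ v ∈ range n, σ.d v + 900 * σ.lg + 200 → Q (recol σ c s 0) τ' t) :
    Rn w n k colourP σ τ Q := by
  have B := F.bounds
  have hops := G.ops_le (L.mono (Nat.le_succ _))
  have hlg := G.lgs
  refine Rn.seq (Rn.assign (by decide) (eval_const_lt F (c := 0) (by decide)) fun c1 hc1 => ?_)
  refine Rn.loop (fun σ' τ' t => ∃ c s, σ' = recol σ c s 0 ∧
      Search n κ σ True (fun _ => False) c s 0 ∧ τ' 9 ≤ σ.lg ∧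
      (∀ i < τ' 9, 0 < σ.d (σ.log i) → c (σ.log i) ≠ 0) ∧
      t ≤ 1000 * colCost n σ c + 900 * τ' 9)
    (fun _ τ' => σ.lg - τ' 9) ?_ ?_
  · refine ⟨fun _ => 0, σ.stk, ?_, ?_, by simp, by simp, by omega⟩
    · rw [← hcol, ← hsp]; rfl
    · exact ⟨by simp, by simp, by simp, by simp, by simp [stkCost]⟩
  rintro σ' τ' t ⟨c, s, rfl, S, h9, hl, ht⟩ c2 hc2
  have hev := eval_lt_eq_zero F (eval_tmp (w := w) (n := n) (k := k)
    (σ := recol σ c s 0) (i := 9) (τ := τ')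
    (by decide) rfl) (e' := .reg 37) (y := σ.lg) rfl
  refine ⟨fun h0 => ?_, fun h0 => ?_⟩
  · rw [hev] at h0
    have hb := colCost_le (n := n) S.pos
    have hpos : ∀ v, 0 < σ.d v → c v ≠ 0 := by
      intro v hv
      obtain ⟨i, hi, rfl⟩ := G.logd v hv
      exact hl i (by omega) hv
    refine h c s _ _ ⟨S.le, fun v => ⟨S.pos v, hpos v⟩, fun u v hv => ?_⟩ (by omega)
    rcases S.closed u (hpos u (pos_of_mem_row hv)) with h1 | ⟨i, hi, _⟩ | h1
    · exact h1.elim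
    · omega
    · exact (h1 v hv).2
  · rw [Ne, hev] at h0
    have hln := G.logn (τ' 9) (by omega)
    set x := σ.log (τ' 9) with hx
    refine Rn.seq (Rn.assign (x := x) (by decide)
      (eval_log F (eval_tmp (by decide) rfl) (by omega)) fun c3 hc3 => ?_)
    have hlt : (ltE (.const 0) (degE 3)).eval w (enc n k (recol σ c s 0) (Function.update τ' 3 x))
        = if 0 < σ.d x then 1 else 0 := by
      rw [eval_ltE, eval_const_lt F (by decide), eval_degE F (u := x) (by decide) (by simp) hln]
      change (if 0 < σ.d x then 1 else 0) % 2 ^ w = _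
      refine Nat.mod_eq_of_lt ?_
      split_ifs <;> omega
    have hev2 := eval_lt_eq_zero F (eval_col (w := w) (σ := recol σ c s 0) F
      (eval_tmp (τ := Function.update τ' 3 x) (i := 3) (x := x) (by decide) (by simp))
      (le_cap_of_lt F hln)) hlt
    refine Rn.seq (Rn.ite (fun h1 c4 hc4 => ?_) (fun h1 c4 hc4 => ?_))
    · rw [Ne, hev2] at h1
      have h1' : ¬ (if 0 < σ.d x then 1 else 0) ≤ c x := h1
      have hdx : 0 < σ.d x := by by_contra hne; simp [hne] at h1'
      have hcx : c x = 0 := by rw [if_pos hdx] at h1'; omega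
      refine Rn.search F G L S (x := x) (by simp) hln hcx hdx ?_
      intro c' s' τ2 t2 S2 h92 hcc hcx' ht2
      have h92' : τ2 9 = τ' 9 := by rw [h92]; simp
      refine Rn.assign (x := τ' 9 + 1) (by decide) (eval_add_one (eval_tmp (by decide) h92')
        (by omega)) fun c5 hc5 => ?_
      simp only [Function.update_self]
      refine ⟨⟨c', s', rfl, S2, by omega, fun i hi hd => ?_, by omega⟩, by omega⟩
      rcases Nat.lt_succ_iff_lt_or_eq.1 hi with h2 | rfl
      · exact hcc _ (hl i h2 hd)
      · exact hcx'
    · rw [hev2] at h1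
      have h1' : (if 0 < σ.d x then 1 else 0) ≤ c x := h1
      refine Rn.skip ?_
      refine Rn.assign (x := τ' 9 + 1) (by decide) (eval_add_one (eval_tmp (by decide) (by simp))
        (by omega)) fun c5 hc5 => ?_
      simp only [Function.update_self]
      refine ⟨⟨c, s, rfl, S, by omega, fun i hi hd => ?_, by omega⟩, by omega⟩
      rcases Nat.lt_succ_iff_lt_or_eq.1 hi with h2 | rfl
      · exact hl i h2 hd
      · rw [← hx] at hd ⊢
        rw [if_pos hd] at h1'; omega

end

/-! ### The auction -/

/-- Find the cheapest neighbour in the sparsifier of the vertex in register `3`: if its price is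
below `k`, it is put into register `7`, increased by one, and the price into register `6`. -/
def chooseP : Prog :=
  .assign 4 (.const 0) ;; .assign 6 (.reg 33) ;; .assign 7 (.const 0) ;;
  .loop (ltE (.reg 4) (degE 3))
    (.assign 5 (.load (addr 7 (idx (.reg 3) (.reg 4)))) ;;
      .ite (ltE (.load (addr 6 (.reg 5))) (.reg 6))
        (.assign 6 (.load (addr 6 (.reg 5))) ;; .assign 7 (.reg 5 + .const 1))
        .skip ;;
      .assign 4 (.reg 4 + .const 1))

/-- The bidder in register `10`, increased by one, takes its cheapest neighbour and raises the
price; the former partner of this neighbour becomes the next bidder. -/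
def bidP : Prog :=
  .assign 3 (.reg 10 - .const 1) ;; chooseP ;;
  .ite (ltE (.const 0) (.reg 7))
    (.assign 7 (.reg 7 - .const 1) ;;
      .store (addr 6 (.reg 7)) (.reg 6 + .const 1) ;;
      .assign 10 (.load (.reg 7)) ;;
      .store (.reg 7) (.reg 3 + .const 1) ;;
      .store (.reg 3) (.reg 7 + .const 1) ;;
      .ite (ltE (.const 0) (.reg 10))
        (.store (.reg 10 - .const 1) (.const 0))
        (.assign 40 (.reg 40 + .const 1)))
    (.assign 10 (.const 0))

/-- The auction with the vertices of colour `1` as bidders. -/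
def auctionP : Prog :=
  .assign 40 (.const 0) ;; .assign 9 (.const 0) ;;
  .loop (ltE (.reg 9) (.reg 37))
    (.assign 3 (.load (addr 4 (.reg 9))) ;;
      .ite (eqE (.load (addr 5 (.reg 3))) (.const 1))
        (.store (addr 5 (.reg 3)) (.const 3) ;;
          .assign 10 (.reg 3 + .const 1) ;;
          .loop (ltE (.const 0) (.reg 10)) bidP)
        .skip ;;
      .assign 9 (.reg 9 + .const 1))

/-- The data `σ` with another matching, other colours and prices. -/
def bidSt (σ : St) (m c p : ℕ → ℕ) (q : ℕ) : St := { σ with mt := m, col := c, pr := p, ms := q }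

/-- The invariant of the auction with the matching `m`, the colours `c`, the prices `p`, the number
`q` of matched pairs, and the bidder `b - 1` waiting if `b ≠ 0`. The items have the colour `2`, the
bidders the colour `3`, or `1` as long as they have not been considered. -/
structure Auction (n k : ℕ) (σ : St) (m c p : ℕ → ℕ) (q b : ℕ) : Prop where
  bip : ∀ u v, v ∈ row σ u → (c u = 2 ↔ c v ≠ 2)
  pos : ∀ v, c v ≠ 0 ↔ 0 < σ.d v
  le : ∀ v, c v ≤ 3
  sym : ∀ u v, m u = v + 1 → m v = u + 1 ∧ v ∈ row σ u
  priced : ∀ v, p v ≠ 0 → c v = 2 ∧ m v ≠ 0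
  ple : ∀ v, p v ≤ k
  happy : ∀ u y, m u = y + 1 → c u ≠ 2 → ∀ y' ∈ row σ u, p y ≤ p y' + 1
  fail : ∀ u, c u = 3 → m u = 0 → u + 1 ≠ b → ∀ y ∈ row σ u, k ≤ p y
  started : ∀ u, m u ≠ 0 → c u ≠ 2 → c u = 3
  act : ∀ u, b = u + 1 → c u = 3 ∧ m u = 0
  card : q = #{v ∈ range n | m v ≠ 0 ∧ c v = 2}

section
variable {w n k : ℕ} {κ : ℕ → Prop} {σ : St} {τ : ℕ → ℕ} {Q : St → (ℕ → ℕ) → ℕ → Prop}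
  {e e' : Expr} {a b u v i x y z q : ℕ} {m c p : ℕ → ℕ}

/-- One bid keeps the invariant: the bidder `u` takes a cheapest neighbour `y`, whose price rises by
`1`, and the former partner of `y`, if any, becomes the waiting bidder. -/
theorem Auction.bid (A : Auction n k σ m c p q (u + 1)) (G : Good n k κ σ) (hy : y ∈ row σ u)
    (hyk : p y < k) (hmin : ∀ y' ∈ row σ u, p y ≤ p y') {m' : ℕ → ℕ} (hu : m' u = y + 1)
    (hmy : m' y = u + 1) (hm' : ∀ v, v ≠ u → v ≠ y → m' v = if m v = y + 1 then 0 else m v) :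
    Auction n k σ m' c (Function.update p y (p y + 1)) (if m y = 0 then q + 1 else q) (m y) := by
  obtain ⟨hcu, hmu⟩ := A.act u rfl
  have hcy : c y = 2 := by
    by_contra h
    have := (A.bip u y hy).2 h
    omega
  have huy : u ≠ y := by rintro rfl; omega
  have hyn := G.adjn' (G.sub _ _ hy)
  have hp : ∀ v, p v ≤ Function.update p y (p y + 1) v := by
    intro v; rw [Function.update_apply]; split_ifs with h
    · subst h; omega
    · exact le_rfl
  -- Items are not matched to the item `y`.
  have hitem : ∀ v, c v = 2 → m v ≠ y + 1 := by
    intro v hv h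
    exact (A.bip v y (A.sym _ _ h).2).1 hv hcy
  refine ⟨A.bip, A.pos, A.le, ?_, ?_, ?_, ?_, ?_, ?_, ?_, ?_⟩
  · intro v z hvz
    by_cases h1 : v = u
    · subst h1
      have : z = y := by omega
      subst this
      exact ⟨hmy, hy⟩
    by_cases h2 : v = y
    · subst h2
      have : z = u := by omega
      subst this
      exact ⟨hu, G.row_symm hy⟩
    rw [hm' v h1 h2] at hvz
    split_ifs at hvz with h3
    obtain ⟨h4, h5⟩ := A.sym v z hvz
    have hzu : z ≠ u := by rintro rfl; omega
    have hzy : z ≠ y := by rintro rfl; exact h3 hvz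
    rw [hm' z hzu hzy, if_neg (by omega)]
    exact ⟨h4, h5⟩
  · intro v hv
    by_cases h2 : v = y
    · subst h2; exact ⟨hcy, by omega⟩
    rw [Function.update_of_ne h2] at hv
    obtain ⟨h3, h4⟩ := A.priced v hv
    refine ⟨h3, ?_⟩
    rw [hm' v (by rintro rfl; omega) h2, if_neg (hitem v h3)]
    exact h4
  · intro v; rw [Function.update_apply]; split_ifs
    · omega
    · exact A.ple v
  · intro u2 y2 h2 hc2 y' hy'
    by_cases h1 : u2 = u
    · subst h1
      have : y2 = y := by omega
      subst this
      rw [Function.update_self]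
      have := hmin y' hy'
      have := hp y'
      omega
    by_cases h3 : u2 = y
    · subst h3; omega
    rw [hm' u2 h1 h3] at h2
    split_ifs at h2 with h4
    rw [Function.update_of_ne (by rintro rfl; exact h4 h2)]
    have := A.happy u2 y2 h2 hc2 y' hy'
    have := hp y'
    omega
  · intro u2 hc2 hm2 hb2 y' hy'
    have h1 : u2 ≠ u := by rintro rfl; omega
    have h3 : u2 ≠ y := by rintro rfl; omega
    rw [hm' u2 h1 h3] at hm2
    have h4 : m u2 ≠ y + 1 := fun h => hb2 (A.sym _ _ h).1.symm
    rw [if_neg h4] at hm2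
    exact (A.fail u2 hc2 hm2 (by omega) y' hy').trans (hp y')
  · intro u2 hm2 hc2
    by_cases h1 : u2 = u
    · subst h1; exact hcu
    by_cases h3 : u2 = y
    · subst h3; omega
    rw [hm' u2 h1 h3] at hm2
    split_ifs at hm2 with h4
    · exact absurd rfl hm2
    · exact A.started u2 hm2 hc2
  · intro o ho
    obtain ⟨h1, h2⟩ := A.sym y o ho
    have h3 : c o ≠ 2 := fun h => hitem o h h1
    have h4 : o ≠ u := by rintro rfl; omega
    have h5 : o ≠ y := by rintro rfl; exact h3 hcy
    exact ⟨A.started o (by omega) h3, by rw [hm' o h4 h5, if_pos h1]⟩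
  · have hset : ({v ∈ range n | m' v ≠ 0 ∧ c v = 2} : Finset ℕ)
        = insert y ({v ∈ range n | m v ≠ 0 ∧ c v = 2} : Finset ℕ) := by
      ext v
      simp only [Finset.mem_filter, Finset.mem_range, Finset.mem_insert]
      by_cases h2 : v = y
      · subst h2; simp [hyn, hcy, hmy]
      · by_cases h3 : c v = 2
        · rw [hm' v (by rintro rfl; omega) h2, if_neg (hitem v h3)]
          simp [h2]
        · simp [h2, h3]
    rw [hset]
    split_ifs with h
    · rw [Finset.card_insert_of_notMem (by simp [h]), A.card]
    · rw [Finset.insert_eq_self.2 (by simp [h, hyn, hcy]), A.card]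

theorem Auction.lt (A : Auction n k σ m c p q b) (G : Good n k κ σ) (h : c v ≠ 0) : v < n := by
  by_contra hv
  have := G.dz v (by omega)
  have := (A.pos v).1 h
  omega

/-- Either no neighbour of `u` is cheaper than `k`, and register `7` is `0`, or the registers `7`
and `6` hold a cheapest neighbour, increased by one, and its price. -/
theorem Rn.choose (F : Fits w n k) (G : Good n k κ σ) (L : Lim (bet k) σ)
    (h3 : τ 3 = u) (hun : u < n) (hple : ∀ v, σ.pr v ≤ k)
    (h : ∀ τ' t, τ' 3 = u → τ' 9 = τ 9 →
      ((τ' 7 = 0 ∧ ∀ y ∈ row σ u, k ≤ σ.pr y) ∨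
        ∃ y ∈ row σ u, τ' 7 = y + 1 ∧ τ' 6 = σ.pr y ∧ σ.pr y < k ∧
          ∀ y' ∈ row σ u, σ.pr y ≤ σ.pr y') →
      t ≤ 700 * σ.d u + 400 → Q σ τ' t) :
    Rn w n k chooseP σ τ Q := by
  have Bd := F.bounds
  have hdu := G.d_le (L.mono (Nat.le_succ _)) u
  refine Rn.seq (Rn.assign (by decide) (eval_const_lt F (c := 0) (by decide)) fun c1 hc1 => ?_)
  refine Rn.seq (Rn.assign (x := k) (by decide) rfl fun c2 hc2 => ?_)
  refine Rn.seq (Rn.assign (by decide) (eval_const_lt F (c := 0) (by decide)) fun c3 hc3 => ?_)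
  refine Rn.loop (fun σ' τ' t => σ' = σ ∧ τ' 3 = u ∧ τ' 9 = τ 9 ∧ τ' 4 ≤ σ.d u ∧
      (∀ i < τ' 4, τ' 6 ≤ σ.pr (σ.slot u i)) ∧
      ((τ' 7 = 0 ∧ τ' 6 = k) ∨ ∃ i < σ.d u, τ' 7 = σ.slot u i + 1 ∧ τ' 6 = σ.pr (σ.slot u i) ∧
        τ' 6 < k) ∧ t ≤ 700 * τ' 4)
    (fun _ τ' => σ.d u - τ' 4) ?_ ?_
  · refine ⟨rfl, by simpa using h3, by simp, by simp, by simp, by simp, by omega⟩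
  rintro σ' τ' t ⟨rfl, h3', h9', h4', hmin, hbest, ht⟩ c4 hc4
  have hev := eval_lt_eq_zero F (eval_tmp (w := w) (n := n) (k := k)
    (σ := σ') (i := 4) (τ := τ')
    (by decide) rfl) (eval_degE F (a := 3) (by decide) h3' hun)
  refine ⟨fun h0 => ?_, fun h0 => ?_⟩
  · rw [hev] at h0
    refine h _ _ h3' h9' ?_ (by omega)
    rcases hbest with ⟨h7, h6⟩ | ⟨i, hi, h7, h6, h6k⟩
    · refine Or.inl ⟨h7, fun y hy => ?_⟩
      obtain ⟨i, hi, rfl⟩ := mem_row.1 hy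
      rw [← h6]
      exact hmin i (by omega)
    · refine Or.inr ⟨_, mem_row.2 ⟨i, hi, rfl⟩, h7, h6, by omega, fun y' hy' => ?_⟩
      obtain ⟨i', hi', rfl⟩ := mem_row.1 hy'
      rw [← h6]
      exact hmin i' (by omega)
  · rw [Ne, hev] at h0
    have hy : σ'.slot u (τ' 4) ∈ row σ' u := mem_row.2 ⟨_, by omega, rfl⟩
    set y := σ'.slot u (τ' 4) with hydef
    have hyn := G.adjn' (G.sub _ _ hy)
    refine Rn.seq (Rn.assign (x := y) (by decide)
      (eval_slot F (eval_tmp (by decide) h3') (eval_tmp (by decide) rfl) hun (by omega))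
      fun c5 hc5 => ?_)
    have hpr : ∀ τ'', τ'' 5 = y →
        (Expr.load (addr 6 (.reg 5))).eval w (enc n k σ' τ'') = σ'.pr y := fun τ'' h5 =>
      eval_pr F (eval_tmp (by decide) h5) (le_cap_of_lt F hyn)
    have hev2 := eval_lt_eq_zero F (hpr (Function.update τ' 5 y) (by simp))
      (eval_tmp (i := 6) (x := τ' 6) (by decide) (by simp))
    refine Rn.seq (Rn.ite (fun h1 c6 hc6 => ?_) (fun h1 c6 hc6 => ?_))
    · rw [Ne, hev2] at h1
      refine Rn.seq (Rn.assign (x := σ'.pr y) (by decide) (hpr _ (by simp)) fun c7 hc7 => ?_)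
      refine Rn.assign (x := y + 1) (by decide) (eval_add_one (eval_tmp (by decide) (by simp))
        (by omega)) fun c8 hc8 => ?_
      refine Rn.assign (x := τ' 4 + 1) (by decide) (eval_add_one (eval_tmp (by decide) (by simp))
        (by omega)) fun c9 hc9 => ?_
      have h6k : τ' 6 ≤ k := by
        rcases hbest with ⟨_, h6⟩ | ⟨i, hi, h7, h6, h6k⟩ <;> omega
      simp only [Function.update_self]
      refine ⟨⟨trivial, by simpa using h3', by simpa using h9', by omega, fun i hi => ?_,
        Or.inr ⟨τ' 4, by omega, by simp [hydef], by simp [hydef], ?_⟩, by omega⟩, by omega⟩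
      · simp only [ne_eq, not_false_eq_true,
          Function.update_of_ne, Function.update_self, Nat.reduceEqDiff]
        rcases Nat.lt_succ_iff_lt_or_eq.1 hi with h2 | rfl
        · have := hmin i h2; omega
        · exact le_rfl
      · simp only [ne_eq, not_false_eq_true,
          Function.update_of_ne, Function.update_self, Nat.reduceEqDiff]
        omega
    · rw [hev2] at h1
      refine Rn.skip ?_
      refine Rn.assign (x := τ' 4 + 1) (by decide) (eval_add_one (eval_tmp (by decide) (by simp))
        (by omega)) fun c9 hc9 => ?_
      simp only [Function.update_self]
      refine ⟨⟨trivial, by simpa using h3', by simpa using h9', by omega, fun i hi => ?_,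
        by simpa using hbest, by omega⟩, by omega⟩
      rcases Nat.lt_succ_iff_lt_or_eq.1 hi with h2 | rfl
      · simpa using hmin i h2
      · simpa [← hydef] using h1

theorem Auction.q_le (A : Auction n k σ m c p q b) : q ≤ n := by
  rw [A.card]
  exact (Finset.card_filter_le _ _).trans (by simp)

/-- The specification of `bidP`: a bid raises the sum of the prices, or ends the sequence of bids.
-/
theorem Rn.bid (F : Fits w n k) (G : Good n k κ σ) (L : Lim (bet k) σ)
    (A : Auction n k σ m c p q (u + 1)) (h10 : τ 10 = u + 1)
    (h : ∀ m' p' q' τ' t, Auction n k σ m' c p' q' (τ' 10) → τ' 9 = τ 9 →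
      ((∑ v ∈ range n, p' v = ∑ v ∈ range n, p v + 1) ∨ (p' = p ∧ τ' 10 = 0)) →
      t ≤ 800 * bet k → Q (bidSt σ m' c p' q') τ' t) :
    Rn w n k bidP (bidSt σ m c p q) τ Q := by
  have Bd := F.bounds
  have hk : 64 ≤ k * k := Nat.mul_le_mul F.eight F.eight
  have hqn := A.q_le
  obtain ⟨hcu, hmu⟩ := A.act u rfl
  have hun : u < n := A.lt G (by omega)
  have hdu := G.d_le (L.mono (Nat.le_succ _)) u
  refine Rn.seq (Rn.assign (x := u) (by decide) (eval_sub_one (x := u + 1)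
    (eval_tmp (by decide) h10) (by omega)) fun c1 hc1 => ?_)
  have G' : Good n k κ (bidSt σ m c p q) :=
    ⟨G.dz, G.sym, G.sub, G.adjs, G.adjn, G.bip, G.degb, G.pot, G.cnts, G.cntT, G.lgs, G.dvs,
      G.logn, G.logd, G.stkn⟩
  refine Rn.seq (Rn.choose F G' L (u := u) (by simp) hun A.ple ?_)
  intro τ1 t1 h31 h91 hres ht1
  have ht1' : t1 ≤ 700 * σ.d u + 400 := ht1
  have h91' : τ1 9 = τ 9 := by rw [h91]; simp
  have hev := eval_lt_eq_zero F (s := enc n k (bidSt σ m c p q) τ1)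
    (eval_const_lt F (c := 0) (by decide)) (eval_tmp (i := 7) (by decide) rfl)
  refine Rn.ite (fun h0 c2 hc2 => ?_) (fun h0 c2 hc2 => ?_)
  · rw [Ne, hev] at h0
    rcases hres with ⟨h7, _⟩ | ⟨y, hy, h7, h6, hyk, hmin⟩
    · omega
    have hy' : y ∈ row σ u := hy
    have hyk' : p y < k := hyk
    have h6' : τ1 6 = p y := h6
    have hyn := G.adjn' (G.sub _ _ hy')
    have huy : u ≠ y := G.ne (G.sub _ _ hy')
    refine Rn.seq (Rn.assign (x := y) (by decide) (eval_sub_one (x := y + 1)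
      (eval_tmp (by decide) h7) (by omega)) fun c3 hc3 => ?_)
    refine Rn.seq (Rn.store_pr F (i := y) (x := p y + 1) (eval_tmp (by decide) (by simp))
      (le_cap_of_lt F hyn) (eval_add_one (eval_tmp (by decide) (by simpa using h6')) (by omega))
      fun c4 hc4 => ?_)
    refine Rn.seq (Rn.assign (x := m y) (by decide) (eval_mt (i := y)
      (eval_tmp (by decide) (by simp)) hyn) fun c5 hc5 => ?_)
    refine Rn.seq (Rn.store_mt (i := y) (x := u + 1) (eval_tmp (by decide) (by simp)) hyn
      (eval_add_one (eval_tmp (by decide) (by simpa using h31)) (by omega)) fun c6 hc6 => ?_)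
    refine Rn.seq (Rn.store_mt (i := u) (x := y + 1) (eval_tmp (by decide) (by simpa using h31))
      hun (eval_add_one (eval_tmp (by decide) (by simp)) (by omega)) fun c7 hc7 => ?_)
    have hev2 := fun σ' => eval_lt_eq_zero F
      (s := enc n k σ' (Function.update (Function.update τ1 7 y) 10 (m y)))
      (eval_const_lt F (c := 0) (by decide)) (eval_tmp (i := 10) (x := m y) (by decide) (by simp))
    have hsum := sum_update hyn (fun _ x => x) p (p y + 1)
    refine Rn.ite (fun h1 c8 hc8 => ?_) (fun h1 c8 hc8 => ?_)
    · rw [Ne, hev2] at h1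
      obtain ⟨o, ho⟩ : ∃ o, m y = o + 1 := ⟨m y - 1, by omega⟩
      obtain ⟨h2, h3⟩ := A.sym y o ho
      have hon := G.adjn' (G.sub _ _ h3)
      have hoy : o ≠ y := (G.ne (G.sub _ _ h3)).symm
      have hou : o ≠ u := by rintro rfl; omega
      refine Rn.store_mt (i := o) (x := 0) (eval_sub_one (x := o + 1)
        (eval_tmp (by decide) (by simp [ho])) (by omega)) hon
        (eval_const_lt F (by decide)) fun c9 hc9 => ?_
      have A' := A.bid G hy' hyk' hmin
        (m' := Function.update (Function.update (Function.update m y (u + 1)) u (y + 1)) o 0)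
        (by rw [Function.update_of_ne hou.symm, Function.update_self])
        (by rw [Function.update_of_ne hoy.symm, Function.update_of_ne huy.symm,
          Function.update_self])
        (fun v hv1 hv2 => by
          by_cases hvo : v = o
          · subst hvo; rw [Function.update_self, if_pos h2]
          · rw [Function.update_of_ne hvo, Function.update_of_ne hv1, Function.update_of_ne hv2,
              if_neg]
            intro h4
            have := (A.sym _ _ h4).1
            omega)
      rw [if_neg (by omega)] at A'
      exact h (Function.update (Function.update (Function.update m y (u + 1)) u (y + 1)) o 0)
        (Function.update p y (p y + 1)) q _ _ (by simpa using A') (by simpa using h91')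
        (Or.inl (by omega)) (by omega)
    · rw [hev2] at h1
      have hmy0 : m y = 0 := by omega
      refine Rn.assign_ms (x := q + 1) (eval_add_one rfl (by omega)) fun c9 hc9 => ?_
      have A' := A.bid G hy' hyk' hmin
        (m' := Function.update (Function.update m y (u + 1)) u (y + 1))
        (by rw [Function.update_self])
        (by rw [Function.update_of_ne huy.symm, Function.update_self])
        (fun v hv1 hv2 => by
          rw [Function.update_of_ne hv1, Function.update_of_ne hv2, if_neg]
          intro h4
          have := (A.sym _ _ h4).1
          omega)
      rw [if_pos hmy0] at A'
      exact h (Function.update (Function.update m y (u + 1)) u (y + 1))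
        (Function.update p y (p y + 1)) (q + 1) _ _ (by simpa using A') (by simpa using h91')
        (Or.inl (by omega)) (by omega)
  · rw [hev] at h0
    rcases hres with ⟨h7, hall⟩ | ⟨y, hy, h7, h6, hyk, hmin⟩
    · refine Rn.assign (by decide) (eval_const_lt F (c := 0) (by decide)) fun c3 hc3 => ?_
      refine h m p q _ _ ?_ (by simpa using h91') (Or.inr ⟨rfl, by simp⟩) (by omega)
      refine ⟨A.bip, A.pos, A.le, A.sym, A.priced, A.ple, A.happy, ?_, A.started, by simp, A.card⟩
      intro u2 hc2 hm2 _
      by_cases hu2 : u2 = u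
      · subst hu2; exact hall
      · exact A.fail u2 hc2 hm2 (by omega)
    · omega

/-- The bids following the start of a bidder, until nobody is waiting. The time is paid for by the
growth of the prices, up to one bid. -/
theorem Rn.bids (F : Fits w n k) (G : Good n k κ σ) (L : Lim (bet k) σ)
    (A : Auction n k σ m c p q (τ 10)) (hb : τ 10 ≠ 0)
    (h : ∀ m' p' q' τ' t, Auction n k σ m' c p' q' 0 → τ' 9 = τ 9 →
      t + 900 * bet k * ∑ v ∈ range n, p v ≤ 900 * bet k * ∑ v ∈ range n, p' v + 900 * bet k + 100 →
      Q (bidSt σ m' c p' q') τ' t) :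
    Rn w n k (.loop (ltE (.const 0) (.reg 10)) bidP) (bidSt σ m c p q) τ Q := by
  have Bd := F.bounds
  have hk : 64 ≤ k * k := Nat.mul_le_mul F.eight F.eight
  refine Rn.loop (fun σ' τ' t => ∃ m' p' q', σ' = bidSt σ m' c p' q' ∧
      Auction n k σ m' c p' q' (τ' 10) ∧ τ' 9 = τ 9 ∧
      t + 900 * bet k * ∑ v ∈ range n, p v + (if τ' 10 = 0 then 0 else 900 * bet k)
        ≤ 900 * bet k * ∑ v ∈ range n, p' v + 900 * bet k)
    (fun σ' τ' => 2 * (k * n - ∑ v ∈ range n, σ'.pr v) + (if τ' 10 = 0 then 0 else 1)) ?_ ?_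
  · exact ⟨m, p, q, rfl, A, rfl, by rw [if_neg hb]; omega⟩
  rintro σ' τ' t ⟨m', p', q', rfl, A', h9, ht⟩ c1 hc1
  have hev := eval_lt_eq_zero F (s := enc n k (bidSt σ m' c p' q') τ')
    (eval_const_lt F (c := 0) (by decide)) (eval_tmp (i := 10) (by decide) rfl)
  refine ⟨fun h0 => ?_, fun h0 => ?_⟩
  · rw [hev] at h0
    have h10 : τ' 10 = 0 := by omega
    rw [h10] at A'
    rw [if_pos h10] at ht
    exact h _ _ _ _ _ A' h9 (by omega)
  · rw [Ne, hev] at h0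
    obtain ⟨u, hu⟩ : ∃ u, τ' 10 = u + 1 := ⟨τ' 10 - 1, by omega⟩
    rw [if_neg (by omega)] at ht
    rw [hu] at A'
    refine Rn.bid F G L A' hu ?_
    intro m2 p2 q2 τ2 t2 A2 h92 hres ht2
    have hb : ∀ p : ℕ → ℕ, (∀ v, p v ≤ k) → ∑ v ∈ range n, p v ≤ k * n := fun p hp => by
      refine (Finset.sum_le_card_nsmul _ _ k fun u _ => hp u).trans ?_
      simp [Nat.mul_comm]
    have hb2 := hb p2 A2.ple
    refine ⟨⟨m2, p2, q2, rfl, A2, by omega, ?_⟩, ?_⟩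
    · rcases hres with h1 | ⟨rfl, h1⟩
      · rw [h1, Nat.mul_add]
        split_ifs <;> omega
      · rw [if_pos h1]; omega
    · simp only [bidSt]
      rw [if_neg (by omega : τ' 10 ≠ 0)]
      rcases hres with h1 | ⟨rfl, h1⟩
      · split_ifs <;> omega
      · rw [if_pos h1]; omega

/-- The total degree of the bidders which have been considered. -/
def bidCost (n : ℕ) (σ : St) (c : ℕ → ℕ) : ℕ := ∑ v ∈ range n, if c v = 3 then σ.d v else 0

/-- The specification of `auctionP`. The last bid in the sequence started by a bidder is paid for by
its degree in the sparsifier, which is positive. -/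
theorem Rn.auction (F : Fits w n k) (G : Good n k κ σ) (L : Lim (bet k) σ) (P : Proper σ σ.col)
    (hmt : σ.mt = fun _ => 0) (hpr : σ.pr = fun _ => 0)
    (h : ∀ m c p q τ' t, Auction n k σ m c p q 0 → (∀ v, c v ≠ 1) →
      t ≤ 1000 * bet k * (∑ v ∈ range n, p v + ∑ v ∈ range n, σ.d v) + 900 * σ.lg + 300 →
      Q (bidSt σ m c p q) τ' t) :
    Rn w n k auctionP σ τ Q := by
  have Bd := F.bounds
  have hk : 64 ≤ k * k := Nat.mul_le_mul F.eight F.eight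
  have hops := G.ops_le (L.mono (Nat.le_succ _))
  have hlg := G.lgs
  refine Rn.seq (Rn.assign_ms (x := 0) (eval_const_lt F (by decide)) fun c1 hc1 => ?_)
  refine Rn.seq (Rn.assign (by decide) (eval_const_lt F (c := 0) (by decide)) fun c2 hc2 => ?_)
  refine Rn.loop (fun σ' τ' t => ∃ m c p q, σ' = bidSt σ m c p q ∧
      Auction n k σ m c p q 0 ∧ τ' 9 ≤ σ.lg ∧ (∀ i < τ' 9, c (σ.log i) ≠ 1) ∧
      t ≤ 900 * bet k * ∑ v ∈ range n, p v + 1000 * bet k * bidCost n σ c + 900 * τ' 9)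
    (fun _ τ' => σ.lg - τ' 9) ?_ ?_
  · refine ⟨fun _ => 0, σ.col, fun _ => 0, 0, ?_, ?_, by simp, by simp, by omega⟩
    · rw [← hmt]
      have : σ.mt = σ.pr := by rw [hmt, hpr]
      simp only [bidSt]
      congr 1
      exact this.symm
    · refine ⟨fun u v huv => ?_, P.pos, fun v => (P.le v).trans (by omega), by simp, by simp,
        by simp, by simp, fun u hu => ?_, by simp, by simp, by simp⟩
      · have h1 := P.ne u v huv
        have h2 := P.le u
        have h3 := P.le v
        have h4 := (P.pos u).2 (pos_of_mem_row huv)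
        have h5 := (P.pos v).2 (pos_of_mem_row (G.row_symm huv))
        omega
      · have := P.le u; omega
  rintro σ' τ' t ⟨m, c, p, q, rfl, A, h9, hl, ht⟩ c3 hc3
  have hev := eval_lt_eq_zero F (eval_tmp (w := w) (n := n) (k := k)
    (σ := bidSt σ m c p q) (i := 9) (τ := τ')
    (by decide) rfl) (e' := .reg 37) (y := σ.lg) rfl
  refine ⟨fun h0 => ?_, fun h0 => ?_⟩
  · rw [hev] at h0
    have hc1 : ∀ v, c v ≠ 1 := by
      intro v hv
      obtain ⟨i, hi, rfl⟩ := G.logd v ((A.pos v).1 (by omega))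
      exact hl i (by omega) hv
    refine h m c p q _ _ A hc1 ?_
    have : bidCost n σ c ≤ ∑ v ∈ range n, σ.d v :=
      Finset.sum_le_sum fun v _ => by split_ifs <;> omega
    have := Nat.mul_le_mul_left (1000 * bet k) this
    have : 1000 * bet k * (∑ v ∈ range n, p v + ∑ v ∈ range n, σ.d v)
        = 900 * bet k * ∑ v ∈ range n, p v + 100 * (bet k * ∑ v ∈ range n, p v)
          + 1000 * bet k * ∑ v ∈ range n, σ.d v := by ring
    omega
  · rw [Ne, hev] at h0
    have hln := G.logn (τ' 9) (by omega)
    set x := σ.log (τ' 9) with hx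
    refine Rn.seq (Rn.assign (x := x) (by decide)
      (eval_log F (eval_tmp (by decide) rfl) (by omega)) fun c4 hc4 => ?_)
    have hev2 := eval_eq_one F (eval_col (w := w) (σ := bidSt σ m c p q) F
      (eval_tmp (τ := Function.update τ' 3 x) (i := 3) (x := x) (by decide) (by simp))
      (le_cap_of_lt F hln)) (eval_const_lt F (c := 1) (by decide))
    refine Rn.seq (Rn.ite (fun h1 c5 hc5 => ?_) (fun h1 c5 hc5 => ?_))
    · rw [hev2] at h1
      have hcx : c x = 1 := by
        by_contra hne
        exact h1 (if_neg hne)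
      refine Rn.seq (Rn.store_col F (i := x) (x := 3) (eval_tmp (by decide) (by simp))
        (le_cap_of_lt F hln) (eval_const_lt F (by decide)) fun c6 hc6 => ?_)
      refine Rn.seq (Rn.assign (x := x + 1) (by decide) (eval_add_one (eval_tmp (by decide)
        (by simp)) (by omega)) fun c7 hc7 => ?_)
      have hdx : 0 < σ.d x := (A.pos x).1 (by omega)
      have hmx : m x = 0 := by
        by_contra hne
        have := A.started x hne (by omega)
        omega
      have hc2 : ∀ v, Function.update c x 3 v = 2 ↔ c v = 2 := by
        intro v; rw [Function.update_apply]; split_ifs with hv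
        · subst hv; omega
        · rfl
      have A' : Auction n k σ m (Function.update c x 3) p q (x + 1) := by
        refine ⟨fun u v huv => ?_, fun v => ?_, fun v => ?_, A.sym, fun v hv => ?_, A.ple,
          fun u y huy hcu => ?_, fun u hcu hmu hux => ?_, fun u hmu hcu => ?_, fun u hu => ?_, ?_⟩
        · rw [Ne, hc2, hc2]; exact A.bip u v huv
        · rw [Function.update_apply]; split_ifs with hv
          · subst hv; simp [hdx]
          · exact A.pos v
        · rw [Function.update_apply]; split_ifs with hv
          · omega
          · exact A.le v
        · rw [hc2]; exact A.priced v hv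
        · rw [Ne, hc2] at hcu; exact A.happy u y huy hcu
        · rw [Function.update_of_ne (by omega)] at hcu
          exact A.fail u hcu hmu (by omega)
        · rw [Ne, hc2] at hcu
          have := A.started u hmu hcu
          rw [Function.update_of_ne (by rintro rfl; omega)]; exact this
        · have : u = x := by omega
          subst this
          exact ⟨Function.update_self .., hmx⟩
        · simp only [hc2]; exact A.card
      refine Rn.bids (σ := σ) (m := m) (c := Function.update c x 3) (p := p) (q := q) F G L
        (by simpa using A') (by simp) ?_
      intro m2 p2 q2 τ2 t2 A2 h92 ht2
      have h92' : τ2 9 = τ' 9 := by rw [h92]; simp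
      refine Rn.assign (x := τ' 9 + 1) (by decide) (eval_add_one (eval_tmp (by decide) h92')
        (by omega)) fun c8 hc8 => ?_
      simp only [Function.update_self]
      refine ⟨⟨m2, Function.update c x 3, p2, q2, rfl, A2, by omega, fun i hi => ?_, ?_⟩,
        by omega⟩
      · rw [Function.update_apply]; split_ifs with hv
        · omega
        · rcases Nat.lt_succ_iff_lt_or_eq.1 hi with h2 | rfl
          · exact hl i h2
          · exact absurd rfl hv
      · have hbc : bidCost n σ (Function.update c x 3) = bidCost n σ c + σ.d x := by
          have := sum_update hln (fun v c => if c = 3 then σ.d v else 0) c 3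
          simp only [hcx] at this
          simp only [bidCost]
          simpa using this
        obtain ⟨δ, hδ⟩ : ∃ δ, σ.d x = δ + 1 := ⟨σ.d x - 1, by omega⟩
        rw [hbc, hδ]
        have hb0 : 1000 * bet k * (bidCost n σ c + (δ + 1))
            = 1000 * bet k * bidCost n σ c + 1000 * (bet k * δ) + 1000 * bet k := by ring
        omega
    · rw [hev2] at h1
      have hcx : c x ≠ 1 := by
        intro hne
        have h1' : (if c x = 1 then 1 else 0) = 0 := h1
        simp [hne] at h1'
      refine Rn.skip ?_
      refine Rn.assign (x := τ' 9 + 1) (by decide) (eval_add_one (eval_tmp (by decide) (by simp))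
        (by omega)) fun c8 hc8 => ?_
      simp only [Function.update_self]
      refine ⟨⟨m, c, p, q, rfl, A, by omega, fun i hi => ?_, by omega⟩, by omega⟩
      rcases Nat.lt_succ_iff_lt_or_eq.1 hi with h2 | rfl
      · exact hl i h2
      · exact hcx

end

/-! ### Rebuilding the matching -/

/-- Compute a new matching in the sparsifier. -/
def rebuildP : Prog := resetP ;; colourP ;; auctionP

/-- The partners in the stored matching are adjacent, exactly one of two partners has the colour
`2`, and `ms` is the size of the matching. -/
structure Matched (n : ℕ) (σ : St) : Prop where
  sym : ∀ u v, σ.mt u = v + 1 → σ.mt v = u + 1 ∧ Adj σ u v ∧ (σ.col u = 2 ↔ σ.col v ≠ 2)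
  card : σ.ms = #{v ∈ range n | σ.mt v ≠ 0 ∧ σ.col v = 2}

/-- The data `σ` after a rebuild. -/
def rebuilt (σ : St) (m c p s : ℕ → ℕ) (q : ℕ) : St :=
  { σ with mt := m, col := c, pr := p, stk := s, sp := 0, ms := q }

section
variable {w n k : ℕ} {κ : ℕ → Prop} {σ : St} {τ : ℕ → ℕ} {Q : St → (ℕ → ℕ) → ℕ → Prop}
  {a b u v i x y z q : ℕ} {m c p s : ℕ → ℕ}

theorem Good.rebuilt (G : Good n k κ σ) : Good n k κ (rebuilt σ m c p s q) :=
  ⟨G.dz, G.sym, G.sub, G.adjs, G.adjn, G.bip, G.degb, G.pot, (Nat.le_add_right _ _).trans G.cnts,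
    G.cntT, G.lgs, G.dvs, G.logn, G.logd, fun _ h => absurd h (Nat.not_lt_zero _)⟩

theorem Good.sum_count_row (G : Good n k κ σ) (u : ℕ) :
    ∑ v ∈ range n, (row σ u).count v = σ.d u := by
  rw [← card_row σ u, ← Multiset.toFinset_sum_count_eq]
  refine (Finset.sum_subset (fun v hv => ?_) fun v _ hv => ?_).symm
  · exact Finset.mem_range.2 (G.adjn' (G.sub _ _ (Multiset.mem_toFinset.1 hv)))
  · rw [Multiset.count_eq_zero]
    exact fun h => hv (Multiset.mem_toFinset.2 h)

/-- Only matched items have a positive price, so the auction is short compared with the matching. -/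
theorem Auction.sum_price_le (A : Auction n k σ m c p q b) : ∑ v ∈ range n, p v ≤ k * q := by
  have h1 : ∑ v ∈ range n, p v = ∑ v ∈ range n with m v ≠ 0 ∧ c v = 2, p v := by
    rw [Finset.sum_filter]
    refine Finset.sum_congr rfl fun v _ => ?_
    split_ifs with h
    · rfl
    · by_contra h'
      exact h (A.priced v h').symm
  rw [h1, A.card]
  refine (Finset.sum_le_card_nsmul _ _ k fun v _ => A.ple v).trans ?_
  simp [Nat.mul_comm]

/-- The vertex cover of the sparsifier, scaled by `k`, given by an auction: an item has its price,
and a matched bidder the rest of `k + 1` for the price of its item. -/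
def auctionCover (k : ℕ) (m c p : ℕ → ℕ) (v : ℕ) : ℕ :=
  if c v = 2 then p v else if m v = 0 then 0 else k + 1 - p (m v - 1)

/-- Complementary slackness: an unmatched bidder found all neighbours at the price `k`, and the item
of a matched bidder is up to `1` a cheapest one. -/
theorem Auction.cover (A : Auction n k σ m c p q 0) (hc : ∀ v, c v ≠ 1) (G : Good n k κ σ)
    (h : v ∈ row σ u) : k ≤ auctionCover k m c p u + auctionCover k m c p v := by
  have key : ∀ u v, v ∈ row σ u → c v = 2 →
      k ≤ auctionCover k m c p u + auctionCover k m c p v := by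
    intro u v h hv
    have hu : c u ≠ 2 := fun hu => (A.bip u v h).1 hu hv
    have hu0 := (A.pos u).2 (pos_of_mem_row h)
    have hu1 := hc u
    have hu3 := A.le u
    simp only [auctionCover]
    rw [if_neg hu, if_pos hv]
    split_ifs with hm
    · have := A.fail u (by omega) hm (by omega) v h
      omega
    · obtain ⟨y, hy⟩ : ∃ y, m u = y + 1 := ⟨m u - 1, by omega⟩
      have h1 := A.happy u y hy hu v h
      have h2 := A.ple y
      rw [hy, Nat.add_sub_cancel]
      omega
  by_cases hv : c v = 2
  · exact key u v h hv
  · rw [Nat.add_comm]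
    exact key v u (G.row_symm h) ((A.bip u v h).2 hv)

/-- The price of an item and the rest for its partner add up to `k + 1`. -/
theorem Auction.sum_cover (A : Auction n k σ m c p q 0) (G : Good n k κ σ) :
    ∑ v ∈ range n, auctionCover k m c p v = (k + 1) * q := by
  have h0 : ∀ u v, m u = v + 1 → u < n ∧ (c u = 2 ↔ c v ≠ 2) := fun u v h =>
    ⟨G.adjn _ _ (G.sub _ _ (A.sym u v h).2), A.bip u v (A.sym u v h).2⟩
  have h1 : ∑ v ∈ range n, auctionCover k m c p v
      = ∑ v ∈ range n with m v ≠ 0 ∧ c v = 2, p v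
        + ∑ v ∈ range n with m v ≠ 0 ∧ c v ≠ 2, (k + 1 - p (m v - 1)) := by
    rw [Finset.sum_filter, Finset.sum_filter, ← Finset.sum_add_distrib]
    refine Finset.sum_congr rfl fun v _ => ?_
    have := A.priced v
    unfold auctionCover
    by_cases hc : c v = 2 <;> by_cases hm : m v = 0 <;> simp_all
  have h2 : ∑ v ∈ range n with m v ≠ 0 ∧ c v ≠ 2, (k + 1 - p (m v - 1))
      = ∑ v ∈ range n with m v ≠ 0 ∧ c v = 2, (k + 1 - p v) := by
    refine Finset.sum_nbij' (fun v => m v - 1) (fun v => m v - 1) ?_ ?_ ?_ ?_ fun _ _ => rfl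
    · intro v hv
      simp only [Finset.mem_filter, Finset.mem_range] at hv ⊢
      obtain ⟨y, hy⟩ : ∃ y, m v = y + 1 := ⟨m v - 1, by omega⟩
      have h3 := (A.sym v y hy).1
      have := h0 v y hy
      rw [hy, Nat.add_sub_cancel]
      exact ⟨(h0 y v h3).1, by omega, by tauto⟩
    · intro v hv
      simp only [Finset.mem_filter, Finset.mem_range] at hv ⊢
      obtain ⟨y, hy⟩ : ∃ y, m v = y + 1 := ⟨m v - 1, by omega⟩
      have h3 := (A.sym v y hy).1
      have := h0 v y hy
      rw [hy, Nat.add_sub_cancel]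
      exact ⟨(h0 y v h3).1, by omega, by tauto⟩
    · intro v hv
      simp only [Finset.mem_filter] at hv
      obtain ⟨y, hy⟩ : ∃ y, m v = y + 1 := ⟨m v - 1, by omega⟩
      have h3 := (A.sym v y hy).1
      simp [hy, h3]
    · intro v hv
      simp only [Finset.mem_filter] at hv
      obtain ⟨y, hy⟩ : ∃ y, m v = y + 1 := ⟨m v - 1, by omega⟩
      have h3 := (A.sym v y hy).1
      simp [hy, h3]
  have h3 : ∑ v ∈ range n with m v ≠ 0 ∧ c v = 2, (p v + (k + 1 - p v))
      = ∑ v ∈ range n with m v ≠ 0 ∧ c v = 2, (k + 1) :=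
    Finset.sum_congr rfl fun v _ => by have := A.ple v; omega
  rw [h1, h2, ← Finset.sum_add_distrib, h3, A.card]
  simp [Nat.mul_comm]

/-- The matching found by the auction is almost as large as the cover value of the sparsifier. -/
theorem Auction.dv_le (A : Auction n k σ m c p q 0) (hc : ∀ v, c v ≠ 1) (G : Good n k κ σ)
    (L : Lim (bet k) σ) : k * σ.dv ≤ (k + 1) * ((k + 1) * q) := by
  rw [← A.sum_cover G, G.dvs]
  refine sum_cov_le_cover (w := fun u v => (row σ u).count v) G.sym
    (fun u _ => G.sum_count_row u) (fun u _ v _ h => L u v (Multiset.count_pos.1 h))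
    fun u _ v _ h => A.cover hc G (Multiset.count_pos.1 h)

/-- A rebuild leaves the sparsifier alone. Its time depends on the sparsifier and on the size `q` of
the new matching, but not on `n`. -/
theorem Rn.rebuild (F : Fits w n k) (G : Good n k κ σ) (L : Lim (bet k) σ) (C : Clean σ)
    (hsp : σ.sp = 0)
    (h : ∀ m c p s q τ' t, Matched n (rebuilt σ m c p s q) → Clean (rebuilt σ m c p s q) →
      k * σ.dv ≤ (k + 1) * ((k + 1) * q) →
      t ≤ 1000 * bet k * (k * q) + 1000 * bet k * ∑ v ∈ range n, σ.d v
        + 2000 * ∑ v ∈ range n, σ.d v + 2500 * σ.lg + 700 →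
      Q (rebuilt σ m c p s q) τ' t) :
    Rn w n k rebuildP σ τ Q := by
  refine Rn.seq (Rn.reset F G L C fun τ1 t1 ht1 => ?_)
  set σ1 : St := { σ with mt := fun _ => 0, col := fun _ => 0, pr := fun _ => 0 } with hσ1
  have G1 : Good n k κ σ1 :=
    ⟨G.dz, G.sym, G.sub, G.adjs, G.adjn, G.bip, G.degb, G.pot, G.cnts, G.cntT, G.lgs, G.dvs,
      G.logn, G.logd, G.stkn⟩
  refine Rn.seq (Rn.colour F G1 L hsp rfl fun c s τ2 t2 P2 ht2 => ?_)
  have G2 : Good n k κ (recol σ1 c s 0) := G.rebuilt (m := fun _ => 0) (p := fun _ => 0)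
    (q := σ.ms)
  refine Rn.auction F G2 L ⟨P2.le, P2.pos, P2.ne⟩ rfl rfl ?_
  intro m c' p q τ3 t3 A hc ht3
  have A' : Auction n k σ m c' p q 0 :=
    ⟨A.bip, A.pos, A.le, A.sym, A.priced, A.ple, A.happy, A.fail, A.started, A.act, A.card⟩
  have ht2' : t2 ≤ 2000 * ∑ v ∈ range n, σ.d v + 900 * σ.lg + 200 := ht2
  have ht3' : t3 ≤ 1000 * bet k * (∑ v ∈ range n, p v + ∑ v ∈ range n, σ.d v) + 900 * σ.lg + 300 :=
    ht3
  rw [Nat.mul_add] at ht3'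
  have hp := Nat.mul_le_mul_left (1000 * bet k) A'.sum_price_le
  refine h m c' p s q τ3 _ ⟨fun u v huv => ?_, A'.card⟩ (fun v hv => ?_) (A'.dv_le hc G L)
    (by omega)
  · obtain ⟨h1, h2⟩ := A'.sym u v huv
    exact ⟨h1, G.sub _ _ h2, A'.bip u v h2⟩
  · refine G.logd v ?_
    have key : ∀ v, m v ≠ 0 → 0 < σ.d v := fun v hv =>
      pos_of_mem_row (A'.sym v (m v - 1) (by omega)).2
    rcases hv with hv | hv | hv
    · exact key v hv
    · exact (A'.pos v).1 hv
    · exact key v (A'.priced v hv).2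

/-! ### Consequences of the invariants -/

/-- The number of vertices which are not scanned any more. -/
def dead (n k : ℕ) (σ : St) : ℕ := #{v ∈ range n | thr k ≤ σ.cnt v}

/-- The vertex cover of the graph, scaled by `k` and up to an error of `1` at every edge. -/
def cover (k : ℕ) (σ : St) (v : ℕ) : ℕ := cov k (σ.d v) + if thr k ≤ σ.cnt v then k else 0

theorem Good.sum_cover (G : Good n k κ σ) :
    ∑ v ∈ range n, cover k σ v = σ.dv + k * dead n k σ := by
  simp only [cover, Finset.sum_add_distrib, G.dvs, dead, Finset.card_filter, Finset.mul_sum]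
  congr 1
  exact Finset.sum_congr rfl fun v _ => by split_ifs <;> simp

theorem Pend.cover (hP : Pend k (fun _ _ => False) σ) (hsp : σ.sp = 0) (h : Adj σ u v) :
    k ≤ cover k σ u + cover k σ v + 1 := by
  have key : ∀ x, Flag k σ x → k ≤ IncrementalMatching.cover k σ x := by
    intro x hx
    rcases hx with ⟨i, hi, _⟩ | hx
    · omega
    · rw [IncrementalMatching.cover, if_pos hx]; omega
  rcases hP u v h with h1 | h1 | h1 | h1
  · have := cov_add_cov h1
    simp only [IncrementalMatching.cover]; omega
  · have := key u h1; omega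
  · have := key v h1; omega
  · exact h1.elim

theorem Good.sum_deg_le (G : Good n k κ σ) (L : Lim (bet k) σ) (hP : Pend k (fun _ _ => False) σ)
    (hsp : σ.sp = 0) : k * ∑ v ∈ range n, σ.d v
      ≤ 2 * bet k * (σ.dv + k * dead n k σ) + ∑ v ∈ range n, σ.d v := by
  rw [← G.sum_cover]
  exact sum_deg_le_cover (w := fun u v => (row σ u).count v) G.sym
    (fun u _ => G.sum_count_row u) (fun u _ => G.d_le (L.mono (Nat.le_succ _)) u)
    fun u _ v _ h => hP.cover hsp (G.sub _ _ (Multiset.count_pos.1 h))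

/-- There are few dead vertices, since all scans together are paid for by changes of the
sparsifier. -/
theorem Good.dead_le (hk : 8 ≤ k) (G : Good n k κ σ) (L : Lim (bet k) σ)
    (hP : Pend k (fun _ _ => False) σ) (hsp : σ.sp = 0) : k * (k * dead n k σ) ≤ σ.dv := by
  refine IncrementalMatching.dead_le hk ?_ G.ops_le_sum (G.sum_deg_le L hP hsp)
  have h1 : thr k * dead n k σ ≤ ∑ v ∈ range n, σ.cnt v := by
    rw [dead, Finset.card_filter, Finset.mul_sum]
    refine Finset.sum_le_sum fun v _ => ?_
    split_ifs with h <;> simp [h]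
  have := G.cnts
  omega

/-- The number of edges of the sparsifier is bounded by its cover value. -/
theorem Good.mul_sum_deg_le (hk : 8 ≤ k) (G : Good n k κ σ) (L : Lim (bet k) σ)
    (hP : Pend k (fun _ _ => False) σ) (hsp : σ.sp = 0) :
    k * ∑ v ∈ range n, σ.d v ≤ 5 * bet k * σ.dv := by
  have h1 := G.sum_deg_le L hP hsp
  have h2 := G.dead_le hk L hP hsp
  have h3 : 8 * (k * dead n k σ) ≤ σ.dv := (Nat.mul_le_mul_right _ hk).trans h2
  have h4 := Nat.mul_le_mul_left (bet k) h3
  have h5 := Nat.mul_le_mul_right (∑ v ∈ range n, σ.d v) hk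
  rw [Nat.mul_add] at h1
  have e1 : bet k * (8 * (k * dead n k σ)) = 4 * (2 * bet k * (k * dead n k σ)) := by ring
  have e2 : 2 * bet k * σ.dv = 2 * (bet k * σ.dv) := by ring
  have e3 : 5 * bet k * σ.dv = 5 * (bet k * σ.dv) := by ring
  omega

/-- The time of a rebuild is paid for by the growth of the matching. -/
theorem rebuild_time (hk : 8 ≤ k) {D S lg ops q₀ : ℕ} (h1 : (k + 5) * q₀ < D)
    (h2 : k * D ≤ (k + 1) * ((k + 1) * q)) (h3 : k * S ≤ 5 * bet k * D) (h4 : lg ≤ 2 * ops)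
    (h5 : ops ≤ bet k * S) :
    1000 * bet k * (k * q) + 1000 * bet k * S + 2000 * S + 2500 * lg
      + 31000 * (bet k * bet k) * ((k + 5) * q₀) ≤ 31000 * (bet k * bet k) * ((k + 5) * q) := by
  have hb : 136 ≤ bet k := by
    have := Nat.mul_le_mul hk hk
    rw [bet_eq]; omega
  have hkb : k ≤ bet k := by rw [bet_eq]; omega
  set B := bet k
  have hD : D ≤ 2 * k * q := by
    have : (k + 1) * (k + 1) ≤ 2 * k * k := by nlinarith
    have h6 : k * D ≤ k * (2 * k * q) := by nlinarith [Nat.mul_le_mul_right q this]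
    exact Nat.le_of_mul_le_mul_left h6 (by omega)
  have hS : S ≤ 10 * B * q := by
    have h6 : k * S ≤ k * (10 * B * q) := by nlinarith [Nat.mul_le_mul_left (5 * B) hD]
    exact Nat.le_of_mul_le_mul_left h6 (by omega)
  have hq : (k + 5) * q₀ + 2 * q ≤ (k + 5) * q := by
    have h6 : k * ((k + 5) * q₀ + 2 * q) ≤ k * ((k + 5) * q) := by nlinarith
    exact Nat.le_of_mul_le_mul_left h6 (by omega)
  have hq' := Nat.mul_le_mul_left (31000 * (B * B)) hq
  have e1 : 31000 * (B * B) * ((k + 5) * q₀ + 2 * q)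
      = 31000 * (B * B) * ((k + 5) * q₀) + 62000 * (B * B * q) := by ring
  have e2 : 1000 * B * (k * q) ≤ 1000 * (B * B * q) := by
    have := Nat.mul_le_mul_left (1000 * B) (Nat.mul_le_mul_right q hkb)
    calc _ ≤ _ := this
      _ = _ := by ring
  have e3 : B * S ≤ 10 * (B * B * q) := by
    calc _ ≤ _ := Nat.mul_le_mul_left B hS
      _ = _ := by ring
  have e4 : 136 * S ≤ B * S := Nat.mul_le_mul_right _ hb
  have e5 : 1000 * B * S = 1000 * (B * S) := by ring
  omega

end

/-! ### The insertion of an edge -/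

/-- Append the vertex in register `b` to the adjacency list of the vertex in register `a`. -/
def linkP (a b : ℕ) : Prog :=
  .store (addr 8 (idx (.reg a) (.load (addr 2 (.reg a))))) (.reg b) ;;
  .store (addr 2 (.reg a)) (.load (addr 2 (.reg a)) + .const 1)

/-- The insertion of the edge whose endpoints are in the registers `0` and `1`: repair the
sparsifier, and compute a new matching when the stored one has become too small. -/
def insertP : Prog :=
  .assign 3 (.reg 0) ;; .assign 4 (.reg 1) ;; linkP 3 4 ;; linkP 4 3 ;; satP ;; cascadeP ;;
  .ite (ltE ((.reg 33 + .const 5) * .reg 40) (.reg 39)) rebuildP .skip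

/-- The effect of `linkP`. -/
def link (u v : ℕ) (σ : St) : St :=
  { σ with adj := upd2 σ.adj u (σ.deg u) v, deg := Function.update σ.deg u (σ.deg u + 1) }

/-- The invariant between two insertions. -/
structure Ready (n k : ℕ) (κ : ℕ → Prop) (σ : St) : Prop extends Good n k κ σ where
  lim : Lim (bet k) σ
  pend : Pend k (fun _ _ => False) σ
  sp0 : σ.sp = 0
  clean : Clean σ
  matched : Matched n σ
  large : σ.dv ≤ (k + 5) * σ.ms

/-- The potential which pays for the running time: the three terms account for the changes of the
sparsifier, the scans, and the rebuilds. -/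
def potential (n k : ℕ) (σ : St) : ℕ :=
  1700 * (bet k * σ.ops) + 600 * scans n σ + 31000 * (bet k * bet k) * ((k + 5) * σ.ms)

section
variable {w n k : ℕ} {κ : ℕ → Prop} {σ : St} {τ : ℕ → ℕ} {Q : St → (ℕ → ℕ) → ℕ → Prop}
  {a b u v i x y z q : ℕ} {m c p s : ℕ → ℕ}

theorem adj_link : Adj (link u v σ) a b ↔ Adj σ a b ∨ (a = u ∧ b = v) := by
  by_cases h : a = u
  · subst h
    simp only [Adj, link, Function.update_self, upd2_apply, true_and]
    constructor
    · rintro ⟨i, hi, h⟩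
      split_ifs at h with h'
      · exact Or.inr h.symm
      · exact Or.inl ⟨i, by omega, h⟩
    · rintro (⟨i, hi, h⟩ | h)
      · exact ⟨i, by omega, by rw [if_neg (by omega)]; exact h⟩
      · exact ⟨σ.deg a, by omega, by rw [if_pos rfl]; exact h.symm⟩
  · simp only [Adj, link, Function.update_of_ne h, upd2_apply, h, false_and, if_false, or_false]

theorem Rn.link {ra rb : ℕ} (F : Fits w n k) (ha : ra < 32) (hb : rb < 32) (h3 : τ ra = u)
    (h4 : τ rb = v) (hu : u < n) (hd : σ.deg u < n * n)
    (h : ∀ t ≤ 200, Q (link u v σ) τ t) : Rn w n k (linkP ra rb) σ τ Q := by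
  have Bd := F.bounds
  have hev : ∀ σ' : St, (Expr.load (addr 2 (.reg ra))).eval w (enc n k σ' τ) = σ'.deg u :=
    fun σ' => eval_deg F (eval_tmp ha h3) (le_cap_of_lt F hu)
  refine Rn.seq (Rn.store_adj (x := v) F (eval_tmp ha h3) (hev σ) hu (by omega)
    (eval_tmp hb h4) fun c1 hc1 => ?_)
  refine Rn.store_deg F (x := σ.deg u + 1) (eval_tmp ha h3) (le_cap_of_lt F hu)
    (eval_add_one (hev _) (by show σ.deg u + 1 < _; omega)) fun c2 hc2 => ?_
  exact h _ (by omega)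

theorem adj_link_link : Adj (IncrementalMatching.link v u (IncrementalMatching.link u v σ)) a b ↔
    Adj σ a b ∨ (a = u ∧ b = v) ∨ (a = v ∧ b = u) := by
  rw [adj_link, adj_link, or_assoc]

theorem deg_link_link (huv : u ≠ v) :
    (IncrementalMatching.link v u (IncrementalMatching.link u v σ)).deg
      = Function.update (Function.update σ.deg u (σ.deg u + 1)) v (σ.deg v + 1) := by
  simp [IncrementalMatching.link, Function.update_of_ne huv.symm]

theorem Good.link (G : Good n k κ σ) (hu : u < n) (hv : v < n) (hκ : κ u ↔ ¬ κ v)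
    (hdu : σ.deg u < n * n) (hdv : σ.deg v < n * n) :
    Good n k κ (IncrementalMatching.link v u (IncrementalMatching.link u v σ)) := by
  have huv : u ≠ v := by rintro rfl; tauto
  refine ⟨G.dz, G.sym, fun a b h => adj_link_link.2 (Or.inl (G.sub a b h)), fun a b h => ?_,
    fun a b h => ?_, fun a b h => ?_, fun a => ?_, G.pot, G.cnts, G.cntT, G.lgs, G.dvs,
    G.logn, G.logd, G.stkn⟩
  · rw [adj_link_link] at h ⊢
    rcases h with h | h | h
    · exact Or.inl (G.adjs _ _ h)
    · exact Or.inr (Or.inr h.symm)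
    · exact Or.inr (Or.inl h.symm)
  · rcases adj_link_link.1 h with h | ⟨rfl, rfl⟩ | ⟨rfl, rfl⟩
    · exact G.adjn _ _ h
    · exact hu
    · exact hv
  · rcases adj_link_link.1 h with h | ⟨rfl, rfl⟩ | ⟨rfl, rfl⟩
    · exact G.bip _ _ h
    · exact hκ
    · tauto
  · rw [deg_link_link huv, Function.update_apply, Function.update_apply]
    have := G.degb a
    split_ifs <;> omega

theorem scans_le_link :
    scans n σ ≤ scans n (IncrementalMatching.link v u (IncrementalMatching.link u v σ)) := by
  refine Finset.sum_le_sum fun x _ => Nat.mul_le_mul_left _ ?_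
  simp only [IncrementalMatching.link, Function.update_apply]
  split_ifs <;> (simp_all; try omega)

/-- The specification of `insertP`, with amortized time `3000`. -/
theorem Rn.insert (F : Fits w n k) (R : Ready n k κ σ) (h0 : τ 0 = u) (h1 : τ 1 = v) (hu : u < n)
    (hv : v < n) (hκ : κ u ↔ ¬ κ v) (hdu : σ.deg u < n * n) (hdv : σ.deg v < n * n)
    (h : ∀ σ' τ' t, Ready n k κ σ' →
      (∀ a b, Adj σ' a b ↔ Adj σ a b ∨ (a = u ∧ b = v) ∨ (a = v ∧ b = u)) →
      σ'.deg = Function.update (Function.update σ.deg u (σ.deg u + 1)) v (σ.deg v + 1) →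
      t + potential n k σ ≤ potential n k σ' + 3000 → Q σ' τ' t) :
    Rn w n k insertP σ τ Q := by
  have Bd := F.bounds
  have hk : 64 ≤ k * k := Nat.mul_le_mul F.eight F.eight
  have huv : u ≠ v := by rintro rfl; tauto
  refine Rn.seq (Rn.assign (x := u) (by decide) (eval_tmp (by decide) h0) fun c1 hc1 => ?_)
  refine Rn.seq (Rn.assign (x := v) (by decide) (eval_tmp (by decide) (by simpa using h1))
    fun c2 hc2 => ?_)
  refine Rn.seq (Rn.link F (u := u) (v := v) (by decide) (by decide) (by simp) (by simp) hu hdu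
    fun t1 ht1 => ?_)
  refine Rn.seq (Rn.link F (u := v) (v := u) (by decide) (by decide) (by simp) (by simp) hv
    (by simpa [IncrementalMatching.link, Function.update_of_ne huv.symm] using hdv)
    fun t2 ht2 => ?_)
  have G1 := R.toGood.link hu hv hκ hdu hdv
  have hsc := scans_le_link (n := n) (u := u) (v := v) (σ := σ)
  have hadj := fun a b => adj_link_link (σ := σ) (u := u) (v := v) (a := a) (b := b)
  have hdeg := deg_link_link (σ := σ) huv
  have P1 : Pend k (fun a b => (a = u ∧ b = v) ∨ (a = v ∧ b = u))
      (IncrementalMatching.link v u (IncrementalMatching.link u v σ)) := by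
    intro a b hab
    rcases (hadj a b).1 hab with h2 | h2
    · rcases R.pend a b h2 with h3 | h3 | h3 | h3
      · exact Or.inl h3
      · exact Or.inr (Or.inl h3)
      · exact Or.inr (Or.inr (Or.inl h3))
      · exact h3.elim
    · exact Or.inr (Or.inr (Or.inr h2))
  have L1 : Lim (bet k) (IncrementalMatching.link v u (IncrementalMatching.link u v σ)) := R.lim
  have K1 : (IncrementalMatching.link v u (IncrementalMatching.link u v σ)).mt = σ.mt ∧
      (IncrementalMatching.link v u (IncrementalMatching.link u v σ)).col = σ.col ∧
      (IncrementalMatching.link v u (IncrementalMatching.link u v σ)).pr = σ.pr ∧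
      (IncrementalMatching.link v u (IncrementalMatching.link u v σ)).ms = σ.ms ∧
      (IncrementalMatching.link v u (IncrementalMatching.link u v σ)).lg = σ.lg ∧
      (IncrementalMatching.link v u (IncrementalMatching.link u v σ)).log = σ.log ∧
      (IncrementalMatching.link v u (IncrementalMatching.link u v σ)).ops = σ.ops ∧
      (IncrementalMatching.link v u (IncrementalMatching.link u v σ)).cnt = σ.cnt ∧
      (IncrementalMatching.link v u (IncrementalMatching.link u v σ)).sp = 0 :=
    ⟨rfl, rfl, rfl, rfl, rfl, rfl, rfl, rfl, R.sp0⟩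
  generalize IncrementalMatching.link v u (IncrementalMatching.link u v σ) = σ1 at *
  obtain ⟨kmt, kcol, kpr, kms, klg, klog, kops, kcnt, ksp⟩ := K1
  refine Rn.seq (Rn.sat F G1 L1 (u := u) (v := v) (by simp) (by simp)
    ((hadj u v).2 (Or.inr (Or.inl ⟨rfl, rfl⟩))) ?_)
  intro σ2 τ2 t3 G2 L2 E2 D2 hd2 _ ht3
  have P2 : Pend k (fun _ _ => False) σ2 := P1.sat E2 D2 hd2 fun a b hab => Or.inr hab
  refine Rn.seq (Rn.cascade F G2 L2 P2 ?_)
  intro σ3 τ3 t4 G3 L3 P3 K3 hsp3 ht4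
  have K := E2.keep.trans K3
  have hadj3 : ∀ a b, Adj σ3 a b ↔ Adj σ a b ∨ (a = u ∧ b = v) ∨ (a = v ∧ b = u) := fun a b => by
    rw [← hadj]; simp [Adj, K.deg, K.adj]
  have hdeg3 := K.deg.trans hdeg
  obtain ⟨δ, hδ, hsp2⟩ : ∃ δ, σ2.ops = σ.ops + δ ∧ σ2.sp ≤ δ :=
    ⟨σ2.ops - σ.ops, by have := E2.spo; omega, by have := E2.spo; omega⟩
  have hscan2 : scans n σ2 = scans n σ1 := by simp [scans, E2.cnt, E2.deg]
  have C3 : Clean σ3 := by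
    intro x hx
    rw [K.mt, K.col, K.pr, kmt, kcol, kpr] at hx
    obtain ⟨i, hi, hix⟩ := R.clean x hx
    rw [← klg] at hi
    exact ⟨i, hi.trans_le K.lg, by rw [K.log i hi, klog]; exact hix⟩
  have M3 : Matched n σ3 := by
    refine ⟨fun a b hab => ?_, ?_⟩
    · rw [K.mt, kmt] at hab ⊢
      rw [K.col, kcol, hadj3]
      obtain ⟨h2, h3, h4⟩ := R.matched.sym a b hab
      exact ⟨h2, Or.inl h3, h4⟩
    · rw [K.ms, K.mt, K.col, kms, kmt, kcol]; exact R.matched.card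
  have ms3 : σ3.ms = σ.ms := K.ms.trans kms
  have time : t3 + t4 + 1700 * (bet k * σ.ops) + 600 * scans n σ
      ≤ 1700 * (bet k * σ3.ops) + 600 * scans n σ3 + 200 := by
    rw [kops, hδ] at ht3
    rw [hδ, hscan2] at ht4
    have e1 : 1600 * bet k * (σ.ops + δ) = 1600 * bet k * σ.ops + 1600 * (bet k * δ) := by ring
    have e2 : 1700 * bet k * (σ.ops + δ) = 1700 * (bet k * σ.ops) + 1700 * (bet k * δ) := by ring
    have e3 : 128 * δ ≤ bet k * δ := Nat.mul_le_mul_right _ (by omega)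
    have e4 : 1700 * bet k * σ3.ops = 1700 * (bet k * σ3.ops) := by ring
    omega
  have hms : σ.ms ≤ n := by
    rw [R.matched.card]
    exact (Finset.card_filter_le _ _).trans (by simp)
  have hms5 : (k + 5) * σ.ms ≤ (k + 5) * n := Nat.mul_le_mul_left _ hms
  have hev := eval_lt_eq_zero F (e := (.reg 33 + .const 5) * .reg 40) (e' := .reg 39)
    (s := enc n k σ3 τ3) (x := (k + 5) * σ.ms) (y := σ3.dv) (by
      have e1 : (5 : ℕ) % 2 ^ w = 5 := Nat.mod_eq_of_lt (by omega)
      have e2 : (Expr.reg 33).eval w (enc n k σ3 τ3) = k := rfl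
      have e3 : (Expr.reg 40).eval w (enc n k σ3 τ3) = σ3.ms := rfl
      rw [eval_mul, eval_add, eval_const, e1, e2, e3, ms3, Nat.mod_eq_of_lt (a := k + 5) (by omega),
        Nat.mod_eq_of_lt (by omega)]) rfl
  refine Rn.ite (fun h0 c3 hc3 => ?_) (fun h0 c3 hc3 => ?_)
  · rw [Ne, hev] at h0
    refine Rn.rebuild F G3 L3 C3 hsp3 ?_
    intro m c p s q τ4 t5 M4 C4 hq ht5
    have hk8 := F.eight
    refine h _ _ _ ⟨G3.rebuilt, L3, fun a b hab => ?_, rfl, C4, M4, ?_⟩ hadj3 hdeg3 ?_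
    · have hfl : ∀ x, Flag k σ3 x → Flag k (rebuilt σ3 m c p s q) x := by
        rintro x (⟨i, hi, _⟩ | hx)
        · omega
        · exact Or.inr hx
      exact (P3 a b hab).imp_right (Or.imp (hfl a) (Or.imp_left (hfl b)))
    · show σ3.dv ≤ (k + 5) * q
      have h2 : (k + 1) * ((k + 1) * q) ≤ k * ((k + 5) * q) := by
        rw [← Nat.mul_assoc, ← Nat.mul_assoc]
        exact Nat.mul_le_mul_right _ (by ring_nf; omega)
      have h2 := hq.trans h2
      exact Nat.le_of_mul_le_mul_left h2 (by omega)
    · have h2 := rebuild_time (q₀ := σ.ms) hk8 (by omega) hq (G3.mul_sum_deg_le hk8 L3 P3 hsp3)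
        G3.lgs G3.ops_le_sum
      have h3 : potential n k (rebuilt σ3 m c p s q) = 1700 * (bet k * σ3.ops) + 600 * scans n σ3
        + 31000 * (bet k * bet k) * ((k + 5) * q) := rfl
      rw [h3]
      simp only [potential]
      omega
  · rw [hev] at h0
    refine Rn.skip (h _ _ _ ⟨G3, L3, P3, hsp3, C3, M3, by rw [ms3]; exact h0⟩ hadj3 hdeg3 ?_)
    simp only [potential, ms3]
    omega

end

/-! ### Matchings of the graph -/

/-- Weak duality: a vertex cover with weights at least `K` on every edge bounds matchings. -/
theorem mul_ncard_le {n K : ℕ} {G : SimpleGraph (Fin n)} {κ : ℕ → Prop} {y : ℕ → ℕ}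
    (hκ : ∀ a b : Fin n, G.Adj a b → (κ a ↔ ¬ κ b))
    (hy : ∀ a b : Fin n, G.Adj a b → K ≤ y a + y b) {M : G.Subgraph} (hM : M.IsMatching) :
    K * M.edgeSet.ncard ≤ ∑ v ∈ range n, y v := by
  classical
  -- The matching edges are counted at their endpoints in the class `κ`.
  have hex : ∀ v : Fin n, ∃ u, v ∈ M.verts → M.Adj v u := fun v => by
    by_cases hv : v ∈ M.verts
    · obtain ⟨u, hu, _⟩ := hM hv
      exact ⟨u, fun _ => hu⟩
    · exact ⟨v, fun h => absurd h hv⟩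
  choose f hf using hex
  set S : Finset (Fin n) := {v | v ∈ M.verts ∧ κ v} with hS
  have hSf : ∀ v ∈ S, M.Adj v (f v) ∧ κ v := fun v hv => by
    simp only [hS, Finset.mem_filter, Finset.mem_univ, true_and] at hv
    exact ⟨hf v hv.1, hv.2⟩
  have h1 : M.edgeSet ⊆ ((S.image fun v => s(v, f v) : Finset (Sym2 (Fin n))) : Set _) := by
    intro e he
    induction e with
    | _ a b =>
      have hab : M.Adj a b := he
      have key : ∀ a b, M.Adj a b → κ a → s(a, b) ∈ S.image fun v => s(v, f v) := by
        intro a b hab ha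
        refine Finset.mem_image.2 ⟨a, ?_, ?_⟩
        · simp [hS, M.edge_vert hab, ha]
        · rw [hM.eq_of_adj_left (hf a (M.edge_vert hab)) hab]
      rw [Finset.mem_coe]
      by_cases ha : κ a
      · exact key a b hab ha
      · rw [Sym2.eq_swap]
        refine key b a hab.symm ?_
        have := hκ a b hab.adj_sub
        tauto
  have h2 : M.edgeSet.ncard ≤ #S := by
    refine (Set.ncard_le_ncard h1 (Finset.finite_toSet _)).trans ?_
    rw [Set.ncard_coe_finset]
    exact Finset.card_image_le
  have hinj : Set.InjOn f S := fun a ha b hb hab =>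
    hM.eq_of_adj_right (hSf a ha).1 (hab ▸ (hSf b hb).1)
  have hdis : Disjoint S (S.image f) := by
    rw [Finset.disjoint_left]
    intro a ha ha'
    obtain ⟨b, hb, rfl⟩ := Finset.mem_image.1 ha'
    have := hκ b (f b) (hSf b hb).1.adj_sub
    have h3 := (hSf b hb).2
    have h4 := (hSf (f b) ha).2
    tauto
  calc K * M.edgeSet.ncard ≤ K * #S := Nat.mul_le_mul_left _ h2
    _ = ∑ v ∈ S, K := by simp [Nat.mul_comm]
    _ ≤ ∑ v ∈ S, (y v + y (f v)) :=
      Finset.sum_le_sum fun v hv => hy _ _ (hSf v hv).1.adj_sub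
    _ = ∑ v ∈ S, y v + ∑ v ∈ S.image f, y v := by
      rw [Finset.sum_add_distrib, Finset.sum_image hinj]
    _ = ∑ v ∈ S ∪ S.image f, y v := (Finset.sum_union hdis).symm
    _ ≤ ∑ v : Fin n, y v := Finset.sum_le_sum_of_subset (Finset.subset_univ _)
    _ = ∑ v ∈ range n, y v := Fin.sum_univ_eq_sum_range y n

section
variable {n k : ℕ} {κ : ℕ → Prop} {σ : St}

/-- The stored matching as a subgraph. -/
theorem Matched.exists_subgraph (M : Matched n σ) (hn : ∀ a b, Adj σ a b → a < n)
    {G : SimpleGraph (Fin n)} (hG : ∀ a b : Fin n, Adj σ a b ↔ G.Adj a b) (τ : ℕ → ℕ) :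
    ∃ H : G.Subgraph, H.IsMatching ∧ Stores (enc n k σ τ) H ∧ σ.ms ≤ H.edgeSet.ncard := by
  classical
  have hpart : ∀ v : Fin n, σ.mt v ≠ 0 → ∃ u : Fin n, σ.mt v = u + 1 := fun v hv => by
    have h1 := M.sym v (σ.mt v - 1) (by omega)
    have h2 := M.sym _ _ h1.1
    exact ⟨⟨σ.mt v - 1, hn _ _ h2.2.1⟩, by simp only; omega⟩
  refine ⟨⟨{v | σ.mt v ≠ 0}, fun v u => σ.mt v = u + 1, fun {v u} h => (hG v u).1 (M.sym _ _ h).2.1,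
    fun {v u} h => ?_, ⟨fun v u h => (M.sym _ _ h).1⟩⟩, fun v hv => ?_,
    fun v => ⟨fun u => ?_, ?_⟩, ?_⟩
  · show σ.mt v ≠ 0
    omega
  · obtain ⟨u, hu⟩ := hpart v hv
    refine ⟨u, hu, fun u' hu' => ?_⟩
    have : σ.mt v = u' + 1 := hu'
    exact Fin.ext (by omega)
  · have : (enc n k σ τ).mem v = σ.mt v := if_pos v.2
    rw [this]
  · have : (enc n k σ τ).mem v = σ.mt v := if_pos v.2
    rw [this]
    exact not_not.symm
  · choose! f hf using hpart
    set S : Finset (Fin n) := {v | σ.mt v ≠ 0 ∧ σ.col v = 2} with hS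
    have h1 : σ.ms = #S := by
      rw [M.card, ← Finset.card_map Fin.valEmbedding]
      congr 1
      ext v
      simp only [Finset.mem_filter, Finset.mem_range, Finset.mem_map, hS, Finset.mem_univ, true_and,
        Fin.valEmbedding_apply]
      constructor
      · rintro ⟨hv, h⟩
        exact ⟨⟨v, hv⟩, h, rfl⟩
      · rintro ⟨v, h, rfl⟩
        exact ⟨v.2, h⟩
    rw [h1, ← Set.ncard_coe_finset]
    refine Set.ncard_le_ncard_of_injOn (fun v => s(v, f v)) ?_ ?_ (Set.toFinite _)
    · intro v hv
      have hv' : σ.mt v ≠ 0 ∧ σ.col v = 2 := by simpa [hS] using hv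
      exact hf v hv'.1
    · intro a ha b hb hab
      have ha' : σ.mt a ≠ 0 ∧ σ.col a = 2 := by simpa [hS] using ha
      have hb' : σ.mt b ≠ 0 ∧ σ.col b = 2 := by simpa [hS] using hb
      rcases Sym2.eq_iff.1 hab with ⟨h, _⟩ | ⟨h, _⟩
      · exact h
      · have := (M.sym b (f b) (hf b hb'.1)).2.2.1 hb'.2
        rw [← h] at this
        exact absurd ha'.2 this

/-- The stored matching is almost as large as any matching. -/
theorem Ready.mul_ncard_le (R : Ready n k κ σ) (hk : 8 ≤ k) {G : SimpleGraph (Fin n)}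
    (hG : ∀ a b : Fin n, Adj σ a b ↔ G.Adj a b) {M : G.Subgraph} (hM : M.IsMatching) :
    k * ((k - 1) * M.edgeSet.ncard) ≤ (k + 1) * ((k + 5) * σ.ms) := by
  have h1 : (k - 1) * M.edgeSet.ncard ≤ σ.dv + k * dead n k σ := by
    rw [← R.toGood.sum_cover]
    refine IncrementalMatching.mul_ncard_le (κ := κ) (fun a b h => R.bip _ _ ((hG a b).2 h))
      (fun a b h => ?_) hM
    have := R.pend.cover R.sp0 ((hG a b).2 h)
    omega
  have h2 := R.toGood.dead_le hk R.lim R.pend R.sp0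
  have h3 := Nat.mul_le_mul_left k h1
  have h4 := Nat.mul_le_mul_left (k + 1) R.large
  rw [Nat.add_mul, Nat.one_mul] at h4
  rw [Nat.mul_add] at h3
  omega

theorem Ready.matchingNumber_le (R : Ready n k κ σ) (hk : 8 ≤ k) {G : SimpleGraph (Fin n)}
    (hG : ∀ a b : Fin n, Adj σ a b ↔ G.Adj a b) {ε : ℝ} (hε : 8 ≤ k * ε) :
    (1 - ε) * (matchingNumber G : ℝ) ≤ σ.ms := by
  have hmem : matchingNumber G ∈ {k | ∃ M : G.Subgraph, M.IsMatching ∧ M.edgeSet.ncard = k} := by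
    refine Nat.sSup_mem ⟨_, ⊥, fun v hv => hv.elim, rfl⟩ ⟨(Set.univ : Set (Sym2 (Fin n))).ncard, ?_⟩
    rintro _ ⟨M, _, rfl⟩
    exact Set.ncard_le_ncard (Set.subset_univ _) (Set.toFinite _)
  obtain ⟨M, hM, hcard⟩ := hmem
  have h1 := R.mul_ncard_le hk hG hM
  rw [hcard] at h1
  obtain ⟨j, rfl⟩ : ∃ j, k = j + 1 := ⟨k - 1, by omega⟩
  have h2 : ((j : ℝ) + 1) * (j * matchingNumber G) ≤ (j + 1 + 1) * ((j + 1 + 5) * σ.ms) := by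
    exact_mod_cast h1
  have hj : (7 : ℝ) ≤ j := by exact_mod_cast (by omega : 7 ≤ j)
  have hm : (0 : ℝ) ≤ matchingNumber G := Nat.cast_nonneg _
  have hs : (0 : ℝ) ≤ σ.ms := Nat.cast_nonneg _
  push_cast at hε
  rcases le_or_gt 1 ε with h | h
  · exact (mul_nonpos_of_nonpos_of_nonneg (by linarith) hm).trans hs
  -- With `k = j + 1`: the ratio is at least `k (k - 1) / ((k + 1) (k + 5)) ≥ 1 - 8 / k`.
  have h3 : (1 - ε) * (j + 1) ≤ j - 7 := by nlinarith
  have h4 : ((j : ℝ) - 7) * ((j + 2) * (j + 6)) ≤ (j + 1) * ((j + 1) * j) := by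
    nlinarith [mul_self_nonneg (j : ℝ)]
  have h5 : (1 - ε) * (j + 1) * ((j + 2) * (j + 6)) ≤ (j + 1) * ((j + 1) * j) :=
    (mul_le_mul_of_nonneg_right h3 (by positivity)).trans h4
  have h6 := mul_le_mul_of_nonneg_right h5 hm
  have h7 := mul_le_mul_of_nonneg_left h2 (by positivity : (0 : ℝ) ≤ j + 1)
  have h8 : (j + 1) * ((j + 2) * (j + 6)) * ((1 - ε) * (matchingNumber G : ℝ))
      ≤ (j + 1) * ((j + 2) * (j + 6)) * σ.ms := by linarith
  exact le_of_mul_le_mul_left h8 (by positivity)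

end

/-! ### The whole run -/

/-- From the numbers `n`, `p`, `q` in the registers `0`, `1`, `2` compute the parameter
`k = 8 * (q / p + 1)`, then `bet k`, `stride n k` and `thr k`. -/
def initP : Prog :=
  .assign 32 (.reg 0) ;;
  .assign 33 (.const 8 * (.op .div (.reg 2) (.reg 1) + .const 1)) ;;
  .assign 34 (.reg 33 * (.const 2 * .reg 33 + .const 1)) ;;
  .assign 35 (.reg 0 * .reg 0 + .reg 34) ;;
  .assign 36 (.const 4 * .reg 34 * .reg 34 * .reg 33)

/-- The data of the graph without edges. -/
def St.empty : St :=
  { mt := fun _ => 0, d := fun _ => 0, cnt := fun _ => 0, deg := fun _ => 0, stk := fun _ => 0,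
    log := fun _ => 0, col := fun _ => 0, pr := fun _ => 0, slot := fun _ _ => 0,
    adj := fun _ _ => 0, lg := 0, sp := 0, dv := 0, ms := 0, ops := 0 }

theorem exec_assign {w i x : ℕ} {e : Expr} {r m : ℕ → ℕ} (h : e.eval w ⟨r, m⟩ = x) :
    Exec w (.assign i e) ⟨r, m⟩ (e.cost + 1) ⟨Function.update r i x, m⟩ := by
  subst h
  exact Exec.assign i e _

/-- The initialization is run outside of `Rn`, since `enc` assumes that the parameters are in place.
-/
theorem exec_init {w n k p q : ℕ} (F : Fits w n k) (hk : k = 8 * (q / p + 1)) :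
    ∃ t ≤ 100, Exec w initP (startState n p q) t
      (enc n k St.empty (startState n p q).reg) := by
  have B := F.bounds
  have hthr : thr k = 4 * bet k * bet k * k := rfl
  have hst : stride n k = n * n + bet k := rfl
  have hB : bet k = k * (2 * k + 1) := rfl
  have hk1 : 1 ≤ k := by omega
  have hb1 : 1 ≤ bet k := by omega
  have h1 : 2 * k + 1 ≤ bet k := by rw [hB]; exact Nat.le_mul_of_pos_left _ (by omega)
  have h2 : 4 * bet k * bet k ≤ thr k := by rw [hthr]; exact Nat.le_mul_of_pos_right _ (by omega)
  have h3 : 4 * bet k ≤ 4 * bet k * bet k := Nat.le_mul_of_pos_right _ (by omega)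
  have hmod : ∀ x, x < 2 ^ w → x % 2 ^ w = x := fun x hx => Nat.mod_eq_of_lt hx
  set r := (startState n p q).reg with hr
  have e1 : (Expr.reg 0).eval w ⟨r, fun _ => 0⟩ = n := rfl
  have e2 : (Expr.const 8 * (Expr.op .div (.reg 2) (.reg 1) + .const 1)).eval w
      ⟨Function.update r 32 n, fun _ => 0⟩ = k := by
    have : (Expr.op .div (.reg 2) (.reg 1)).eval w ⟨Function.update r 32 n, fun _ => 0⟩ = q / p :=
      rfl
    rw [eval_mul, eval_add, eval_const, eval_const, this, hmod 8 (by omega), hmod 1 (by omega),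
      hmod (q / p + 1) (by omega), ← hk, hmod k (by omega)]
  have e3 : (Expr.reg 33 * (.const 2 * .reg 33 + .const 1)).eval w
      ⟨Function.update (Function.update r 32 n) 33 k, fun _ => 0⟩ = bet k := by
    have : (Expr.reg 33).eval w ⟨Function.update (Function.update r 32 n) 33 k, fun _ => 0⟩ = k :=
      rfl
    rw [eval_mul, eval_add, eval_mul, eval_const, eval_const, this, hmod 2 (by omega),
      hmod 1 (by omega), hmod (2 * k) (by omega), hmod (2 * k + 1) (by omega), ← hB,
      hmod _ (by omega)]
  have e4 : (Expr.reg 0 * .reg 0 + .reg 34).eval w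
      ⟨Function.update (Function.update (Function.update r 32 n) 33 k) 34 (bet k), fun _ => 0⟩
      = stride n k := by
    have h0 : (Expr.reg 0).eval w ⟨Function.update (Function.update (Function.update r 32 n) 33 k)
      34 (bet k), fun _ => 0⟩ = n := rfl
    have h34 : (Expr.reg 34).eval w ⟨Function.update (Function.update (Function.update r 32 n) 33 k)
      34 (bet k), fun _ => 0⟩ = bet k := rfl
    rw [eval_add, eval_mul, h0, h34, hmod (n * n) (by omega), ← hst, hmod _ (by omega)]
  have e5 : (Expr.const 4 * .reg 34 * .reg 34 * .reg 33).eval w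
      ⟨Function.update (Function.update (Function.update (Function.update r 32 n) 33 k) 34 (bet k))
        35 (stride n k), fun _ => 0⟩ = thr k := by
    have h33 : (Expr.reg 33).eval w ⟨Function.update (Function.update (Function.update
      (Function.update r 32 n) 33 k) 34 (bet k)) 35 (stride n k), fun _ => 0⟩ = k := rfl
    have h34 : (Expr.reg 34).eval w ⟨Function.update (Function.update (Function.update
      (Function.update r 32 n) 33 k) 34 (bet k)) 35 (stride n k), fun _ => 0⟩ = bet k := rfl
    rw [eval_mul, eval_mul, eval_mul, eval_const, h33, h34, hmod 4 (by omega),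
      hmod (4 * bet k) (by omega), hmod (4 * bet k * bet k) (by omega), ← hthr, hmod _ (by omega)]
  have hx := Exec.seq (exec_assign (i := 32) e1) (Exec.seq (exec_assign (i := 33) e2)
    (Exec.seq (exec_assign (i := 34) e3) (Exec.seq (exec_assign (i := 35) e4)
      (exec_assign (i := 36) e5))))
  have hfin : (⟨Function.update (Function.update (Function.update (Function.update
      (Function.update r 32 n) 33 k) 34 (bet k)) 35 (stride n k)) 36 (thr k), fun _ => 0⟩ : State)
      = enc n k St.empty r := by
    simp only [enc, State.mk.injEq]
    constructor
    · funext j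
      simp only [Function.update_apply]
      have hr0 : ∀ j, 2 < j → r j = 0 := fun j hj => by
        simp only [hr, startState]
        rw [if_neg (by omega), if_neg (by omega), if_neg (by omega)]
      by_cases h : j < 32
      · simp only [h, if_true]
        rw [if_neg (by omega), if_neg (by omega), if_neg (by omega), if_neg (by omega),
          if_neg (by omega)]
      · rw [if_neg h]
        split_ifs <;> first | rfl | omega | (rw [hr0 j (by omega)]; rfl)
    · funext a
      simp [cell, St.empty]
  rw [hfin] at hx
  exact ⟨_, Nat.le_of_ble_eq_true rfl, hx⟩

theorem ready_empty {n k : ℕ} (κ : ℕ → Prop) : Ready n k κ St.empty := by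
  have h0 : ∀ u v, ¬ Adj St.empty u v := fun u v ⟨i, hi, _⟩ => absurd hi (Nat.not_lt_zero _)
  have h1 : ∀ u, row St.empty u = 0 := fun u => rfl
  have hc : cov k 0 = 0 := by simp [cov]
  refine ⟨⟨fun _ _ => rfl, fun u v => by simp [h1], fun u v h => by simp [h1] at h,
    fun u v h => (h0 _ _ h).elim, fun u v h => (h0 _ _ h).elim, fun u v h => (h0 _ _ h).elim,
    fun u => Nat.zero_le _, by simp [St.empty], by simp [St.empty], fun u => Nat.zero_le _,
    le_rfl, by simp [St.empty, hc], fun i hi => absurd hi (Nat.not_lt_zero _),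
    fun v hv => absurd hv (Nat.not_lt_zero _), fun i hi => absurd hi (Nat.not_lt_zero _)⟩,
    fun u v h => by simp [h1] at h, fun u v h => (h0 _ _ h).elim, rfl,
    fun v hv => by simp [St.empty] at hv,
    ⟨fun u v h => by simp [St.empty] at h, by simp [St.empty]⟩,
    Nat.zero_le _⟩

/-- The edges in the list, as pairs of numbers in both orders. -/
def EdgeIn {n : ℕ} (es : List (Fin n × Fin n)) (a b : ℕ) : Prop :=
  ∃ x ∈ es, (a = (x.1 : ℕ) ∧ b = x.2) ∨ (a = (x.2 : ℕ) ∧ b = x.1)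

theorem edgeIn_take_succ {n : ℕ} {es : List (Fin n × Fin n)} {i : ℕ} (hi : i < es.length)
    (a b : ℕ) : EdgeIn (es.take (i + 1)) a b ↔ EdgeIn (es.take i) a b ∨
      (a = (es[i].1 : ℕ) ∧ b = es[i].2) ∨ (a = (es[i].2 : ℕ) ∧ b = es[i].1) := by
  rw [← List.take_append_getElem hi]
  simp only [EdgeIn, List.mem_append, List.mem_singleton]
  constructor
  · rintro ⟨x, hx | rfl, h⟩
    · exact Or.inl ⟨x, hx, h⟩
    · exact Or.inr h
  · rintro (⟨x, hx, h⟩ | h)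
    · exact ⟨x, Or.inl hx, h⟩
    · exact ⟨_, Or.inr rfl, h⟩

theorem edgeIn_iff {n : ℕ} {es : List (Fin n × Fin n)} (hne : ∀ x ∈ es, x.1 ≠ x.2) (a b : Fin n) :
    EdgeIn es a b ↔ (graphOf es).Adj a b := by
  simp only [graphOf, SimpleGraph.fromEdgeSet_adj, Set.mem_ofPred_eq, EdgeIn, Sym2.eq_iff]
  constructor
  · rintro ⟨x, hx, h⟩
    have := hne x hx
    rcases h with ⟨h1, h2⟩ | ⟨h1, h2⟩
    · obtain rfl := Fin.ext h1
      obtain rfl := Fin.ext h2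
      exact ⟨⟨x, hx, Or.inl ⟨rfl, rfl⟩⟩, this⟩
    · obtain rfl := Fin.ext h1
      obtain rfl := Fin.ext h2
      exact ⟨⟨x, hx, Or.inr ⟨rfl, rfl⟩⟩, this.symm⟩
  · rintro ⟨⟨x, hx, h⟩, _⟩
    refine ⟨x, hx, ?_⟩
    rcases h with ⟨rfl, rfl⟩ | ⟨rfl, rfl⟩
    · exact Or.inl ⟨rfl, rfl⟩
    · exact Or.inr ⟨rfl, rfl⟩

/-- What is known after `i` insertions when `T` time units have elapsed. -/
def Invariant {n : ℕ} (k : ℕ) (κ : ℕ → Prop) (es : List (Fin n × Fin n)) (i : ℕ) (s : State)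
    (T : ℕ) : Prop :=
  ∃ σ τ, s = enc n k σ τ ∧ Ready n k κ σ ∧ (∀ a b, Adj σ a b ↔ EdgeIn (es.take i) a b) ∧
    (∀ x, σ.deg x ≤ i) ∧ ∑ x ∈ range n, σ.deg x = 2 * i ∧ T ≤ potential n k σ + 3000 * i + 100

theorem request_enc {n k : ℕ} (σ : St) (τ : ℕ → ℕ) (u v : ℕ) :
    request (enc n k σ τ) u v
      = enc n k σ (Function.update (Function.update τ 0 u) 1 v) := by
  rw [← enc_tmp (by decide), ← enc_tmp (by decide)]
  rfl

theorem Invariant.step {w n k : ℕ} {κ : ℕ → Prop} {es : List (Fin n × Fin n)} (F : Fits w n k)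
    {i : ℕ} (hi : i < es.length) (hκ : ∀ x ∈ es, κ x.1 ↔ ¬ κ x.2) (hlen : es.length ≤ n * n)
    {s : State} {T : ℕ} (I : Invariant k κ es i s T) :
    ∃ t s', Exec w insertP (request s (es[i].1 : ℕ) (es[i].2 : ℕ)) t s' ∧
      Invariant k κ es (i + 1) s' (T + t) := by
  obtain ⟨σ, τ, rfl, R, hadj, hdeg, hsum, hT⟩ := I
  have hκi := hκ es[i] (List.getElem_mem hi)
  have hne : (es[i].1 : ℕ) ≠ es[i].2 := fun h => by rw [h] at hκi; tauto
  have hdu := hdeg es[i].1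
  have hdv := hdeg es[i].2
  rw [request_enc]
  have key : Rn w n k insertP σ
      (Function.update (Function.update τ 0 (es[i].1 : ℕ)) 1 (es[i].2 : ℕ))
      fun σ' τ' t => Invariant k κ es (i + 1) (enc n k σ' τ') (T + t) := by
    refine Rn.insert F R (u := es[i].1) (v := es[i].2) (by simp) (by simp) es[i].1.2 es[i].2.2 hκi
      (by omega) (by omega) ?_
    intro σ' τ' t R' hadj' hdeg' ht
    refine ⟨σ', τ', rfl, R', fun a b => ?_, fun x => ?_, ?_, by omega⟩
    · rw [hadj', hadj, edgeIn_take_succ hi]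
    · have := hdeg x
      rw [hdeg', Function.update_apply, Function.update_apply]
      split_ifs <;> omega
    · have h1 := sum_update es[i].1.2 (fun _ x => x) σ.deg (σ.deg es[i].1 + 1)
      have h2 := sum_update es[i].2.2 (fun _ x => x)
        (Function.update σ.deg (es[i].1 : ℕ) (σ.deg es[i].1 + 1)) (σ.deg es[i].2 + 1)
      rw [Function.update_of_ne hne.symm] at h2
      rw [hdeg']
      omega
  obtain ⟨t, σ', τ', h1, h2⟩ := key
  exact ⟨t, _, h1, h2⟩

/-- A run can be continued as long as the invariant can be maintained. -/
theorem exists_run {A : Algorithm} {w n p q : ℕ} {es : List (Fin n × Fin n)}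
    {I : ℕ → State → ℕ → Prop} {s₀ : State} {t₀ : ℕ} (h0 : Exec w A.init (startState n p q) t₀ s₀)
    (hI : I 0 s₀ t₀)
    (step : ∀ (i : ℕ) (hi : i < es.length) (s : State) (T : ℕ), I i s T →
      ∃ t s', Exec w A.insert (request s (es[i].1 : ℕ) (es[i].2 : ℕ)) t s' ∧ I (i + 1) s' (T + t)) :
    ∃ s t, IsRun A w n p q es s t ∧
      ∀ i ≤ es.length, I i (s i) (∑ j ∈ range (i + 1), t j) := by
  suffices H : ∀ m ≤ es.length, ∃ (s : ℕ → State) (t : ℕ → ℕ),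
      Exec w A.init (startState n p q) (t 0) (s 0) ∧
      (∀ (i : ℕ) (_ : i < m) (hi : i < es.length),
        Exec w A.insert (request (s i) (es[i].1 : ℕ) (es[i].2 : ℕ)) (t (i + 1)) (s (i + 1))) ∧
      ∀ i ≤ m, I i (s i) (∑ j ∈ range (i + 1), t j) by
    obtain ⟨s, t, h1, h2, h3⟩ := H _ le_rfl
    exact ⟨s, t, ⟨h1, fun i hi => h2 i hi hi⟩, h3⟩
  intro m
  induction m with
  | zero =>
    intro _
    refine ⟨fun _ => s₀, fun _ => t₀, h0, fun i hi => absurd hi (Nat.not_lt_zero _), fun i hi => ?_⟩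
    obtain rfl : i = 0 := by omega
    simpa using hI
  | succ m ih =>
    intro hm
    obtain ⟨s, t, h1, h2, h3⟩ := ih (by omega)
    obtain ⟨t', s', h4, h5⟩ := step m (by omega) _ _ (h3 m le_rfl)
    have hs : ∀ i ≤ m, Function.update s (m + 1) s' i = s i := fun i hi =>
      Function.update_of_ne (by omega) _ _
    have ht : ∀ i ≤ m, Function.update t (m + 1) t' i = t i := fun i hi =>
      Function.update_of_ne (by omega) _ _
    have hsum : ∀ i ≤ m, ∑ j ∈ range (i + 1), Function.update t (m + 1) t' j
        = ∑ j ∈ range (i + 1), t j := fun i hi =>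
      Finset.sum_congr rfl fun j hj => ht j (by have := Finset.mem_range.1 hj; omega)
    refine ⟨Function.update s (m + 1) s', Function.update t (m + 1) t', ?_, fun i hi hil => ?_,
      fun i hi => ?_⟩
    · rw [hs 0 (Nat.zero_le _), ht 0 (Nat.zero_le _)]
      exact h1
    · rcases Nat.lt_succ_iff_lt_or_eq.1 hi with h | rfl
      · rw [hs i h.le, hs (i + 1) h, ht (i + 1) h]
        exact h2 i h hil
      · rw [hs i le_rfl, Function.update_self, Function.update_self]
        exact h4
    · rcases Nat.le_succ_iff.1 hi with h | rfl
      · rw [hs i h, hsum i h]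
        exact h3 i h
      · rw [Finset.sum_range_succ, hsum m le_rfl, Function.update_self, Function.update_self]
        exact h5

/-- All numbers that occur are below a constant times `(n + q) ^ 5`, and `n + q ≥ 2`, so that the
exponent `40` absorbs the constant. -/
theorem fits_of_pow_le {w n k q : ℕ} (hn : 1 ≤ n) (hk : 8 ≤ k) (hkq : k ≤ 16 * q) (hq : 0 < q)
    (hw : (n + q) ^ 40 ≤ 2 ^ w) : Fits w n k := by
  refine ⟨hn, hk, le_trans ?_ hw⟩
  obtain ⟨N, hN⟩ : ∃ N, N = n + q := ⟨_, rfl⟩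
  rw [← hN]
  have hN2 : 2 ≤ N := by omega
  have h1 : n + 1 ≤ N := by omega
  have h2 : k ≤ 16 * N := by omega
  have hB : bet k ≤ 768 * N ^ 2 := by
    have h3 : k * k ≤ 16 * N * (16 * N) := Nat.mul_le_mul h2 h2
    have h4 : k ≤ k * k := Nat.le_mul_self k
    rw [bet_eq]
    have : 16 * N * (16 * N) = 256 * N ^ 2 := by ring
    omega
  have hs : stride n k ≤ 769 * N ^ 2 := by
    have h3 : n * n ≤ N * N := Nat.mul_le_mul (by omega) (by omega)
    have : N * N = N ^ 2 := by ring
    unfold stride; omega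
  have hc1 : (n + 1) * stride n k ≤ N * (769 * N ^ 2) := Nat.mul_le_mul h1 hs
  have hc2 : bet k * (bet k * n) ≤ 768 * N ^ 2 * (768 * N ^ 2 * N) :=
    Nat.mul_le_mul hB (Nat.mul_le_mul hB (by omega))
  have hc3 : thr k ≤ 4 * (768 * N ^ 2) * (768 * N ^ 2) * (16 * N) :=
    Nat.mul_le_mul (Nat.mul_le_mul (Nat.mul_le_mul_left 4 hB) hB) h2
  have hc4 : (k + 5) * (n + 1) ≤ (16 * N + 5 * N) * N := Nat.mul_le_mul (by omega) h1
  have e2 : 768 * N ^ 2 * (768 * N ^ 2 * N) = 589824 * N ^ 5 := by ring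
  have e3 : 4 * (768 * N ^ 2) * (768 * N ^ 2) * (16 * N) = 37748736 * N ^ 5 := by ring
  have e1 : N * (769 * N ^ 2) = 769 * N ^ 3 := by ring
  have e4 : (16 * N + 5 * N) * N = 21 * N ^ 2 := by ring
  have p1 : N ^ 3 ≤ N ^ 5 := Nat.pow_le_pow_right (by omega) (by omega)
  have p2 : N ^ 2 ≤ N ^ 5 := Nat.pow_le_pow_right (by omega) (by omega)
  have p3 : 1 ≤ N ^ 5 := Nat.one_le_pow _ _ (by omega)
  have p4 : 2 ^ 35 * N ^ 5 ≤ N ^ 40 := by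
    calc _ ≤ N ^ 35 * N ^ 5 := Nat.mul_le_mul_right _ (Nat.pow_le_pow_left hN2 _)
      _ = N ^ 40 := by ring
  unfold cap
  omega

/-- The total time, from the bounds `bet k * (bet k * n)`, `2 * m * thr k` and `n` for the number of
changes, the time of the scans and the size of the matching. -/
theorem time_le {n k m T : ℕ} {σ : St} {κ : ℕ → Prop} (hn : 1 ≤ n) (hk : 8 ≤ k)
    (R : Ready n k κ σ) (hsum : ∑ x ∈ range n, σ.deg x = 2 * m)
    (hT : T ≤ potential n k σ + 3000 * m + 100) :
    T ≤ 700000 * (k ^ 6 * n + k ^ 5 * m) := by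
  have hB : bet k ≤ 3 * k ^ 2 := by
    have : k * k = k ^ 2 := by ring
    have := Nat.le_mul_self k
    rw [bet_eq]; omega
  have h1 : bet k * σ.ops ≤ 3 * k ^ 2 * (3 * k ^ 2 * (3 * k ^ 2 * n)) :=
    Nat.mul_le_mul hB ((R.toGood.ops_le (R.lim.mono (Nat.le_succ _))).trans
      (Nat.mul_le_mul hB (Nat.mul_le_mul_right _ hB)))
  have h2 : scans n σ ≤ 4 * (3 * k ^ 2) * (3 * k ^ 2) * k * (2 * m) := by
    rw [← hsum, scans, Finset.mul_sum]
    refine Finset.sum_le_sum fun x _ => Nat.mul_le_mul_right _ ((R.cntT x).trans ?_)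
    exact Nat.mul_le_mul_right _ (Nat.mul_le_mul (Nat.mul_le_mul_left 4 hB) hB)
  have hms : σ.ms ≤ n := by
    rw [R.matched.card]
    exact (Finset.card_filter_le _ _).trans (by simp)
  have h3 : bet k * bet k * ((k + 5) * σ.ms) ≤ 3 * k ^ 2 * (3 * k ^ 2) * (2 * k * n) :=
    Nat.mul_le_mul (Nat.mul_le_mul hB hB) (Nat.mul_le_mul (by omega) hms)
  have e1 : 3 * k ^ 2 * (3 * k ^ 2 * (3 * k ^ 2 * n)) = 27 * (k ^ 6 * n) := by ring
  have e2 : 4 * (3 * k ^ 2) * (3 * k ^ 2) * k * (2 * m) = 72 * (k ^ 5 * m) := by ring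
  have e3 : 8 * (3 * k ^ 2 * (3 * k ^ 2) * (2 * k * n)) ≤ 18 * (k ^ 6 * n) := by
    calc _ ≤ k * (3 * k ^ 2 * (3 * k ^ 2) * (2 * k * n)) := Nat.mul_le_mul_right _ hk
      _ = _ := by ring
  have e4 : m ≤ k ^ 5 * m := Nat.le_mul_of_pos_left _ (by positivity)
  have e5 : n ≤ k ^ 6 * n := Nat.le_mul_of_pos_left _ (by positivity)
  have e6 : 31000 * (bet k * bet k) * ((k + 5) * σ.ms)
      = 31000 * (bet k * bet k * ((k + 5) * σ.ms)) := by ring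
  unfold potential at hT
  omega

end IncrementalMatching

open IncrementalMatching

theorem mainTheorem1 :
    ∃ (A : IncrementalMatching.Algorithm) (c : ℕ) (C : ℝ), 1 ≤ c ∧
      ∀ (ε : ℝ), 0 < ε → ε < 1 →
      ∀ (p q : ℕ), 0 < q → ε / 2 ≤ (p : ℝ) / q → (p : ℝ) / q ≤ ε →
      ∀ (n : ℕ), 1 ≤ n →
      ∀ (w : ℕ), (n + q) ^ c ≤ 2 ^ w →
      ∀ (es : List (Fin n × Fin n)), IncrementalMatching.IsInsertionSequence es →
        (IncrementalMatching.graphOf es).IsBipartite →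
      ∃ (s : ℕ → WordRAM.State) (t : ℕ → ℕ),
        IncrementalMatching.IsRun A w n p q es s t ∧
        (∀ i ≤ es.length, ∃ M : (IncrementalMatching.graphOf (es.take i)).Subgraph,
          M.IsMatching ∧ IncrementalMatching.Stores (s i) M ∧
          (1 - ε) * (IncrementalMatching.matchingNumber
            (IncrementalMatching.graphOf (es.take i)) : ℝ) ≤ (M.edgeSet.ncard : ℝ)) ∧
        ((∑ i ∈ Finset.range (es.length + 1), t i : ℕ) : ℝ)
          ≤ C * ((n : ℝ) / ε ^ 6 + (es.length : ℝ) / ε ^ 5) := by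
  refine ⟨⟨initP, insertP⟩, 40, 700000 * 24 ^ 6, by norm_num, ?_⟩
  intro ε hε hε1 p q hq hp1 hp2 n hn w hw es hes hbip
  have hq' : (0 : ℝ) < q := by exact_mod_cast hq
  have hp : 0 < p := by
    rcases Nat.eq_zero_or_pos p with rfl | h
    · simp at hp1; linarith
    · exact h
  have hp' : (0 : ℝ) < p := by exact_mod_cast hp
  obtain ⟨k, hk⟩ : ∃ k, k = 8 * (q / p + 1) := ⟨_, rfl⟩
  have hk8 : 8 ≤ k := hk ▸ Nat.le_mul_of_pos_right 8 (Nat.succ_pos _)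
  have hkq : k ≤ 16 * q := by
    have := Nat.div_le_self q p
    generalize q / p = j at *
    omega
  have hF := fits_of_pow_le hn hk8 hkq hq hw
  -- The parameter `k` lies between `8 / ε` and `24 / ε`.
  have hkε : 8 ≤ (k : ℝ) * ε := by
    have h1 : q < p * (q / p + 1) := by
      rw [Nat.mul_comm]; exact Nat.lt_mul_of_div_lt (Nat.lt_succ_self _) hp
    have h2 : (q : ℝ) < p * ((q / p : ℕ) + 1) := by exact_mod_cast h1
    have h3 : (k : ℝ) = 8 * ((q / p : ℕ) + 1) := by rw [hk]; push_cast; ring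
    have h4 : (p : ℝ) ≤ ε * q := by rwa [div_le_iff₀ hq'] at hp2
    have h5 : (0 : ℝ) ≤ (q / p : ℕ) + 1 := by positivity
    have h6 : (q : ℝ) * 1 < q * (ε * ((q / p : ℕ) + 1)) := by nlinarith
    have h7 := lt_of_mul_lt_mul_left h6 hq'.le
    rw [h3]; nlinarith
  have hk24 : (k : ℝ) ≤ 24 / ε := by
    have h1 : ((q / p : ℕ) : ℝ) ≤ (q : ℝ) / p := Nat.cast_div_le
    have h2 : (q : ℝ) / p ≤ 2 / ε := by
      rw [div_le_div_iff₀ hp' hε]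
      rw [div_le_div_iff₀ (by norm_num) hq'] at hp1
      linarith
    have h3 : (k : ℝ) = 8 * ((q / p : ℕ) + 1) := by rw [hk]; push_cast; ring
    have h4 : 1 ≤ 1 / ε := by rw [le_div_iff₀ hε]; linarith
    have h5 : 24 / ε = 8 * (2 / ε + 1 / ε) := by ring
    rw [h3, h5]; linarith
  obtain ⟨hne, hnd⟩ := hes
  -- This keeps the adjacency lists within their rows.
  have hlen : es.length ≤ n * n := by
    have := hnd.of_map.length_le_card
    simpa using this
  obtain ⟨col⟩ := hbip
  -- The bipartition of the final graph serves for all earlier graphs; only the analysis uses it.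
  set κ : ℕ → Prop := fun a => ∃ h : a < n, col ⟨a, h⟩ = 0 with hκdef
  have hκ : ∀ x ∈ es, κ x.1 ↔ ¬ κ x.2 := by
    intro x hx
    have hadj : (graphOf es).Adj x.1 x.2 := (edgeIn_iff hne _ _).1 ⟨x, hx, Or.inl ⟨rfl, rfl⟩⟩
    have h1 := col.valid hadj
    have h2 : ∀ v : Fin n, κ v ↔ col v = 0 := fun v => ⟨fun ⟨_, h⟩ => h, fun h => ⟨v.2, h⟩⟩
    rw [h2, h2]
    omega
  obtain ⟨t₀, ht₀, hinit⟩ := exec_init hF hk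
  have hI0 : Invariant k κ es 0 (enc n k St.empty (startState n p q).reg) t₀ := by
    refine ⟨St.empty, _, rfl, ready_empty κ, fun a b => ?_, fun x => le_rfl, by simp [St.empty],
      by omega⟩
    simp [EdgeIn, Adj, St.empty]
  obtain ⟨s, t, hrun, hI⟩ := exists_run (A := ⟨initP, insertP⟩) (I := Invariant k κ es) hinit hI0
    fun i hi s T I => I.step hF hi hκ hlen
  refine ⟨s, t, hrun, fun i hi => ?_, ?_⟩
  · obtain ⟨σ, τ, hs, R, hadj, -⟩ := hI i hi
    have hG : ∀ a b : Fin n, Adj σ a b ↔ (graphOf (es.take i)).Adj a b := fun a b => by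
      rw [hadj, edgeIn_iff fun x hx => hne x (List.mem_of_mem_take hx)]
    obtain ⟨M, hM, hst, hms⟩ := R.matched.exists_subgraph (k := k) R.adjn hG τ
    refine ⟨M, hM, hs ▸ hst, (R.matchingNumber_le hk8 hG hkε).trans ?_⟩
    exact_mod_cast hms
  · obtain ⟨σ, τ, -, R, -, -, hsum, hT⟩ := hI _ le_rfl
    have h1 := time_le hn hk8 R hsum hT
    have h2 : ((∑ i ∈ Finset.range (es.length + 1), t i : ℕ) : ℝ)
        ≤ 700000 * ((k : ℝ) ^ 6 * n + (k : ℝ) ^ 5 * es.length) := by exact_mod_cast h1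
    have h3 : (k : ℝ) ^ 6 * n ≤ (24 / ε) ^ 6 * n := by gcongr
    have h4 : (k : ℝ) ^ 5 * es.length ≤ (24 / ε) ^ 5 * es.length := by gcongr
    have h5 : (24 / ε) ^ 6 * n = 24 ^ 6 * (n / ε ^ 6) := by ring
    have h6 : (24 / ε) ^ 5 * es.length ≤ 24 ^ 6 * (es.length / ε ^ 5) := by
      have : (24 / ε) ^ 5 * es.length = 24 ^ 5 * (es.length / ε ^ 5) := by ring
      rw [this]
      gcongr <;> norm_num
    linarith
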